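/- **Setting.** Let $H$ be a real Hilbert space and $A$ a positive self-adjoint operator in $H$ with an orthonormal eigenbasis $(e_k)_{k\ge1}$, $Ae_k=\lambda_ke_k$, $0<\lambda_1\le\lambda_2\le\dots$, $\lambda_k\to\infty$. For $s\ge0$ let $F_s=D(A^s)$ with inner product $(v,w)_s=(A^sv,A^sw)$, so $F_0=H$; for $s<0$ let $F_s$ be the space of formal series $\sum c_ke_k$ with $\sum\lambda_k^{2s}c_k^2<\infty$. Let $\beta>0$, $\nu>0$, $0\le\omega<1$, $p\in H$. For $i=1,2$ let $\delta_i>0$ and let $\mu_i\in C^1(0,\infty)\cap L^1(0,\infty)\cap C[0,\infty)$ satisfy $\mu_i\ge0$ and $\mu_i'+\delta_i\mu_i\le0$ on $(0,\infty)$; assume that $\omega>0$ or $\mu_2\not\equiv0$. Let $M\in C^2([0,\infty))$ satisfy $\int_0^zM(\xi)\,d\xi\ge-az-b$ for all $z\ge0$, with some $a\in(0,\lambda_1)$, $b\in\mathbb R$. Let $$\mathcal H=F_1\times F_0\times F_0\times L^2_{\mu_1}(\mathbb R_+;F_1)\times L^2_{\mu_2}(\mathbb R_+;F_{1/2}),$$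 where $\|\xi\|^2_{L^2_\mu(\mathbb R_+;X)}=\int_0^\infty\mu(s)\|\xi(s)\|_X^2\,ds$. For $U=(u,w,v,\bar\eta,\eta)$ put $$\mathcal LU=\Bigl(w,\ -\beta A^2u-\int_0^\infty\mu_1(s)A^2\bar\eta(s)\,ds+\nu Av,\ -\omega Av-\int_0^\infty\mu_2(s)A\eta(s)\,ds-\nu Aw,\ -\bar\eta_s+w,\ -\eta_s+v\Bigr)$$ on the domain $D(\mathcal L)$ of those $U\in\mathcal H$ for which $w\in F_1$, $v\in F_{1/2}$, $\bar\eta_s\in L^2_{\mu_1}(\mathbb R_+;F_1)$, $\eta_s\in L^2_{\mu_2}(\mathbb R_+;F_{1/2})$ (distributional derivatives), $\bar\eta(0)=0$, $\eta(0)=0$, $\beta A^2u+\int_0^\infty\mu_1A^2\bar\eta\,ds-\nu Av\in F_0$ and $\omega Av+\int_0^\infty\mu_2A\eta\,ds\in F_0$. Put $$f(U)=\bigl(0,\,-M(\|A^{1/2}u\|^2)Au+p,\,0,\,0,\,0\bigr),$$ and, for $W\in\mathcal H$ with first component $w$, $$f'(U)W=\bigl(0,\,-2M'(\|A^{1/2}u\|^2)(Au,w)Au-M(\|A^{1/2}u\|^2)Aw,\,0,\,0,\,0\bigr).$$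 A mild solution of $\dot U=\mathcal LU+G(t,U)$, $U(0)=U_0$, is a function $U\in C([0,\infty);\mathcal H)$ with $U(t)=e^{t\mathcal L}U_0+\int_0^te^{(t-\tau)\mathcal L}G(\tau,U(\tau))\,d\tau$ for all $t\ge0$, where $e^{t\mathcal L}$ is the strongly continuous semigroup generated by $\mathcal L$. **Theorem.** The operator $\mathcal L$ generates a strongly continuous semigroup on $\mathcal H$, and for every $U_0\in\mathcal H$ the problem $\dot U=\mathcal LU+f(U)$, $U(0)=U_0$, has a unique mild solution $U(t)=:S_tU_0$, $t\ge0$. For each $t\ge0$ the map $U\mapsto S_tU$ is Fréchet differentiable on $\mathcal H$. Moreover, for all $U_0,W_0\in\mathcal H$ the linearized problem $$\dot W=\mathcal LW+f'(U(t))W,\qquad W(0)=W_0,\qquad U(t)=S_tU_0,$$ has a unique mild solution $W\in C([0,\infty);\mathcal H)$; it has the form $W(t)=(w(t),w_t(t),\xi(t),\tilde{\bar\eta}^t,\tilde\eta^t)$, i.e. its second component is the time derivative in $H$ of its first component; and $D[S_tU_0]W_0=W(t)$ for every $t\ge0$. -/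

import Mathlib

open Filter Topology MeasureTheory Set
open scoped NNReal ENNReal InnerProductSpace

noncomputable section

namespace ThermoPlate

variable {H : Type*} [NormedAddCommGroup H] [InnerProductSpace ℝ H]

/-! ### The operator `A` and the scale of spaces `F_s` -/

/-- The positive self-adjoint operator `A` in `H`, given by its orthonormal eigenbasis `e_k` and
its eigenvalues `0 < λ_k`, nondecreasing and tending to infinity (indices start at `0`).
A self-adjoint operator with an orthonormal eigenbasis is exactly the diagonal operator with
these eigenvalues on the maximal domain `{v | ∑ λ_k² (v, e_k)² < ∞}`. -/
structure DiagOp (H : Type*) [NormedAddCommGroup H] [InnerProductSpace ℝ H] where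
  /-- the eigenbasis -/
  e : HilbertBasis ℕ ℝ H
  /-- the eigenvalues -/
  eig : ℕ → ℝ
  eig_pos : ∀ k, 0 < eig k
  eig_mono : Monotone eig
  eig_tendsto : Tendsto eig atTop atTop

namespace DiagOp

variable (A : DiagOp H)

/-- `A^r v = ∑ λ_k^r (v, e_k) e_k`; meaningful for `v` in the domain of `A^r`, and used only
there. -/
def pow (r : ℝ) (v : H) : H := ∑' k, (A.eig k ^ r * ⟪A.e k, v⟫_ℝ) • A.e k

/-- `v ∈ D(A^s)` for `0 ≤ s`, i.e. `∑ λ_k^{2s} (v, e_k)² < ∞`. -/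
def MemF (s : ℝ≥0) (v : H) : Prop :=
  Summable fun k => A.eig k ^ (2 * (s : ℝ)) * ⟪A.e k, v⟫_ℝ ^ 2

theorem sq_coef (s : ℝ≥0) (v : H) (k : ℕ) :
    A.eig k ^ (2 * (s : ℝ)) * ⟪A.e k, v⟫_ℝ ^ 2
      = ‖A.eig k ^ (s : ℝ) * ⟪A.e k, v⟫_ℝ‖ ^ (2 : ℝ≥0∞).toReal := by
  have h : A.eig k ^ (2 * (s : ℝ)) = (A.eig k ^ (s : ℝ)) ^ 2 := by
    rw [mul_comm, Real.rpow_mul (A.eig_pos k).le]; norm_num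
  rw [h, ENNReal.toReal_ofNat, Real.rpow_two, Real.norm_eq_abs, sq_abs, mul_pow]

theorem memF_iff (s : ℝ≥0) (v : H) :
    A.MemF s v ↔ Memℓp (fun k => A.eig k ^ (s : ℝ) * ⟪A.e k, v⟫_ℝ) 2 := by
  rw [memℓp_gen_iff (by norm_num), MemF]
  simp only [sq_coef]

/-- `D(A^s)` as a linear subspace of `H`. -/
def domain (s : ℝ≥0) : Submodule ℝ H where
  carrier := {v | A.MemF s v}
  zero_mem' := by simp [MemF]
  add_mem' {v w} hv hw := by
    simp only [mem_ofPred_eq, memF_iff] at *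
    convert hv.add hw using 1
    funext k; simp [inner_add_right, mul_add]
  smul_mem' c v hv := by
    simp only [mem_ofPred_eq, memF_iff] at *
    convert hv.const_smul c using 1
    funext k; simp [real_inner_smul_right]; ring

/-- The space `F_s = D(A^s)`, `0 ≤ s`. It is not given the norm of `H` but the inner product
`(v, w)_s = (A^s v, A^s w)`, see below. -/
def F (s : ℝ≥0) : Type _ := A.domain s

instance (s : ℝ≥0) : AddCommGroup (A.F s) := inferInstanceAs (AddCommGroup (A.domain s))
instance (s : ℝ≥0) : Module ℝ (A.F s) := inferInstanceAs (Module ℝ (A.domain s))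

/-- The inclusion `F_s ⊆ H`. -/
def incl (s : ℝ≥0) : A.F s →ₗ[ℝ] H := (A.domain s).subtype

theorem incl_mem {s : ℝ≥0} (v : A.F s) : A.MemF s (A.incl s v) := Subtype.property v

theorem incl_injective (s : ℝ≥0) : Function.Injective (A.incl s) := Subtype.val_injective

theorem hasSum_pow {s : ℝ≥0} {v : H} (hv : A.MemF s v) :
    HasSum (fun k => (A.eig k ^ (s : ℝ) * ⟪A.e k, v⟫_ℝ) • A.e k)
      (A.e.repr.symm ⟨_, (A.memF_iff s v).1 hv⟩) :=
  A.e.hasSum_repr_symm ⟨_, (A.memF_iff s v).1 hv⟩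

theorem inner_pow {s : ℝ≥0} {v : H} (hv : A.MemF s v) (k : ℕ) :
    ⟪A.e k, A.pow s v⟫_ℝ = A.eig k ^ (s : ℝ) * ⟪A.e k, v⟫_ℝ := by
  rw [pow, (A.hasSum_pow hv).tsum_eq, ← A.e.repr_apply_apply, LinearIsometryEquiv.apply_symm_apply]

theorem ext_coef {v w : H} (h : ∀ k, ⟪A.e k, v⟫_ℝ = ⟪A.e k, w⟫_ℝ) : v = w := by
  apply A.e.repr.injective
  ext k
  rw [A.e.repr_apply_apply, A.e.repr_apply_apply, h]

/-- `A^s` as a linear bijection of `F_s` onto `H`. -/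
def powEquiv (s : ℝ≥0) : A.F s ≃ₗ[ℝ] H :=
  LinearEquiv.ofBijective
    { toFun := fun v => A.pow s (A.incl s v)
      map_add' := fun v w => A.ext_coef fun k => by
        rw [inner_add_right, A.inner_pow (A.incl_mem _), A.inner_pow (A.incl_mem _),
          A.inner_pow (A.incl_mem _), map_add, inner_add_right, mul_add]
      map_smul' := fun c v => A.ext_coef fun k => by
        rw [RingHom.id_apply, real_inner_smul_right, A.inner_pow (A.incl_mem _),
          A.inner_pow (A.incl_mem _), map_smul, real_inner_smul_right]; ring }
    (by
      have hp : ∀ k, 0 < A.eig k ^ (s : ℝ) := fun k => Real.rpow_pos_of_pos (A.eig_pos k) _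
      constructor
      · intro v w h
        apply A.incl_injective
        refine A.ext_coef fun k => ?_
        have h' := congrArg (fun x => ⟪A.e k, x⟫_ℝ) h
        simp only [LinearMap.coe_mk, AddHom.coe_mk, A.inner_pow (A.incl_mem _)] at h'
        exact mul_left_cancel₀ (hp k).ne' h'
      · intro h
        have hm : Memℓp (fun k => (A.eig k ^ (s : ℝ))⁻¹ * ⟪A.e k, h⟫_ℝ) 2 := by
          have h1 : Memℓp (fun k => (A.eig 0 ^ (s : ℝ))⁻¹ * ⟪A.e k, h⟫_ℝ) 2 := by
            have := (lp.memℓp (A.e.repr h)).const_smul ((A.eig 0 ^ (s : ℝ))⁻¹)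
            have he : (fun k => (A.eig 0 ^ (s : ℝ))⁻¹ * ⟪A.e k, h⟫_ℝ)
                = (A.eig 0 ^ (s : ℝ))⁻¹ • ⇑(A.e.repr h) := by
              funext k
              rw [Pi.smul_apply, A.e.repr_apply_apply, smul_eq_mul]
            rw [he]; exact this
          rw [memℓp_gen_iff (by norm_num)] at h1 ⊢
          refine h1.of_nonneg_of_le (fun k => by positivity) fun k => ?_
          have : (A.eig k ^ (s : ℝ))⁻¹ ≤ (A.eig 0 ^ (s : ℝ))⁻¹ :=
            inv_anti₀ (hp 0) (Real.rpow_le_rpow (A.eig_pos 0).le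
              (A.eig_mono (Nat.zero_le k)) s.2)
          have hk := (inv_pos.2 (hp k)).le
          have h0 := (inv_pos.2 (hp 0)).le
          refine Real.rpow_le_rpow (norm_nonneg _) ?_ (by norm_num)
          rw [norm_mul, norm_mul, Real.norm_of_nonneg hk, Real.norm_of_nonneg h0]
          gcongr
        set v : H := A.e.repr.symm ⟨_, hm⟩ with hv
        have hc : ∀ k, ⟪A.e k, v⟫_ℝ = (A.eig k ^ (s : ℝ))⁻¹ * ⟪A.e k, h⟫_ℝ := fun k => by
          rw [← A.e.repr_apply_apply, hv, LinearIsometryEquiv.apply_symm_apply]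
        have hc' : ∀ k, A.eig k ^ (s : ℝ) * ⟪A.e k, v⟫_ℝ = ⟪A.e k, h⟫_ℝ := fun k => by
          rw [hc, mul_inv_cancel_left₀ (hp k).ne']
        have hvm : A.MemF s v := by
          have he : (fun k => A.eig k ^ (s : ℝ) * ⟪A.e k, v⟫_ℝ) = ⇑(A.e.repr h) := by
            funext k
            rw [hc', A.e.repr_apply_apply]
          rw [memF_iff, he]
          exact lp.memℓp (A.e.repr h)
        refine ⟨(⟨v, hvm⟩ : A.domain s), A.ext_coef fun k => ?_⟩
        exact (A.inner_pow hvm k).trans (hc' k))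

theorem powEquiv_apply (s : ℝ≥0) (v : A.F s) : A.powEquiv s v = A.pow s (A.incl s v) := rfl

/-- The norm `‖v‖_s = ‖A^s v‖` of `F_s`. -/
instance (s : ℝ≥0) : NormedAddCommGroup (A.F s) :=
  NormedAddCommGroup.induced (A.F s) H (A.powEquiv s) (A.powEquiv s).injective

theorem norm_F (s : ℝ≥0) (v : A.F s) : ‖v‖ = ‖A.pow s (A.incl s v)‖ := rfl

/-- The inner product `(v, w)_s = (A^s v, A^s w)` of `F_s`. -/
instance (s : ℝ≥0) : InnerProductSpace ℝ (A.F s) where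
  norm_smul_le c v := by
    rw [A.norm_F, A.norm_F, ← powEquiv_apply, ← powEquiv_apply, map_smul, norm_smul]
  inner v w := ⟪A.pow s (A.incl s v), A.pow s (A.incl s w)⟫_ℝ
  norm_sq_eq_re_inner v := by
    rw [A.norm_F]; exact (real_inner_self_eq_norm_sq _).symm
  conj_inner_symm v w := by simp [real_inner_comm]
  add_left u v w := by
    have h : A.pow s (A.incl s (u + v)) = A.pow s (A.incl s u) + A.pow s (A.incl s v) :=
      map_add (A.powEquiv s) u v
    rw [h, inner_add_left]
  smul_left u v c := by
    have h : A.pow s (A.incl s (c • u)) = c • A.pow s (A.incl s u) :=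
      map_smul (A.powEquiv s) c u
    rw [h, real_inner_smul_left]; rfl

theorem inner_F (s : ℝ≥0) (v w : A.F s) :
    ⟪v, w⟫_ℝ = ⟪A.pow s (A.incl s v), A.pow s (A.incl s w)⟫_ℝ := rfl

/-- `A^s` as an isometry of `F_s` onto `H`. -/
def powIsometry (s : ℝ≥0) : A.F s ≃ₗᵢ[ℝ] H where
  toLinearEquiv := A.powEquiv s
  norm_map' _ := rfl

instance [CompleteSpace H] (s : ℝ≥0) : CompleteSpace (A.F s) :=
  (completeSpace_congr (e := (A.powIsometry s).toEquiv)
    (A.powIsometry s).isometry.isUniformEmbedding).2 inferInstance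

end DiagOp

/-! ### Memory kernels and memory spaces -/

/-- The conditions on a memory kernel `μ` with decay rate `δ`. -/
structure IsMemoryKernel (μ : ℝ → ℝ) (δ : ℝ) : Prop where
  contDiffOn : ContDiffOn ℝ 1 μ (Ioi 0)
  integrableOn : IntegrableOn μ (Ioi 0)
  continuousOn : ContinuousOn μ (Ici 0)
  nonneg : ∀ s, 0 ≤ s → 0 ≤ μ s
  deriv_le : ∀ s, 0 < s → deriv μ s + δ * μ s ≤ 0

/-- The measure `μ(s) ds` on `(0, ∞)`. -/
def memMeasure (μ : ℝ → ℝ) : Measure ℝ :=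
  (volume.restrict (Ioi 0)).withDensity fun s => ENNReal.ofReal (μ s)

/-- The weighted space `L²_μ(ℝ₊; X)`, with norm `(∫₀^∞ μ(s) ‖ξ(s)‖² ds)^{1/2}`. -/
abbrev MemSpace (μ : ℝ → ℝ) (X : Type*) [NormedAddCommGroup X] : Type _ :=
  Lp X 2 (memMeasure μ)

/-- `η` is (after modification on a null set) locally absolutely continuous with `η(0) = 0`, and
`g` is its distributional derivative `η_s`; both belong to `L²_μ(ℝ₊; X)`, so this says
`η ∈ D(T)` and `T η = - g`. Elements of `L²_μ` are functions only where `μ > 0`, which for a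
nonincreasing `μ` is an interval starting at `0`; nothing is required outside of it. -/
def HasMemDeriv {μ : ℝ → ℝ} {X : Type*} [NormedAddCommGroup X] [NormedSpace ℝ X]
    (η g : MemSpace μ X) : Prop :=
  ∀ᵐ s ∂(memMeasure μ), IntervalIntegrable g volume 0 s ∧ η s = ∫ y in (0 : ℝ)..s, g y

/-! ### The model and its phase space -/

/-- The data of the abstract thermoviscoelastic plate problem. -/
structure Plate (H : Type*) [NormedAddCommGroup H] [InnerProductSpace ℝ H] where
  A : DiagOp H
  β : ℝ
  ν : ℝ
  ω : ℝ
  μ₁ : ℝ → ℝ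
  μ₂ : ℝ → ℝ
  M : ℝ → ℝ
  p : H

namespace Plate

variable (P : Plate H)

/-- The phase space `F₁ × F₀ × F₀ × L²_{μ₁}(ℝ₊; F₁) × L²_{μ₂}(ℝ₊; F_{1/2})`, `F₀ = H`,
as a Hilbert product. -/
abbrev Phase : Type _ :=
  WithLp 2 (P.A.F 1 × WithLp 2 (H × WithLp 2 (H ×
    WithLp 2 (MemSpace P.μ₁ (P.A.F 1) × MemSpace P.μ₂ (P.A.F (1 / 2))))))

variable {P}

/-- The displacement component `u`. -/
def compU (U : P.Phase) : P.A.F 1 := U.fst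
/-- The velocity component `w`. -/
def compW (U : P.Phase) : H := U.snd.fst
/-- The temperature component `v`. -/
def compV (U : P.Phase) : H := U.snd.snd.fst
/-- The memory component of the displacement (`η` with a bar). -/
def compEtaBar (U : P.Phase) : MemSpace P.μ₁ (P.A.F 1) := U.snd.snd.snd.fst
/-- The memory component `η` of the temperature. -/
def compEta (U : P.Phase) : MemSpace P.μ₂ (P.A.F (1 / 2)) := U.snd.snd.snd.snd

variable (P)

/-- The element `(0, h, 0, 0, 0)` of the phase space. -/
def velocity (h : H) : P.Phase :=
  WithLp.toLp 2 (0, WithLp.toLp 2 (h, 0))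

/-- The graph of the operator `𝓛`: `P.LinOp U V` says that `U ∈ D(𝓛)` and `𝓛 U = V`, that is,
`w ∈ F₁`, `v ∈ F_{1/2}`, both memory components have derivatives in the memory spaces and vanish
at `s = 0`, and
* `V_u = w`,
* `V_w = -(β A² u + ∫ μ₁(s) A² ηbar(s) ds - ν A v)`,
* `V_v = -(ω A v + ∫ μ₂(s) A η(s) ds) - ν A w`,
* `V_ηbar = - ∂ₛ ηbar + w`, `V_η = - ∂ₛ η + v`.

The terms of the second and third line lie in spaces `F_{-s}` of formal series `∑ c_k e_k`, where
`A` acts by `c_k ↦ λ_k c_k` and equality means equality of all coefficients. As `V_w, V_v` are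
elements of `H`, the two identities contain the conditions
`β A² u + ∫ μ₁ A² ηbar - ν A v ∈ F₀` and `ω A v + ∫ μ₂ A η ∈ F₀` (note that `A w ∈ F₀`). -/
def LinOp (U V : P.Phase) : Prop :=
  ∃ (w : P.A.F 1) (v : P.A.F (1 / 2))
    (g₁ : MemSpace P.μ₁ (P.A.F 1)) (g₂ : MemSpace P.μ₂ (P.A.F (1 / 2))),
    P.A.incl 1 w = compW U ∧ P.A.incl (1 / 2) v = compV U ∧
    HasMemDeriv (compEtaBar U) g₁ ∧ HasMemDeriv (compEta U) g₂ ∧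
    compU V = w ∧
    (∀ k, ⟪P.A.e k, compW V⟫_ℝ =
      -(P.β * P.A.eig k ^ 2 * ⟪P.A.e k, P.A.incl 1 (compU U)⟫_ℝ
        + (∫ s, P.A.eig k ^ 2 * ⟪P.A.e k, P.A.incl 1 (compEtaBar U s)⟫_ℝ ∂(memMeasure P.μ₁))
        - P.ν * P.A.eig k * ⟪P.A.e k, compV U⟫_ℝ)) ∧
    (∀ k, ⟪P.A.e k, compV V⟫_ℝ =
      -(P.ω * P.A.eig k * ⟪P.A.e k, compV U⟫_ℝ
        + (∫ s, P.A.eig k * ⟪P.A.e k, P.A.incl (1 / 2) (compEta U s)⟫_ℝ ∂(memMeasure P.μ₂)))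
        - P.ν * P.A.eig k * ⟪P.A.e k, compW U⟫_ℝ) ∧
    (∀ᵐ s ∂(memMeasure P.μ₁), compEtaBar V s = -g₁ s + w) ∧
    (∀ᵐ s ∂(memMeasure P.μ₂), compEta V s = -g₂ s + v)

/-- The nonlinearity `f(U) = (0, -M(‖A^{1/2}u‖²) A u + p, 0, 0, 0)`. -/
def f (U : P.Phase) : P.Phase :=
  let u : H := P.A.incl 1 (compU U)
  P.velocity (-(P.M (‖P.A.pow (1 / 2) u‖ ^ 2) • P.A.pow 1 u) + P.p)

/-- The derivative `f'(U) W` of the nonlinearity at `U` in the direction `W`: its second component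
is `-2 M'(‖A^{1/2}u‖²) (A u, w) A u - M(‖A^{1/2}u‖²) A w`, with `u`, `w` the first components of
`U`, `W`; the others vanish. `M'` is the (at `0` one-sided) derivative of `M` on `[0, ∞)`. -/
def f' (U W : P.Phase) : P.Phase :=
  let u : H := P.A.incl 1 (compU U)
  let w : H := P.A.incl 1 (compU W)
  P.velocity
    (-((2 * derivWithin P.M (Ici 0) (‖P.A.pow (1 / 2) u‖ ^ 2) * ⟪P.A.pow 1 u, w⟫_ℝ)
        • P.A.pow 1 u)
      - P.M (‖P.A.pow (1 / 2) u‖ ^ 2) • P.A.pow 1 w)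

end Plate

/-! ### Semigroups and mild solutions -/

section Semigroup

variable {X : Type*} [NormedAddCommGroup X] [NormedSpace ℝ X]

/-- `(E t)_{t ≥ 0}` is a strongly continuous semigroup of bounded linear operators (the values at
negative times are irrelevant). -/
structure IsC0Semigroup (E : ℝ → X →L[ℝ] X) : Prop where
  zero : E 0 = ContinuousLinearMap.id ℝ X
  add : ∀ s t, 0 ≤ s → 0 ≤ t → E (s + t) = (E s).comp (E t)
  tendsto : ∀ x, Tendsto (fun t => E t x) (𝓝[>] 0) (𝓝 x)

/-- The operator with graph `L` is the infinitesimal generator of `E`: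
`L x y` holds if and only if `(E h x - x) / h → y` as `h ↓ 0`. -/
def IsGenerator (E : ℝ → X →L[ℝ] X) (L : X → X → Prop) : Prop :=
  ∀ x y, L x y ↔ Tendsto (fun h : ℝ => h⁻¹ • (E h x - x)) (𝓝[>] 0) (𝓝 y)

/-- `U : [0, ∞) → X` is continuous and is a mild solution of `U' = L U + G(t, U)`, `U(0) = U₀`,
where `L` generates the semigroup `E`, i.e.
`U(t) = E(t) U₀ + ∫₀ᵗ E(t - τ) G(τ, U(τ)) dτ` for all `t ≥ 0`. -/
def IsMildSolution (E : ℝ → X →L[ℝ] X) (G : ℝ → X → X) (U₀ : X) (U : ℝ → X) : Prop :=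
  ContinuousOn U (Ici 0) ∧
    ∀ t, 0 ≤ t → U t = E t U₀ + ∫ τ in (0 : ℝ)..t, E (t - τ) (G τ (U τ))

/-- `U` is the mild solution, unique on `[0, ∞)`. -/
def IsUniqueMildSolution (E : ℝ → X →L[ℝ] X) (G : ℝ → X → X) (U₀ : X) (U : ℝ → X) : Prop :=
  IsMildSolution E G U₀ U ∧ ∀ V, IsMildSolution E G U₀ V → ∀ t, 0 ≤ t → V t = U t

end Semigroup

end ThermoPlate

end

noncomputable section

namespace ThermoPlate

/-! ### Maximal dissipative operators: resolvents and Yosida approximations. -/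

section HilleYosida

/-! The system is a bounded-semigroup perturbation problem. In the energy norm, where the first
component is weighted by `β`, the operator is dissipative: the coupling terms with `ν` cancel, the
memory integrals cancel against the source terms `w` and `v` of the memory equations, and what
remains is `-ω‖v‖²` in `F_{1/2}` and two memory terms of good sign. The memory terms have this sign
because the resolvent of `-∂ₛ` is convolution with `exp (-l r)`, and Young's inequality with a
nonincreasing weight bounds it by `1/l` (`IsMemoryKernel.norm_le_of_hasMemDeriv`,
`IsMemoryKernel.inner_nonneg_of_hasMemDeriv`). The range condition reduces, after the two memory
equations and the equation for `u` are solved, to a 2×2 linear system for each eigenvector, with a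
bound summable over the modes (`exists_mode`, `Plate.exists_linOp`). The Hilbert space form of the
Hille–Yosida theorem then gives a contraction semigroup for the energy norm
(`IsMaxDissipative.isGenerator`, `Plate.exists_semigroup`).

The nonlinearity depends on `u` through `Au`, bounded on `F₁`, and through the quadratic form
`‖A^{1/2}u‖² = (Au, u)`. With `M` of class C² it is therefore Lipschitz on bounded sets and its
linearization has a quadratic remainder (`Plate.isLipOnBounded_f`, `Plate.isQuadraticDeriv_f`).
Truncation by a radial retraction makes it globally Lipschitz; Banach's fixed point theorem and an a
priori bound then give global mild solutions. The bound (`Plate.hasAPrioriBound_f`) comes from the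
energy, which does not increase along mild solutions. It controls `‖U‖` up to a multiple of `‖u‖` in
`H`, and `‖u‖` grows at most exponentially since its velocity is bounded by `‖U‖`.

Differentiability is a Gronwall argument (`IsBoundedSemigroup.hasFDerivAt_semiflow`): the difference
of two solutions minus the linearized solution obeys the linearized equation with a forcing
quadratic in the initial perturbation.

Mild solutions need not lie in the domain of the generator, so energy and displacement are
differentiated from the right, by restarting Duhamel's formula. That `u_t = w` holds for all mild
solutions follows from the domain by density (`Plate.tendsto_displacement`). -/

/-- The set of points of convergence of a bounded family of operators is closed. -/
theorem tendsto_apply_of_dense {ι X Y : Type*} [NormedAddCommGroup X] [NormedSpace ℝ X]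
    [NormedAddCommGroup Y] [NormedSpace ℝ Y] {l : Filter ι} {K : ℝ} {T : ι → X → Y} {S : X → Y}
    (hT : ∀ᶠ i in l, ∀ x y, ‖T i x - T i y‖ ≤ K * ‖x - y‖)
    (hS : ∀ x y, ‖S x - S y‖ ≤ K * ‖x - y‖)
    {D : Set X} (hD : Dense D) (h : ∀ x ∈ D, Tendsto (fun i => T i x) l (𝓝 (S x))) (x : X) :
    Tendsto (fun i => T i x) l (𝓝 (S x)) := by
  rw [Metric.tendsto_nhds]
  intro ε hε
  -- `K` may be zero or negative here, so it is replaced by a positive bound before dividing.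
  have hK : 0 < |K| + 1 := by positivity
  obtain ⟨y, hy, hxy⟩ := Metric.dense_iff.1 hD x (ε / (3 * (|K| + 1))) (by positivity)
  have hxy' : (|K| + 1) * ‖x - y‖ < ε / 3 := by
    rw [Metric.mem_ball', dist_eq_norm, lt_div_iff₀ (by positivity)] at hy
    linarith
  have hb : K * ‖x - y‖ < ε / 3 := by
    have : K * ‖x - y‖ ≤ (|K| + 1) * ‖x - y‖ :=
      mul_le_mul_of_nonneg_right (by linarith [le_abs_self K]) (norm_nonneg _)
    linarith
  have h1 := (Metric.tendsto_nhds.1 (h y hxy)) (ε / 3) (by positivity)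
  filter_upwards [h1, hT] with i hi hTi
  rw [dist_eq_norm] at hi ⊢
  have e : T i x - S x = (T i x - T i y) + (T i y - S y) + -(S x - S y) := by abel
  rw [e]
  have := hTi x y
  have := hS x y
  calc _ ≤ ‖T i x - T i y‖ + ‖T i y - S y‖ + ‖-(S x - S y)‖ := norm_add₃_le
    _ < ε := by rw [norm_neg]; linarith

variable {X : Type*} [NormedAddCommGroup X] [InnerProductSpace ℝ X]

/-- `L` is the graph of a linear dissipative operator such that all `l - L`, `0 < l`, are onto. -/
structure IsMaxDissipative (L : X → X → Prop) : Prop where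
  add : ∀ {x y x' y'}, L x y → L x' y' → L (x + x') (y + y')
  smul : ∀ (c : ℝ) {x y}, L x y → L (c • x) (c • y)
  eq_zero : ∀ {y}, L 0 y → y = 0
  dissipative : ∀ {x y}, L x y → ⟪x, y⟫_ℝ ≤ 0
  range : ∀ l : ℝ, 0 < l → ∀ z, ∃ x y, L x y ∧ l • x - y = z

namespace IsMaxDissipative

variable {L : X → X → Prop}

theorem sub (hL : IsMaxDissipative L) {x y x' y' : X} (h : L x y) (h' : L x' y') :
    L (x - x') (y - y') := by
  simpa [sub_eq_add_neg] using hL.add h (hL.smul (-1) h')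

theorem zero (hL : IsMaxDissipative L) : L 0 0 := by
  obtain ⟨x, y, h, -⟩ := hL.range 1 one_pos 0
  simpa using hL.smul 0 h

/-- Pair `l • x - y` with `x`: dissipativity gives at least `l * ‖x‖ ^ 2`, and Cauchy–Schwarz does
the rest. This bound gives both uniqueness and continuity of the resolvent. -/
theorem norm_le (hL : IsMaxDissipative L) {x y : X} (h : L x y) {l : ℝ} (hl : 0 < l) :
    ‖x‖ ≤ l⁻¹ * ‖l • x - y‖ := by
  have h1 : l * ‖x‖ ^ 2 ≤ ⟪x, l • x - y⟫_ℝ := by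
    rw [inner_sub_right, real_inner_smul_right, real_inner_self_eq_norm_sq]
    linarith [hL.dissipative h]
  have h2 := h1.trans (real_inner_le_norm _ _)
  rcases (norm_nonneg x).eq_or_lt with h0 | h0
  · rw [← h0]; positivity
  · rw [le_inv_mul_iff₀ hl]
    nlinarith

theorem unique (hL : IsMaxDissipative L) {x y x' y' : X} (h : L x y) (h' : L x' y') {l : ℝ}
    (hl : 0 < l)
    (e : l • x - y = l • x' - y') : x = x' := by
  have h1 := hL.norm_le (hL.sub h h') hl
  have e2 : l • (x - x') - (y - y') = 0 := by
    rw [smul_sub, sub_sub_sub_comm, e, sub_self]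
  rw [e2, norm_zero, mul_zero, norm_le_zero_iff] at h1
  exact sub_eq_zero.1 h1

theorem exists_resolvent (hL : IsMaxDissipative L) {l : ℝ} (hl : 0 < l) :
    ∃ R : X →L[ℝ] X, ‖R‖ ≤ l⁻¹ ∧
    ∀ z, L (R z) (l • R z - z) := by
  choose r y hr hz using hL.range l hl
  have hy : ∀ z, y z = l • r z - z := fun z => by
    have := hz z
    rw [eq_sub_iff_add_eq, ← sub_eq_iff_eq_add'.1 this]
  have hadd : ∀ a b, r (a + b) = r a + r b := fun a b => by
    refine hL.unique (hr _) (hL.add (hr a) (hr b)) hl ?_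
    rw [hz, smul_add, add_sub_add_comm, hz, hz]
  have hsmul : ∀ (c : ℝ) a, r (c • a) = c • r a := fun c a => by
    refine hL.unique (hr _) (hL.smul c (hr a)) hl ?_
    rw [hz, smul_comm, ← smul_sub, hz]
  refine ⟨LinearMap.mkContinuous { toFun := r, map_add' := hadd, map_smul' := hsmul } l⁻¹ ?_,
    LinearMap.mkContinuous_norm_le _ (by positivity) _, ?_⟩
  · intro z
    have := hL.norm_le (hr z) hl
    rwa [hz] at this
  · intro z
    have := hr z
    rw [hy] at this
    exact this

/-- The resolvent `(l - L)⁻¹`. -/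
def resolvent (hL : IsMaxDissipative L) (l : ℝ) : X →L[ℝ] X :=
  if hl : 0 < l then (hL.exists_resolvent hl).choose else 0

theorem norm_resolvent_le (hL : IsMaxDissipative L) {l : ℝ} (hl : 0 < l) : ‖hL.resolvent l‖ ≤ l⁻¹ := by
  rw [resolvent, dif_pos hl]; exact (hL.exists_resolvent hl).choose_spec.1

theorem resolvent_mem (hL : IsMaxDissipative L) {l : ℝ} (hl : 0 < l) (z : X) :
    L (hL.resolvent l z) (l • hL.resolvent l z - z) := by
  rw [resolvent, dif_pos hl]; exact (hL.exists_resolvent hl).choose_spec.2 z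

theorem resolvent_eq (hL : IsMaxDissipative L) {l : ℝ} (hl : 0 < l) {x y : X} (h : L x y) :
    hL.resolvent l (l • x - y) = x :=
  hL.unique (hL.resolvent_mem hl _) h hl (by simp)

theorem resolvent_identity (hL : IsMaxDissipative L) {l m : ℝ} (hl : 0 < l) (hm : 0 < m) (z : X) :
    (l - m) • hL.resolvent l (hL.resolvent m z) = hL.resolvent m z - hL.resolvent l z := by
  have h := hL.sub (hL.resolvent_mem hm z) (hL.resolvent_mem hl z)
  have h2 := hL.resolvent_eq hl h
  rw [← h2, ← map_smul]
  congr 1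
  module

/-- Exchanging `l` and `m` in the resolvent identity changes the sign of both the factor and the
right-hand side. -/
theorem commute_resolvent (hL : IsMaxDissipative L) {l m : ℝ} (hl : 0 < l) (hm : 0 < m) :
    Commute (hL.resolvent l) (hL.resolvent m) := by
  rcases eq_or_ne l m with rfl | hlm
  · exact Commute.refl _
  ext z
  simp only [mul_apply_eq_comp]
  have h1 := hL.resolvent_identity hl hm z
  have h2 := hL.resolvent_identity hm hl z
  have h3 : (l - m) • hL.resolvent l (hL.resolvent m z)
      = (l - m) • hL.resolvent m (hL.resolvent l z) := by
    rw [h1, ← neg_sub m l, neg_smul, h2, neg_sub]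
  exact smul_right_injective X (sub_ne_zero.2 hlm) h3

/-- A vector orthogonal to the domain has the form `x - y` with `L x y`. Pairing with `x` gives `‖x‖
^ 2 = ⟪x, y⟫ ≤ 0`, hence `x = 0` and `y = 0`. Completeness turns a trivial orthogonal complement
into density. -/
theorem dense_domain (hL : IsMaxDissipative L) [CompleteSpace X] : Dense {x | ∃ y, L x y} := by
  let D : Submodule ℝ X :=
    { carrier := {x | ∃ y, L x y}
      zero_mem' := ⟨0, hL.zero⟩
      add_mem' := fun ⟨y, h⟩ ⟨y', h'⟩ => ⟨_, hL.add h h'⟩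
      smul_mem' := fun c _ ⟨y, h⟩ => ⟨_, hL.smul c h⟩ }
  change Dense (D : Set X)
  rw [Submodule.dense_iff_topologicalClosure_eq_top, Submodule.topologicalClosure_eq_top_iff,
    Submodule.eq_bot_iff]
  intro z hz
  obtain ⟨x, y, h, rfl⟩ := hL.range 1 one_pos z
  have h1 : ⟪x, (1 : ℝ) • x - y⟫_ℝ = 0 := (Submodule.mem_orthogonal _ _).1 hz x ⟨y, h⟩
  rw [one_smul, inner_sub_right, real_inner_self_eq_norm_sq] at h1
  have h2 := hL.dissipative h
  have h3 : ‖x‖ = 0 := by nlinarith [norm_nonneg x, sq_nonneg ‖x‖]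
  rw [norm_eq_zero] at h3
  subst h3
  rw [hL.eq_zero h, smul_zero, sub_zero]

/-- The Yosida approximation `l (l (l - L)⁻¹ - 1)`. -/
def yosida (hL : IsMaxDissipative L) (l : ℝ) : X →L[ℝ] X :=
  (l ^ 2) • hL.resolvent l + (-l) • (1 : X →L[ℝ] X)

theorem commute_yosida (hL : IsMaxDissipative L) {l m : ℝ} (hl : 0 < l) (hm : 0 < m) :
    Commute (hL.yosida l) (hL.yosida m) := by
  unfold yosida
  refine Commute.add_left (Commute.add_right ?_ ?_) (Commute.add_right ?_ ?_)
  · exact ((hL.commute_resolvent hl hm).smul_left _).smul_right _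
  · exact ((Commute.one_right _).smul_left _).smul_right _
  · exact ((Commute.one_left _).smul_left _).smul_right _
  · exact ((Commute.one_left _).smul_left _).smul_right _

theorem yosida_apply (hL : IsMaxDissipative L) {l : ℝ} (hl : 0 < l) {x y : X} (h : L x y) :
    hL.yosida l x = l • hL.resolvent l y := by
  have := hL.resolvent_eq hl h
  rw [map_sub, map_smul] at this
  have e : hL.resolvent l y = l • hL.resolvent l x - x := by
    rw [eq_sub_iff_add_eq, ← sub_eq_iff_eq_add'.1 this]
  rw [e]
  simp only [yosida, add_apply, smul_apply,
    one_apply_eq_self]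
  module

theorem norm_smul_resolvent_le (hL : IsMaxDissipative L) {l : ℝ} (hl : 0 < l) (z : X) :
    ‖l • hL.resolvent l z‖ ≤ ‖z‖ := by
  have h := (hL.resolvent l).le_of_opNorm_le (hL.norm_resolvent_le hl) z
  rw [norm_smul, Real.norm_of_nonneg hl.le]
  rwa [le_inv_mul_iff₀ hl] at h

/-- On the domain the error is the resolvent applied to `y`, of size `1 / l`; the uniform bound `‖l
• R‖ ≤ 1` carries the limit to the closure. -/
theorem tendsto_smul_resolvent (hL : IsMaxDissipative L) [CompleteSpace X] (z : X) :
    Tendsto (fun l : ℝ => l • hL.resolvent l z) atTop (𝓝 z) := by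
  refine tendsto_apply_of_dense (T := fun l z => l • hL.resolvent l z) (S := fun z => z) (K := 1)
    ?_ ?_ hL.dense_domain ?_ z
  · filter_upwards [eventually_gt_atTop 0] with l hl x y
    rw [← smul_sub, ← map_sub, one_mul]
    exact hL.norm_smul_resolvent_le hl _
  · intro x y; rw [one_mul]
  · rintro x ⟨y, h⟩
    rw [tendsto_iff_norm_sub_tendsto_zero]
    have h0 : Tendsto (fun l : ℝ => l⁻¹ * ‖y‖) atTop (𝓝 0) := by
      simpa using tendsto_inv_atTop_zero.mul_const ‖y‖
    refine squeeze_zero' (Eventually.of_forall fun _ => norm_nonneg _) ?_ h0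
    filter_upwards [eventually_gt_atTop 0] with l hl
    have := hL.resolvent_eq hl h
    rw [map_sub, map_smul, sub_eq_iff_eq_add] at this
    rw [this, add_sub_cancel_left]
    exact (hL.resolvent l).le_of_opNorm_le (hL.norm_resolvent_le hl) y

theorem tendsto_yosida (hL : IsMaxDissipative L) [CompleteSpace X] {x y : X} (h : L x y) :
    Tendsto (fun l : ℝ => hL.yosida l x) atTop (𝓝 y) := by
  refine (hL.tendsto_smul_resolvent y).congr' ?_
  filter_upwards [eventually_gt_atTop 0] with l hl
  rw [hL.yosida_apply hl h]

/-- The path `s ↦ exp ((t - s) B) exp (s A) x` joins the two exponentials. As `A` and `B` commute,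
its derivative is a contraction applied to `A x - B x`. -/
theorem norm_exp_sub_le [CompleteSpace X] {A B : X →L[ℝ] X} (hAB : Commute A B)
    (hA : ∀ t : ℝ, 0 ≤ t → ‖NormedSpace.exp (t • A)‖ ≤ 1)
    (hB : ∀ t : ℝ, 0 ≤ t → ‖NormedSpace.exp (t • B)‖ ≤ 1) {t : ℝ} (ht : 0 ≤ t) (x : X) :
    ‖NormedSpace.exp (t • A) x - NormedSpace.exp (t • B) x‖ ≤ t * ‖A x - B x‖ := by
  have hd : ∀ s : ℝ, HasDerivAt
      (fun s : ℝ => (NormedSpace.exp ((t - s) • B) * NormedSpace.exp (s • A)) x)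
      ((NormedSpace.exp ((t - s) • B) * NormedSpace.exp (s • A)) (A x - B x)) s := by
    intro s
    have h1 : HasDerivAt (fun s : ℝ => NormedSpace.exp (s • A))
        (NormedSpace.exp (s • A) * A) s := hasDerivAt_exp_smul_const A s
    have h2 : HasDerivAt (fun s : ℝ => NormedSpace.exp ((t - s) • B))
        (-(NormedSpace.exp ((t - s) • B) * B)) s := by
      have := (hasDerivAt_exp_smul_const B (t - s)).scomp s ((hasDerivAt_id s).const_sub t)
      simpa [Function.comp_def] using this
    have h3 := (h2.mul h1).clm_apply (hasDerivAt_const s x)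
    refine h3.congr_deriv ?_
    have hc : B * NormedSpace.exp (s • A) = NormedSpace.exp (s • A) * B :=
      (((hAB.symm.smul_right s).exp_right) : _)
    simp only [map_zero, add_zero, add_apply, neg_mul, mul_assoc, hc,
      neg_apply, mul_apply_eq_comp, map_sub]
    abel
  have hbd : ∀ s ∈ Ico (0 : ℝ) t,
      ‖(NormedSpace.exp ((t - s) • B) * NormedSpace.exp (s • A)) (A x - B x)‖ ≤ ‖A x - B x‖ := by
    intro s hs
    have h1 : ‖NormedSpace.exp ((t - s) • B) * NormedSpace.exp (s • A)‖ ≤ 1 :=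
      (norm_mul_le _ _).trans (mul_le_one₀ (hB _ (by linarith [hs.2])) (norm_nonneg _) (hA _ hs.1))
    simpa using ContinuousLinearMap.le_of_opNorm_le _ h1 (A x - B x)
  have := norm_image_sub_le_of_norm_deriv_le_segment' (fun s _ => (hd s).hasDerivWithinAt) hbd t
    (right_mem_Icc.2 ht)
  simpa [mul_comm] using this

theorem inner_yosida_le (hL : IsMaxDissipative L) {l : ℝ} (hl : 0 < l) (z : X) :
    ⟪z, hL.yosida l z⟫_ℝ ≤ 0 := by
  have e : hL.yosida l z = l • (l • hL.resolvent l z - z) := by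
    simp only [yosida, add_apply, smul_apply, one_apply_eq_self]
    module
  rw [e, real_inner_smul_right, inner_sub_right, real_inner_self_eq_norm_sq]
  have h1 := real_inner_le_norm z (l • hL.resolvent l z)
  have h2 := mul_le_mul_of_nonneg_left (hL.norm_smul_resolvent_le hl z) (norm_nonneg z)
  exact mul_nonpos_of_nonneg_of_nonpos hl.le (by nlinarith)

/-- The Yosida approximations inherit dissipativity, so the squared norm of an orbit is
nonincreasing. -/
theorem norm_exp_yosida_le [CompleteSpace X] (hL : IsMaxDissipative L) {l : ℝ} (hl : 0 < l)
    {t : ℝ} (ht : 0 ≤ t) : ‖NormedSpace.exp (t • hL.yosida l)‖ ≤ 1 := by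
  refine ContinuousLinearMap.opNorm_le_bound _ zero_le_one fun x => ?_
  have hd : ∀ s : ℝ, HasDerivAt (fun s : ℝ => NormedSpace.exp (s • hL.yosida l) x)
      (hL.yosida l (NormedSpace.exp (s • hL.yosida l) x)) s := by
    intro s
    have := (hasDerivAt_exp_smul_const' (𝕂 := ℝ) (hL.yosida l) s).clm_apply (hasDerivAt_const s x)
    simpa using this
  have ha : Antitone fun s : ℝ => ‖NormedSpace.exp (s • hL.yosida l) x‖ ^ 2 := by
    refine antitone_of_hasDerivAt_nonpos (fun s => (hd s).norm_sq) fun s => ?_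
    have := hL.inner_yosida_le hl (NormedSpace.exp (s • hL.yosida l) x)
    simp only [Pi.zero_apply]
    linarith
  have h0 := ha ht
  simp only [zero_smul, NormedSpace.exp_zero, one_apply_eq_self] at h0
  rw [one_mul]
  exact (sq_le_sq₀ (norm_nonneg _) (norm_nonneg _)).1 h0

end IsMaxDissipative
end HilleYosida

end ThermoPlate

namespace ThermoPlate

/-! ### The generated contraction semigroup as the limit of the Yosida semigroups. -/

section HilleYosida
variable {X : Type*} [NormedAddCommGroup X] [InnerProductSpace ℝ X]
namespace IsMaxDissipative
variable {L : X → X → Prop}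

/-- The semigroup generated by the Yosida approximation `n + 1`. -/
def approx (hL : IsMaxDissipative L) (n : ℕ) (t : ℝ) : X →L[ℝ] X :=
  NormedSpace.exp (t • hL.yosida (n + 1))

theorem norm_approx_le [CompleteSpace X] (hL : IsMaxDissipative L) (n : ℕ) {t : ℝ} (ht : 0 ≤ t) :
    ‖hL.approx n t‖ ≤ 1 :=
  hL.norm_exp_yosida_le (by positivity) ht

theorem norm_approx_sub_le [CompleteSpace X] (hL : IsMaxDissipative L) (n m : ℕ) {t : ℝ}
    (ht : 0 ≤ t) (x : X) : ‖hL.approx n t x - hL.approx m t x‖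
      ≤ t * ‖hL.yosida (n + 1) x - hL.yosida (m + 1) x‖ :=
  norm_exp_sub_le (hL.commute_yosida (by positivity) (by positivity))
    (fun _ h => hL.norm_approx_le n h) (fun _ h => hL.norm_approx_le m h) ht x

theorem tendsto_yosida_nat [CompleteSpace X] (hL : IsMaxDissipative L) {x y : X} (h : L x y) :
    Tendsto (fun n : ℕ => hL.yosida (n + 1) x) atTop (𝓝 y) :=
  (hL.tendsto_yosida h).comp (tendsto_natCast_atTop_atTop.atTop_add tendsto_const_nhds)

/-- On the domain the Yosida approximations converge, so their exponentials are Cauchy by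
`norm_approx_sub_le`; contractivity extends this to all `x`. -/
theorem exists_limit_approx [CompleteSpace X] (hL : IsMaxDissipative L) {t : ℝ} (ht : 0 ≤ t)
    (x : X) : ∃ z, Tendsto (fun n => hL.approx n t x) atTop (𝓝 z) := by
  apply cauchySeq_tendsto_of_complete
  rw [Metric.cauchySeq_iff']
  intro ε hε
  obtain ⟨x', hx', y, hy⟩ := Metric.dense_iff.1 hL.dense_domain x (ε / 4) (by positivity)
  rw [Metric.mem_ball', dist_eq_norm] at hx'
  have hc := (hL.tendsto_yosida_nat hy).cauchySeq
  -- The denominator contains `t + 1` rather than `t` to allow `t = 0`.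
  obtain ⟨N, hN⟩ := Metric.cauchySeq_iff'.1 hc (ε / (4 * (t + 1))) (by positivity)
  refine ⟨N, fun n hn => ?_⟩
  have h1 := hN n hn
  rw [dist_eq_norm, lt_div_iff₀ (by positivity)] at h1
  rw [dist_eq_norm]
  have h2 := hL.norm_approx_sub_le n N ht x'
  have h3 : ∀ k, ‖hL.approx k t (x - x')‖ ≤ ‖x - x'‖ := fun k => by
    simpa using (hL.approx k t).le_of_opNorm_le (hL.norm_approx_le k ht) (x - x')
  have e : hL.approx n t x - hL.approx N t x = hL.approx n t (x - x')
      + (hL.approx n t x' - hL.approx N t x') + -(hL.approx N t (x - x')) := by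
    simp only [map_sub]; abel
  have h4 : t * ‖hL.yosida (n + 1) x' - hL.yosida (N + 1) x'‖ ≤
      (t + 1) * ‖hL.yosida (n + 1) x' - hL.yosida (N + 1) x'‖ := by
    gcongr; linarith
  rw [e]
  calc _ ≤ ‖hL.approx n t (x - x')‖ + ‖hL.approx n t x' - hL.approx N t x'‖
        + ‖-(hL.approx N t (x - x'))‖ := norm_add₃_le
    _ < ε := by rw [norm_neg]; linarith [h3 n, h3 N]

/-- The semigroup generated by `L`, extended by the identity to negative times. -/
def semigroup [CompleteSpace X] (hL : IsMaxDissipative L) (t : ℝ) : X →L[ℝ] X :=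
  continuousLinearMapOfTendsto (l := atTop) (fun n => hL.approx n (max t 0))
    (f := fun x => (hL.exists_limit_approx (le_max_right t 0) x).choose)
    (tendsto_pi_nhds.2 fun x => (hL.exists_limit_approx (le_max_right t 0) x).choose_spec)

theorem tendsto_approx [CompleteSpace X] (hL : IsMaxDissipative L) {t : ℝ} (ht : 0 ≤ t)
    (x : X) : Tendsto (fun n => hL.approx n t x) atTop (𝓝 (hL.semigroup t x)) := by
  have h := (hL.exists_limit_approx (le_max_right t 0) x).choose_spec
  have e : max t 0 = t := max_eq_left ht
  simp only [e] at h
  convert h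
  simp only [semigroup, e]
  rfl

theorem semigroup_max [CompleteSpace X] (hL : IsMaxDissipative L) (t : ℝ) :
    hL.semigroup (max t 0) = hL.semigroup t := by
  simp only [semigroup, max_assoc, max_self]

theorem norm_semigroup_apply_le [CompleteSpace X] (hL : IsMaxDissipative L) (t : ℝ) (x : X) :
    ‖hL.semigroup t x‖ ≤ ‖x‖ := by
  rw [← hL.semigroup_max]
  refine le_of_tendsto (hL.tendsto_approx (le_max_right t 0) x).norm (Eventually.of_forall ?_)
  intro n
  simpa using (hL.approx n (max t 0)).le_of_opNorm_le (hL.norm_approx_le n (le_max_right t 0)) x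

theorem semigroup_zero [CompleteSpace X] (hL : IsMaxDissipative L) :
    hL.semigroup 0 = ContinuousLinearMap.id ℝ X := by
  ext x
  refine tendsto_nhds_unique (hL.tendsto_approx le_rfl x) ?_
  simp [approx, NormedSpace.exp_zero]

theorem approx_add [CompleteSpace X] (hL : IsMaxDissipative L) (n : ℕ) (s t : ℝ) (x : X) :
    hL.approx n (s + t) x = hL.approx n s (hL.approx n t x) := by
  let i : NormedAlgebra ℚ (X →L[ℝ] X) := NormedAlgebra.restrictScalars ℚ ℝ (X →L[ℝ] X)
  rw [approx, add_smul, NormedSpace.exp_add_of_commute]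
  · rfl
  · exact ((Commute.refl _).smul_left _).smul_right _

theorem semigroup_add [CompleteSpace X] (hL : IsMaxDissipative L) {s t : ℝ} (hs : 0 ≤ s)
    (ht : 0 ≤ t) : hL.semigroup (s + t) = (hL.semigroup s).comp (hL.semigroup t) := by
  ext x
  refine tendsto_nhds_unique (hL.tendsto_approx (add_nonneg hs ht) x) ?_
  simp only [hL.approx_add, ContinuousLinearMap.comp_apply]
  have h1 := hL.tendsto_approx hs (hL.semigroup t x)
  refine h1.congr_dist ?_
  refine squeeze_zero (fun _ => dist_nonneg) (fun n => ?_)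
    (tendsto_iff_dist_tendsto_zero.1 (hL.tendsto_approx ht x))
  rw [dist_comm, dist_eq_norm, dist_eq_norm, ← map_sub]
  simpa using (hL.approx n s).le_of_opNorm_le (hL.norm_approx_le n hs)
    (hL.approx n t x - hL.semigroup t x)

theorem norm_approx_sub_semigroup_le [CompleteSpace X] (hL : IsMaxDissipative L) (n : ℕ) {t : ℝ}
    (ht : 0 ≤ t) {x y : X} (h : L x y) :
    ‖hL.approx n t x - hL.semigroup t x‖ ≤ t * ‖hL.yosida (n + 1) x - y‖ :=
  le_of_tendsto_of_tendsto (tendsto_const_nhds.sub (hL.tendsto_approx ht x)).norm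
    ((tendsto_const_nhds.sub (hL.tendsto_yosida_nat h)).norm.const_mul t)
    (Eventually.of_forall fun m => hL.norm_approx_sub_le n m ht x)

/-- The difference quotients of the limit differ from those of the `n`-th approximation by at most
`‖yosida x - y‖`, uniformly in `t`. Thus `n` can be fixed first and `t` sent to zero afterwards. -/
theorem tendsto_slope [CompleteSpace X] (hL : IsMaxDissipative L) {x y : X} (h : L x y) :
    Tendsto (fun t : ℝ => t⁻¹ • (hL.semigroup t x - x)) (𝓝[>] 0) (𝓝 y) := by
  rw [Metric.tendsto_nhds]
  intro ε hε
  obtain ⟨n, hn⟩ := ((Metric.tendsto_nhds.1 (hL.tendsto_yosida_nat h)) (ε / 3)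
    (by positivity)).exists
  rw [dist_eq_norm] at hn
  have hd : HasDerivAt (fun s : ℝ => hL.approx n s x) (hL.yosida (n + 1) x) 0 := by
    have := (hasDerivAt_exp_smul_const' (𝕂 := ℝ) (hL.yosida (n + 1)) 0).clm_apply
      (hasDerivAt_const 0 x)
    simpa [approx, NormedSpace.exp_zero] using this
  have h1 := hd.tendsto_slope_zero_right
  filter_upwards [(Metric.tendsto_nhds.1 h1) (ε / 3) (by positivity), self_mem_nhdsWithin]
    with t ht1 (ht : 0 < t)
  rw [zero_add] at ht1
  have e0 : hL.approx n 0 x = x := by simp [approx, NormedSpace.exp_zero]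
  rw [e0, dist_eq_norm] at ht1
  rw [dist_eq_norm]
  have h2 := hL.norm_approx_sub_semigroup_le n ht.le h
  have h3 : ‖t⁻¹ • (hL.approx n t x - hL.semigroup t x)‖ ≤ ‖hL.yosida (n + 1) x - y‖ := by
    rw [norm_smul, norm_inv, Real.norm_of_nonneg ht.le, inv_mul_le_iff₀ ht]
    exact h2
  have e : t⁻¹ • (hL.semigroup t x - x) - y = -(t⁻¹ • (hL.approx n t x - hL.semigroup t x))
      + (t⁻¹ • (hL.approx n t x - x) - hL.yosida (n + 1) x) + (hL.yosida (n + 1) x - y) := by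
    module
  rw [e]
  calc _ ≤ ‖-(t⁻¹ • (hL.approx n t x - hL.semigroup t x))‖
      + ‖t⁻¹ • (hL.approx n t x - x) - hL.yosida (n + 1) x‖ + ‖hL.yosida (n + 1) x - y‖ :=
        norm_add₃_le
    _ < ε := by rw [norm_neg]; linarith

theorem tendsto_semigroup [CompleteSpace X] (hL : IsMaxDissipative L) (x : X) :
    Tendsto (fun t => hL.semigroup t x) (𝓝[≥] 0) (𝓝 x) := by
  refine tendsto_apply_of_dense (T := fun t x => hL.semigroup t x) (S := fun x => x) (K := 1)
    (Eventually.of_forall fun t x y => ?_) (fun x y => by rw [one_mul]) hL.dense_domain ?_ x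
  · rw [← map_sub, one_mul]; exact hL.norm_semigroup_apply_le t _
  · rintro x ⟨y, h⟩
    have h0 : Tendsto (fun t : ℝ => t * (‖hL.yosida 1 x - y‖ + ‖hL.yosida 1 x‖)) (𝓝[≥] 0) (𝓝 0) := by
      have : Tendsto (fun t : ℝ => t * (‖hL.yosida 1 x - y‖ + ‖hL.yosida 1 x‖)) (𝓝 0) (𝓝 _) :=
        tendsto_id.mul_const _
      rw [zero_mul] at this
      exact this.mono_left nhdsWithin_le_nhds
    rw [tendsto_iff_norm_sub_tendsto_zero]
    refine squeeze_zero' (Eventually.of_forall fun _ => norm_nonneg _) ?_ h0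
    filter_upwards [self_mem_nhdsWithin] with t (ht : 0 ≤ t)
    have h1 := hL.norm_approx_sub_semigroup_le 0 ht h
    have h2 : ‖hL.approx 0 t x - x‖ ≤ t * ‖hL.yosida 1 x‖ := by
      have := norm_exp_sub_le (A := hL.yosida ((0 : ℕ) + 1)) (B := (0 : X →L[ℝ] X))
        (Commute.zero_right _) (fun _ h => hL.norm_approx_le 0 h)
        (fun _ h => by
          rw [smul_zero, NormedSpace.exp_zero]; exact ContinuousLinearMap.norm_id_le) ht x
      simpa [approx, NormedSpace.exp_zero] using this
    have e : hL.semigroup t x - x = -(hL.approx 0 t x - hL.semigroup t x)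
      + (hL.approx 0 t x - x) := by abel
    rw [e]
    refine (norm_add_le _ _).trans ?_
    rw [norm_neg]
    simp only [Nat.cast_zero, zero_add] at h1
    linarith

theorem isC0Semigroup [CompleteSpace X] (hL : IsMaxDissipative L) :
    IsC0Semigroup hL.semigroup where
  zero := hL.semigroup_zero
  add _ _ hs ht := hL.semigroup_add hs ht
  tendsto x := (hL.tendsto_semigroup x).mono_left (nhdsWithin_mono _ Ioi_subset_Ici_self)

/-- For the converse, let `y` be a limit of difference quotients at `x` and solve `x' - y' = x - y`
in the graph. Then `d = x - x'` has right derivative `d` at time zero, whereas contractivity makes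
the inner product of `d` with its quotients nonpositive. Hence `d = 0`. -/
theorem isGenerator [CompleteSpace X] (hL : IsMaxDissipative L) :
    IsGenerator hL.semigroup L := by
  intro x y
  refine ⟨hL.tendsto_slope, fun h => ?_⟩
  obtain ⟨x', y', h', e⟩ := hL.range 1 one_pos (x - y)
  have h2 := h.sub (hL.tendsto_slope h')
  have e1 : y - y' = x - x' := by
    rw [one_smul] at e
    rw [sub_eq_sub_iff_add_eq_add] at e ⊢
    rw [add_comm y, e]
  rw [e1] at h2
  have h3 : ∀ᶠ t : ℝ in 𝓝[>] 0, ⟪x - x', t⁻¹ • (hL.semigroup t x - x)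
      - t⁻¹ • (hL.semigroup t x' - x')⟫_ℝ ≤ 0 := by
    filter_upwards [self_mem_nhdsWithin] with t (ht : 0 < t)
    have e2 : t⁻¹ • (hL.semigroup t x - x) - t⁻¹ • (hL.semigroup t x' - x')
      = t⁻¹ • (hL.semigroup t (x - x') - (x - x')) := by rw [map_sub]; module
    rw [e2, real_inner_smul_right, inner_sub_right, real_inner_self_eq_norm_sq]
    have h4 := real_inner_le_norm (x - x') (hL.semigroup t (x - x'))
    have h5 := mul_le_mul_of_nonneg_left (hL.norm_semigroup_apply_le t (x - x'))
      (norm_nonneg (x - x'))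
    exact mul_nonpos_of_nonneg_of_nonpos (by positivity) (by nlinarith)
  have h6 := le_of_tendsto ((tendsto_const_nhds (x := x - x')).inner h2) h3
  have h7 : x - x' = 0 := by
    rw [real_inner_self_eq_norm_sq] at h6
    exact norm_eq_zero.1 (pow_eq_zero_iff two_ne_zero |>.1 (le_antisymm h6 (sq_nonneg _)))
  rw [h7, sub_eq_zero] at e1
  rw [sub_eq_zero] at h7
  rwa [h7, e1]

end IsMaxDissipative
end HilleYosida

end ThermoPlate

namespace ThermoPlate

/-! ### Gronwall's inequality and Duhamel's formula for bounded semigroups. -/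

section Extension

variable {Y : Type*} [TopologicalSpace Y]

/-- A function continuous on `[0, T]` agrees there with a continuous function. -/
theorem exists_continuous_eqOn_Icc {T : ℝ} (hT : 0 ≤ T) {f : ℝ → Y}
    (hf : ContinuousOn f (Icc 0 T)) : ∃ g : ℝ → Y, Continuous g ∧ ∀ t ∈ Icc 0 T, g t = f t := by
  refine ⟨fun t => f (max 0 (min t T)), hf.comp_continuous (by fun_prop) fun t => ?_, ?_⟩
  · exact ⟨le_max_left _ _, max_le hT (min_le_right _ _)⟩
  · intro t ht
    simp only [min_eq_left ht.2, max_eq_right ht.1]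

end Extension

/-- Gronwall's inequality in integral form. -/
theorem le_mul_exp_of_le_integral {T a k : ℝ} (hk : 0 ≤ k) {u : ℝ → ℝ} (hu : Continuous u)
    (h : ∀ t ∈ Icc 0 T, u t ≤ a + k * ∫ τ in (0 : ℝ)..t, u τ) {t : ℝ} (ht : t ∈ Icc 0 T) :
    u t ≤ a * Real.exp (k * t) := by
  have hd : ∀ s, HasDerivAt (fun t => a + k * ∫ τ in (0 : ℝ)..t, u τ) (k * u s) s := fun s =>
    ((intervalIntegral.integral_hasDerivAt_right (hu.intervalIntegrable _ _)
      hu.aestronglyMeasurable.stronglyMeasurableAtFilter hu.continuousAt).const_mul k).const_add a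
  have := le_gronwallBound_of_liminf_deriv_right_le
    (f := fun t => a + k * ∫ τ in (0 : ℝ)..t, u τ) (f' := fun t => k * u t) (δ := a) (K := k)
    (ε := 0) (a := 0) (b := T) (fun s _ => (hd s).continuousAt.continuousWithinAt)
    (fun s _ r hr => (hd s).hasDerivWithinAt.liminf_right_slope_le hr) (by simp)
    (fun s hs => by
      rw [add_zero]; exact mul_le_mul_of_nonneg_left (h s (Ico_subset_Icc_self hs)) hk) t ht
  rw [sub_zero, gronwallBound_ε0] at this
  exact (h t ht).trans this

theorem tendsto_sub_nhdsGT (s : ℝ) : Tendsto (fun t : ℝ => t - s) (𝓝[>] s) (𝓝[>] 0) := by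
  rw [tendsto_nhdsWithin_iff]
  constructor
  · have : Continuous fun t : ℝ => t - s := by fun_prop
    simpa using (this.tendsto s).mono_left nhdsWithin_le_nhds
  · filter_upwards [self_mem_nhdsWithin] with t (ht : s < t) using sub_pos.2 ht

section Mild

variable {X : Type*} [NormedAddCommGroup X] [NormedSpace ℝ X]

/-- A strongly continuous semigroup which is bounded by `K` and is extended to negative times by
the identity. -/
structure IsBoundedSemigroup (E : ℝ → X →L[ℝ] X) (K : ℝ) : Prop where
  isC0 : IsC0Semigroup E
  bound : ∀ t x, ‖E t x‖ ≤ K * ‖x‖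
  max_zero : ∀ t, E (max t 0) = E t
  K_nonneg : 0 ≤ K

variable {E : ℝ → X →L[ℝ] X} {K : ℝ}

namespace IsBoundedSemigroup

theorem add_apply (hE : IsBoundedSemigroup E K) {s t : ℝ} (hs : 0 ≤ s) (ht : 0 ≤ t) (x : X) :
    E (s + t) x = E s (E t x) := by
  rw [hE.isC0.add s t hs ht]; rfl

theorem tendsto (hE : IsBoundedSemigroup E K) (x : X) :
    Tendsto (fun t => E t x) (𝓝 0) (𝓝 x) := by
  have h0 : E 0 x = x := by rw [hE.isC0.zero]; rfl
  have h1 : Tendsto (fun t => E t x) (𝓝[≤] 0) (𝓝 x) := by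
    refine tendsto_const_nhds.congr' ?_
    filter_upwards [self_mem_nhdsWithin] with t (ht : t ≤ 0)
    rw [← hE.max_zero, max_eq_right ht, h0]
  rw [← nhdsLE_sup_nhdsGT]
  exact h1.sup (hE.isC0.tendsto x)

theorem norm_sub_le (hE : IsBoundedSemigroup E K) (s t : ℝ) (x : X) :
    ‖E s x - E t x‖ ≤ K * ‖E |max s 0 - max t 0| x - x‖ := by
  rw [← hE.max_zero s, ← hE.max_zero t]
  wlog h : max t 0 ≤ max s 0 generalizing s t
  · rw [norm_sub_rev, abs_sub_comm]
    exact this t s (le_of_not_ge h)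
  have e : max s 0 = max t 0 + |max s 0 - max t 0| := by
    rw [abs_of_nonneg (sub_nonneg.2 h)]; ring
  nth_rw 1 [e]
  rw [hE.add_apply (le_max_right _ _) (abs_nonneg _), ← map_sub]
  exact hE.bound _ _

theorem continuous_orbit (hE : IsBoundedSemigroup E K) (x : X) : Continuous fun t => E t x := by
  rw [continuous_iff_continuousAt]
  intro t
  rw [ContinuousAt, tendsto_iff_norm_sub_tendsto_zero]
  refine squeeze_zero (fun _ => norm_nonneg _) (fun s => hE.norm_sub_le s t x) ?_
  have h1 : Tendsto (fun s : ℝ => |max s 0 - max t 0|) (𝓝 t) (𝓝 0) := by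
    have : Continuous fun s : ℝ => |max s 0 - max t 0| := by fun_prop
    simpa using this.tendsto t
  have h2 := (((hE.tendsto x).comp h1).sub_const x).norm.const_mul K
  simpa using h2

/-- The uniform bound upgrades strong continuity to joint continuity, which makes all Duhamel
integrands continuous. Extension by the identity to negative times makes this hold on the whole
line. -/
theorem continuous_uncurry (hE : IsBoundedSemigroup E K) :
    Continuous fun p : ℝ × X => E p.1 p.2 := by
  rw [continuous_iff_continuousAt]
  rintro ⟨t, x⟩
  rw [ContinuousAt, tendsto_iff_norm_sub_tendsto_zero]
  have h1 : Continuous fun p : ℝ × X => K * ‖p.2 - x‖ + ‖E p.1 x - E t x‖ := by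
    have := (hE.continuous_orbit x).comp continuous_fst (X := ℝ × X)
    exact (continuous_const.mul (continuous_snd.sub continuous_const).norm).add
      (this.sub continuous_const).norm
  have h2 := h1.tendsto (t, x)
  simp only [sub_self, norm_zero, mul_zero, add_zero] at h2
  refine squeeze_zero (fun _ => norm_nonneg _) (fun p => ?_) h2
  have e : E p.1 p.2 - E t x = E p.1 (p.2 - x) + (E p.1 x - E t x) := by rw [map_sub]; abel
  rw [e]
  exact (norm_add_le _ _).trans (add_le_add_left (hE.bound _ _) _)

theorem continuous_comp (hE : IsBoundedSemigroup E K) {Z : Type*} [TopologicalSpace Z]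
    {a : Z → ℝ} {b : Z → X} (ha : Continuous a) (hb : Continuous b) :
    Continuous fun z => E (a z) (b z) :=
  hE.continuous_uncurry.comp (ha.prodMk hb)

end IsBoundedSemigroup

/-- The mild solution of `U' = L U + g(t)`, `U(0) = x`. -/
def duhamel (E : ℝ → X →L[ℝ] X) (g : ℝ → X) (x : X) (t : ℝ) : X :=
  E t x + ∫ τ in (0 : ℝ)..t, E (t - τ) (g τ)

namespace IsBoundedSemigroup

theorem intervalIntegrable (hE : IsBoundedSemigroup E K) {g : ℝ → X} (hg : Continuous g)
    (t a b : ℝ) : IntervalIntegrable (fun τ => E (t - τ) (g τ)) volume a b :=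
  (hE.continuous_comp (by fun_prop) hg).intervalIntegrable _ _

theorem continuous_duhamel (hE : IsBoundedSemigroup E K) {g : ℝ → X} (hg : Continuous g) (x : X) :
    Continuous (duhamel E g x) := by
  refine (hE.continuous_orbit x).add ?_
  refine intervalIntegral.continuous_parametric_intervalIntegral_of_continuous
    (f := fun t τ => E (t - τ) (g τ)) ?_ continuous_id
  exact hE.continuous_comp (a := fun p : ℝ × ℝ => p.1 - p.2) (b := fun p => g p.2)
    (by fun_prop) (by fun_prop)

theorem duhamel_add (hE : IsBoundedSemigroup E K) {g g' : ℝ → X} (hg : Continuous g)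
    (hg' : Continuous g') (x x' : X) (t : ℝ) :
    duhamel E (fun t => g t + g' t) (x + x') t = duhamel E g x t + duhamel E g' x' t := by
  simp only [duhamel, map_add]
  rw [intervalIntegral.integral_add (hE.intervalIntegrable hg _ _ _)
    (hE.intervalIntegrable hg' _ _ _)]
  abel

theorem duhamel_smul (c : ℝ) (g : ℝ → X) (x : X) (t : ℝ) :
    duhamel E (fun t => c • g t) (c • x) t = c • duhamel E g x t := by
  simp only [duhamel, map_smul, intervalIntegral.integral_smul, smul_add]

theorem duhamel_sub (hE : IsBoundedSemigroup E K) {g g' : ℝ → X} (hg : Continuous g)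
    (hg' : Continuous g') (x x' : X) (t : ℝ) :
    duhamel E (fun t => g t - g' t) (x - x') t = duhamel E g x t - duhamel E g' x' t := by
  simp only [duhamel, map_sub]
  rw [intervalIntegral.integral_sub (hE.intervalIntegrable hg _ _ _)
    (hE.intervalIntegrable hg' _ _ _)]
  abel

theorem duhamel_zero (hE : IsBoundedSemigroup E K) (g : ℝ → X) (x : X) : duhamel E g x 0 = x := by
  simp [duhamel, hE.isC0.zero]

theorem duhamel_congr {g g' : ℝ → X} {x : X} {t : ℝ} (ht : 0 ≤ t)
    (h : ∀ τ ∈ Icc 0 t, g τ = g' τ) : duhamel E g x t = duhamel E g' x t := by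
  simp only [duhamel]
  congr 1
  refine intervalIntegral.integral_congr fun τ hτ => ?_
  rw [uIcc_of_le ht] at hτ
  simp only [h τ hτ]

/-- Gronwall estimate for mild solutions. -/
theorem norm_duhamel_le (hE : IsBoundedSemigroup E K) {g : ℝ → X} (hg : Continuous g) {x : X}
    {T l ε : ℝ} (hl : 0 ≤ l) (hε : 0 ≤ ε)
    (h : ∀ t ∈ Icc 0 T, ‖g t‖ ≤ l * ‖duhamel E g x t‖ + ε) {t : ℝ} (ht : t ∈ Icc 0 T) :
    ‖duhamel E g x t‖ ≤ (K * ‖x‖ + K * T * ε) * Real.exp (K * l * t) := by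
  have hK := hE.K_nonneg
  have hc := (hE.continuous_duhamel hg x).norm
  refine le_mul_exp_of_le_integral (by positivity) hc (fun t ht => ?_) ht
  have h1 : ‖∫ τ in (0 : ℝ)..t, E (t - τ) (g τ)‖
      ≤ ∫ τ in (0 : ℝ)..t, (K * l * ‖duhamel E g x τ‖ + K * ε) := by
    refine intervalIntegral.norm_integral_le_of_norm_le ht.1 (ae_of_all _ fun τ hτ => ?_)
      (Continuous.intervalIntegrable (by fun_prop) _ _)
    have := mul_le_mul_of_nonneg_left (h τ ⟨hτ.1.le, hτ.2.trans ht.2⟩) hK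
    exact (hE.bound _ _).trans (by linarith)
  rw [intervalIntegral.integral_add (Continuous.intervalIntegrable (by fun_prop) _ _)
    (by simp), intervalIntegral.integral_const_mul, intervalIntegral.integral_const] at h1
  have h2 : ‖duhamel E g x t‖ ≤ ‖E t x‖ + ‖∫ τ in (0 : ℝ)..t, E (t - τ) (g τ)‖ := norm_add_le _ _
  have h3 := hE.bound t x
  have h4 : (t - 0) • (K * ε) ≤ K * T * ε := by
    have : t * (K * ε) ≤ T * (K * ε) := mul_le_mul_of_nonneg_right ht.2 (by positivity)
    simp only [sub_zero, smul_eq_mul]; linarith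
  linarith

variable [CompleteSpace X]

/-- The semigroup law allows a mild solution to be restarted at time `s`. Right derivatives at `s`
thus reduce to right derivatives of orbits plus an average of the forcing, without any regularity of
the solution. -/
theorem duhamel_restart (hE : IsBoundedSemigroup E K) {g : ℝ → X} (hg : Continuous g) (x : X)
    {s h : ℝ} (hs : 0 ≤ s) (hh : 0 ≤ h) :
    duhamel E g x (s + h) = E h (duhamel E g x s)
      + ∫ r in (0 : ℝ)..h, E (h - r) (g (s + r)) := by
  have h1 : E h (∫ τ in (0 : ℝ)..s, E (s - τ) (g τ))
      = ∫ τ in (0 : ℝ)..s, E (s + h - τ) (g τ) := by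
    rw [← (E h).intervalIntegral_comp_comm (hE.intervalIntegrable hg _ _ _)]
    refine intervalIntegral.integral_congr fun τ hτ => ?_
    rw [uIcc_of_le hs] at hτ
    rw [← hE.add_apply hh (sub_nonneg.2 hτ.2)]
    congr 2; ring
  have h2 : (∫ r in (0 : ℝ)..h, E (h - r) (g (s + r)))
      = ∫ τ in s..(s + h), E (s + h - τ) (g τ) := by
    have := intervalIntegral.integral_comp_add_left (fun τ => E (s + h - τ) (g τ)) s
      (a := 0) (b := h)
    rw [add_zero] at this
    rw [← this]
    simp only [add_sub_add_left_eq_sub]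
  rw [duhamel, duhamel, map_add, h1, h2, add_assoc,
    intervalIntegral.integral_add_adjacent_intervals (hE.intervalIntegrable hg _ _ _)
      (hE.intervalIntegrable hg _ _ _), ← hE.add_apply hh hs, add_comm h s]

theorem tendsto_average (hE : IsBoundedSemigroup E K) {g : ℝ → X} (hg : Continuous g) (s : ℝ) :
    Tendsto (fun h : ℝ => h⁻¹ • ∫ r in (0 : ℝ)..h, E (h - r) (g (s + r))) (𝓝[>] 0) (𝓝 (g s)) := by
  have hc : Continuous fun p : ℝ × ℝ => E (p.1 - p.2) (g (s + p.2)) :=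
    hE.continuous_comp (by fun_prop) (by fun_prop)
  have h0 : E 0 (g s) = g s := by rw [hE.isC0.zero]; rfl
  rw [Metric.tendsto_nhds]
  intro ε hε
  have h1 := Metric.continuousAt_iff.1 (hc.continuousAt (x := ((0 : ℝ), (0 : ℝ))))
    (ε / 2) (by positivity)
  obtain ⟨δ, hδ, h1⟩ := h1
  filter_upwards [Ioo_mem_nhdsGT hδ] with h hh
  have hb : ∀ r ∈ Set.uIoc 0 h, ‖E (h - r) (g (s + r)) - g s‖ ≤ ε / 2 := by
    intro r hr
    rw [uIoc_of_le hh.1.le] at hr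
    have : dist (h, r) ((0 : ℝ), (0 : ℝ)) < δ := by
      rw [Prod.dist_eq, Real.dist_0_eq_abs, Real.dist_0_eq_abs, abs_of_pos hh.1, abs_of_pos hr.1]
      exact max_lt hh.2 (hr.2.trans_lt hh.2)
    have := h1 this
    simp only [sub_zero, add_zero, h0] at this
    rw [← dist_eq_norm]; exact this.le
  have h2 := intervalIntegral.norm_integral_le_of_norm_le_const hb
  have hi : IntervalIntegrable (fun r => E (h - r) (g (s + r))) volume 0 h :=
    (hE.continuous_comp (by fun_prop) (by fun_prop)).intervalIntegrable _ _
  rw [intervalIntegral.integral_sub hi (by simp), intervalIntegral.integral_const, sub_zero,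
    abs_of_pos hh.1] at h2
  have e : h⁻¹ • (∫ r in (0 : ℝ)..h, E (h - r) (g (s + r))) - g s
      = h⁻¹ • ((∫ r in (0 : ℝ)..h, E (h - r) (g (s + r))) - h • g s) := by
    rw [smul_sub, inv_smul_smul₀ hh.1.ne']
  rw [dist_eq_norm, e, norm_smul, norm_inv, Real.norm_of_nonneg hh.1.le, inv_mul_lt_iff₀ hh.1]
  nlinarith [hh.1]

/-- Observations of mild solutions have right derivatives if those of the orbits have. -/
theorem hasDerivWithinAt_duhamel (hE : IsBoundedSemigroup E K) {Y : Type*} [NormedAddCommGroup Y]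
    [NormedSpace ℝ Y] {B : X →L[ℝ] Y} {C : X → Y}
    (hBC : ∀ x, Tendsto (fun h : ℝ => h⁻¹ • (B (E h x) - B x)) (𝓝[>] 0) (𝓝 (C x)))
    {g : ℝ → X} (hg : Continuous g) (x : X) {s : ℝ} (hs : 0 ≤ s) :
    HasDerivWithinAt (fun t => B (duhamel E g x t)) (C (duhamel E g x s) + B (g s)) (Ici s) s := by
  rw [← hasDerivWithinAt_Ioi_iff_Ici, hasDerivWithinAt_iff_tendsto_slope' (by simp)]
  have hm := tendsto_sub_nhdsGT s
  have h1 := ((hBC (duhamel E g x s)).add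
    ((B.continuous.tendsto _).comp (hE.tendsto_average hg s))).comp hm
  refine h1.congr' ?_
  filter_upwards [self_mem_nhdsWithin] with t (ht : s < t)
  have e := hE.duhamel_restart hg x hs (sub_nonneg.2 ht.le)
  rw [add_sub_cancel] at e
  rw [slope_def_module, e]
  simp only [Function.comp_apply, map_smul, map_add]
  module

end IsBoundedSemigroup
end Mild

/-! ### Energy inequality for norms that are nonincreasing along the semigroup. -/

section Energy

variable {X : Type*} [NormedAddCommGroup X] [NormedSpace ℝ X] [CompleteSpace X]
  {E : ℝ → X →L[ℝ] X} {K : ℝ} {Y : Type*} [NormedAddCommGroup Y] [InnerProductSpace ℝ Y]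

/-- Energy inequality for mild solutions. -/
theorem IsBoundedSemigroup.eventually_slope_lt (hE : IsBoundedSemigroup E K) {R : X →L[ℝ] Y}
    (hR : ∀ t x, ‖R (E t x)‖ ≤ ‖R x‖) {g : ℝ → X} (hg : Continuous g) (x : X) {s : ℝ}
    (hs : 0 ≤ s) {r : ℝ} (hr : 2 * ⟪R (duhamel E g x s), R (g s)⟫_ℝ < r) :
    ∀ᶠ t in 𝓝[>] s, slope (fun t => ‖R (duhamel E g x t)‖ ^ 2) s t < r := by
  have hm := tendsto_sub_nhdsGT s
  set U := duhamel E g x s with hU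
  set q : ℝ → X := fun h => h⁻¹ • ∫ r in (0 : ℝ)..h, E (h - r) (g (s + r)) with hq
  have h1 : Tendsto (fun h : ℝ => E h U) (𝓝[>] 0) (𝓝 U) :=
    (hE.tendsto U).mono_left nhdsWithin_le_nhds
  have h2 : Tendsto (fun h : ℝ => R (q h)) (𝓝[>] 0) (𝓝 (R (g s))) :=
    (R.continuous.tendsto _).comp (hE.tendsto_average hg s)
  have h3 : Tendsto (fun h : ℝ => 2 * ⟪R (E h U), R (q h)⟫_ℝ + h * ‖R (q h)‖ ^ 2) (𝓝[>] 0)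
      (𝓝 (2 * ⟪R U, R (g s)⟫_ℝ)) := by
    have h4 := ((((R.continuous.tendsto _).comp h1).inner h2).const_mul 2).add
      ((tendsto_id.mono_left nhdsWithin_le_nhds).mul (h2.norm.pow 2))
    simpa using h4
  filter_upwards [(h3.comp hm).eventually_lt_const hr, self_mem_nhdsWithin] with t ht (hst : s < t)
  refine lt_of_le_of_lt ?_ ht
  have hp : 0 < t - s := sub_pos.2 hst
  have e := hE.duhamel_restart hg x hs hp.le
  have e2 : (∫ r in (0 : ℝ)..(t - s), E (t - s - r) (g (s + r))) = (t - s) • q (t - s) := by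
    rw [hq]; simp only; rw [smul_inv_smul₀ hp.ne']
  rw [add_sub_cancel, e2] at e
  -- Expand the square of `R (E h U) + h R (q h)`. The first square is at most `‖R U‖ ^ 2`, and the
  -- remainder divided by `h` is the quantity whose limit was computed in `h3`.
  rw [slope_def_field, e, ← hU, div_le_iff₀ hp, map_add, map_smul, norm_add_sq_real,
    real_inner_smul_right, norm_smul, Real.norm_of_nonneg hp.le]
  have h5 : ‖R (E (t - s) U)‖ ^ 2 ≤ ‖R U‖ ^ 2 := by gcongr; exact hR _ _
  simp only [Function.comp_apply]
  nlinarith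

end Energy

end ThermoPlate

namespace ThermoPlate

/-! ### Mild solutions on finite intervals: uniqueness, gluing, existence for Lipschitz forcing. -/

section IsLocLip

variable {X : Type*} [NormedAddCommGroup X]

/-- Continuity in both variables on `[0, ∞)`, and Lipschitz continuity with respect to the second
one on bounded sets. -/
structure IsLocLip (G : ℝ → X → X) : Prop where
  cont : ContinuousOn (fun p : ℝ × X => G p.1 p.2) (Ici 0 ×ˢ univ)
  lip : ∀ T R : ℝ, ∃ l, 0 ≤ l ∧ ∀ t ∈ Icc 0 T, ∀ x y, ‖x‖ ≤ R → ‖y‖ ≤ R →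
    ‖G t x - G t y‖ ≤ l * ‖x - y‖

theorem IsLocLip.continuousOn_comp {G : ℝ → X → X} (hG : IsLocLip G) {U : ℝ → X} {s : Set ℝ}
    (hs : s ⊆ Ici 0) (hU : ContinuousOn U s) : ContinuousOn (fun t => G t (U t)) s :=
  hG.cont.comp (continuousOn_id.prodMk hU) fun _ ht => ⟨hs ht, mem_univ _⟩

end IsLocLip

section MildOn

variable {X : Type*} [NormedAddCommGroup X] [NormedSpace ℝ X]

/-- Mild solutions on the interval `[0, T]`. -/
def IsMildOn (E : ℝ → X →L[ℝ] X) (G : ℝ → X → X) (U₀ : X) (T : ℝ) (U : ℝ → X) : Prop :=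
  ContinuousOn U (Icc 0 T) ∧ ∀ t ∈ Icc 0 T, U t = duhamel E (fun τ => G τ (U τ)) U₀ t

theorem IsMildSolution.isMildOn {E : ℝ → X →L[ℝ] X} {G : ℝ → X → X} {U₀ : X} {U : ℝ → X}
    (h : IsMildSolution E G U₀ U) (T : ℝ) : IsMildOn E G U₀ T U :=
  ⟨h.1.mono fun _ ht => ht.1, fun t ht => h.2 t ht.1⟩

theorem IsMildOn.mono {E : ℝ → X →L[ℝ] X} {G : ℝ → X → X} {U₀ : X} {U : ℝ → X} {T T' : ℝ}
    (h : IsMildOn E G U₀ T U) (hT : T' ≤ T) : IsMildOn E G U₀ T' U :=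
  ⟨h.1.mono (Icc_subset_Icc_right hT), fun t ht => h.2 t (Icc_subset_Icc_right hT ht)⟩

theorem isMildSolution_iff {E : ℝ → X →L[ℝ] X} {G : ℝ → X → X} {U₀ : X} {U : ℝ → X} :
    IsMildSolution E G U₀ U ↔ ∀ T, 0 ≤ T → IsMildOn E G U₀ T U := by
  refine ⟨fun h T _ => h.isMildOn T, fun h => ⟨fun t ht => ?_, fun t ht => ?_⟩⟩
  · have ht' : 0 ≤ t := ht
    have h1 := (h (t + 1) (by linarith)).1 t ⟨ht, by linarith⟩
    refine h1.mono_of_mem_nhdsWithin ?_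
    rw [← Ici_inter_Iic]
    exact inter_mem_nhdsWithin _ (Iic_mem_nhds (by linarith))
  · exact (h t ht).2 t ⟨ht, le_rfl⟩

theorem IsMildOn.congr {E : ℝ → X →L[ℝ] X} {G G' : ℝ → X → X} {U₀ : X} {U V : ℝ → X} {T : ℝ}
    (h : IsMildOn E G U₀ T U) (hUV : ∀ t ∈ Icc 0 T, V t = U t)
    (hG : ∀ t ∈ Icc 0 T, G' t (U t) = G t (U t)) : IsMildOn E G' U₀ T V := by
  refine ⟨h.1.congr hUV, fun t ht => ?_⟩
  rw [hUV t ht, h.2 t ht]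
  refine IsBoundedSemigroup.duhamel_congr ht.1 fun τ hτ => ?_
  have hτ' : τ ∈ Icc 0 T := ⟨hτ.1, hτ.2.trans ht.2⟩
  simp only [hUV τ hτ', hG τ hτ']

/-- A mild solution on `[0, T]` solves a linear inhomogeneous problem. -/
theorem IsMildOn.exists_duhamel {E : ℝ → X →L[ℝ] X} {G : ℝ → X → X} (hG : IsLocLip G) {U₀ : X}
    {T : ℝ} (hT : 0 ≤ T) {U : ℝ → X} (h : IsMildOn E G U₀ T U) :
    ∃ g : ℝ → X, Continuous g ∧ (∀ t ∈ Icc 0 T, g t = G t (U t)) ∧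
      ∀ t ∈ Icc 0 T, U t = duhamel E g U₀ t := by
  obtain ⟨g, hg, hg'⟩ := exists_continuous_eqOn_Icc hT
    (hG.continuousOn_comp (fun t ht => ht.1) h.1)
  refine ⟨g, hg, hg', fun t ht => ?_⟩
  rw [h.2 t ht]
  exact IsBoundedSemigroup.duhamel_congr ht.1 fun τ hτ => (hg' τ ⟨hτ.1, hτ.2.trans ht.2⟩).symm

variable {E : ℝ → X →L[ℝ] X} {K : ℝ}

/-- Lipschitz dependence on the initial value. -/
theorem IsBoundedSemigroup.norm_sub_le_of_isMildOn (hE : IsBoundedSemigroup E K) {G : ℝ → X → X}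
    (hG : IsLocLip G) {T l R : ℝ} (hl : 0 ≤ l)
    (hGl : ∀ t ∈ Icc 0 T, ∀ x y, ‖x‖ ≤ R → ‖y‖ ≤ R → ‖G t x - G t y‖ ≤ l * ‖x - y‖)
    {U₀ V₀ : X} {U V : ℝ → X} (hU : IsMildOn E G U₀ T U) (hV : IsMildOn E G V₀ T V)
    (hUR : ∀ t ∈ Icc 0 T, ‖U t‖ ≤ R) (hVR : ∀ t ∈ Icc 0 T, ‖V t‖ ≤ R) {t : ℝ}
    (ht : t ∈ Icc 0 T) : ‖U t - V t‖ ≤ K * ‖U₀ - V₀‖ * Real.exp (K * l * T) := by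
  have hT : 0 ≤ T := ht.1.trans ht.2
  have hK := hE.K_nonneg
  obtain ⟨g, hg, hg1, hg2⟩ := hU.exists_duhamel hG hT
  obtain ⟨k, hk, hk1, hk2⟩ := hV.exists_duhamel hG hT
  have e : ∀ t ∈ Icc 0 T, duhamel E (fun t => g t - k t) (U₀ - V₀) t = U t - V t := fun t ht => by
    rw [hE.duhamel_sub hg hk, hg2 t ht, hk2 t ht]
  have := hE.norm_duhamel_le (hg.fun_sub hk) (x := U₀ - V₀) (T := T) hl le_rfl (fun t ht => by
    rw [e t ht, hg1 t ht, hk1 t ht, add_zero]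
    exact hGl t ht _ _ (hUR t ht) (hVR t ht)) ht
  rw [e t ht, mul_zero, add_zero] at this
  refine this.trans ?_
  gcongr
  exact ht.2

theorem IsBoundedSemigroup.eq_of_isMildOn (hE : IsBoundedSemigroup E K) {G : ℝ → X → X}
    (hG : IsLocLip G) {T : ℝ} {U₀ : X} {U V : ℝ → X} (hU : IsMildOn E G U₀ T U)
    (hV : IsMildOn E G U₀ T V) {t : ℝ} (ht : t ∈ Icc 0 T) : U t = V t := by
  obtain ⟨R, hR⟩ := isCompact_Icc.exists_bound_of_continuousOn hU.1
  obtain ⟨R', hR'⟩ := isCompact_Icc.exists_bound_of_continuousOn hV.1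
  obtain ⟨l, hl, hl'⟩ := hG.lip T (max R R')
  have := hE.norm_sub_le_of_isMildOn hG hl hl' hU hV (fun t ht => (hR t ht).trans (le_max_left _ _))
    (fun t ht => (hR' t ht).trans (le_max_right _ _)) ht
  rw [sub_self, norm_zero, mul_zero, zero_mul, norm_le_zero_iff] at this
  exact sub_eq_zero.1 this

/-- Solvability on all finite intervals gives the unique global solution. -/
theorem IsBoundedSemigroup.exists_isUniqueMildSolution (hE : IsBoundedSemigroup E K)
    {G : ℝ → X → X} (hG : IsLocLip G) {U₀ : X}
    (h : ∀ T, 0 ≤ T → ∃ U, IsMildOn E G U₀ T U) : ∃ U, IsUniqueMildSolution E G U₀ U := by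
  choose! U hU using h
  -- The global solution is the diagonal `t ↦ U t t`; by uniqueness the solution on `[0, t]` is the
  -- restriction of the one on `[0, T]`.
  have key : ∀ T, 0 ≤ T → IsMildOn E G U₀ T fun t => U t t := by
    intro T hT
    refine (hU T hT).congr (fun t ht => ?_) fun _ _ => rfl
    exact hE.eq_of_isMildOn hG (hU t ht.1) ((hU T hT).mono ht.2) ⟨ht.1, le_rfl⟩
  refine ⟨fun t => U t t, isMildSolution_iff.2 key, fun V hV t ht => ?_⟩
  exact hE.eq_of_isMildOn hG (hV.isMildOn t) (key t ht) ⟨ht, le_rfl⟩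

/-- Existence for nonlinearities which are Lipschitz continuous on `[0, T] × X`. -/
theorem IsBoundedSemigroup.exists_isMildOn [CompleteSpace X] (hE : IsBoundedSemigroup E K)
    {G : ℝ → X → X} (hG : ContinuousOn (fun p : ℝ × X => G p.1 p.2) (Ici 0 ×ˢ univ)) {T l : ℝ}
    (hT : 0 ≤ T) (hl : 0 ≤ l) (hGl : ∀ t ∈ Icc 0 T, ∀ x y, ‖G t x - G t y‖ ≤ l * ‖x - y‖)
    (U₀ : X) : ∃ U, IsMildOn E G U₀ T U := by
  have hK := hE.K_nonneg
  -- The unknown is `V t = exp (-γ t) U t` in the supremum norm, that is, an exponentially weighted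
  -- norm for `U`. The contraction constant is then at most `K * l / γ`, and this choice makes it at
  -- most one half on intervals of any length.
  set γ : ℝ := 2 * (K * l) + 1 with hγ
  have hγ0 : 0 < γ := by positivity
  -- Clamping time to `[0, T]` keeps the forcing continuous on the whole line, since `G` is
  -- controlled only at nonnegative times.
  set pr : ℝ → ℝ := fun t => max 0 (min t T) with hpr
  have hprc : Continuous pr := by fun_prop
  have hpr0 : ∀ t, pr t ∈ Icc 0 T := fun t => ⟨le_max_left _ _, max_le hT (min_le_right _ _)⟩
  have hpr1 : ∀ t ∈ Icc 0 T, pr t = t := fun t ht => by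
    simp only [hpr, min_eq_left ht.2, max_eq_right ht.1]
  let ext : C(Icc (0 : ℝ) T, X) → ℝ → X := fun V t => Real.exp (γ * t) • V (projIcc 0 T hT t)
  have hext : ∀ V, Continuous (ext V) := fun V => by
    have : Continuous fun t => V (projIcc 0 T hT t) := V.continuous.comp continuous_projIcc
    fun_prop
  let g : C(Icc (0 : ℝ) T, X) → ℝ → X := fun V t => G (pr t) (ext V t)
  have hg : ∀ V, Continuous (g V) := fun V =>
    hG.comp_continuous (hprc.prodMk (hext V)) fun t => ⟨(hpr0 t).1, mem_univ _⟩
  let Φ : C(Icc (0 : ℝ) T, X) → C(Icc (0 : ℝ) T, X) := fun V =>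
    ⟨fun t => Real.exp (-(γ * t)) • duhamel E (g V) U₀ t, by
      have := hE.continuous_duhamel (hg V) U₀
      fun_prop⟩
  have hlip : ∀ V V' : C(Icc (0 : ℝ) T, X), ‖Φ V - Φ V'‖ ≤ 2⁻¹ * ‖V - V'‖ := by
    intro V V'
    rw [ContinuousMap.norm_le _ (by positivity)]
    intro t
    have ht := t.2
    have e : (Φ V - Φ V') t = Real.exp (-(γ * t))
        • ∫ τ in (0 : ℝ)..t, E (t - τ) (g V τ - g V' τ) := by
      have := hE.duhamel_sub (hg V) (hg V') U₀ U₀ t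
      simp only [ContinuousMap.sub_apply, Φ, ContinuousMap.coe_mk, ← smul_sub, ← this]
      simp [duhamel]
    have h1 : ‖∫ τ in (0 : ℝ)..t, E (t - τ) (g V τ - g V' τ)‖
        ≤ ∫ τ in (0 : ℝ)..t, Real.exp (γ * τ) * (K * l * ‖V - V'‖) := by
      refine intervalIntegral.norm_integral_le_of_norm_le ht.1 (ae_of_all _ fun τ hτ => ?_)
        (Continuous.intervalIntegrable (by fun_prop) _ _)
      have h2 := hGl (pr τ) (hpr0 τ) (ext V τ) (ext V' τ)
      have h3 : ‖ext V τ - ext V' τ‖ ≤ Real.exp (γ * τ) * ‖V - V'‖ := by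
        simp only [ext]
        rw [← smul_sub, norm_smul, Real.norm_of_nonneg (Real.exp_nonneg _)]
        gcongr
        exact (V - V').norm_coe_le_norm _
      calc _ ≤ K * ‖g V τ - g V' τ‖ := hE.bound _ _
        _ ≤ K * (l * (Real.exp (γ * τ) * ‖V - V'‖)) := by
          gcongr
          exact h2.trans (by gcongr)
        _ = _ := by ring
    have h4 : ∫ τ in (0 : ℝ)..t, Real.exp (γ * τ) * (K * l * ‖V - V'‖)
        ≤ γ⁻¹ * Real.exp (γ * t) * (K * l * ‖V - V'‖) := by
      rw [intervalIntegral.integral_mul_const]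
      gcongr
      have h5 : ∀ x : ℝ, HasDerivAt (fun τ => γ⁻¹ * Real.exp (γ * τ)) (Real.exp (γ * x)) x := by
        intro x
        refine (((hasDerivAt_id x).const_mul γ).exp.const_mul γ⁻¹).congr_deriv ?_
        simp only [id, mul_one]
        field_simp
      rw [intervalIntegral.integral_eq_sub_of_hasDerivAt (fun x _ => h5 x)
        (Continuous.intervalIntegrable (by fun_prop) _ _)]
      have : 0 ≤ γ⁻¹ * Real.exp (γ * 0) := by positivity
      linarith
    rw [e, norm_smul, Real.norm_of_nonneg (Real.exp_nonneg _)]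
    calc _ ≤ Real.exp (-(γ * t)) * (γ⁻¹ * Real.exp (γ * t) * (K * l * ‖V - V'‖)) := by
          gcongr; exact h1.trans h4
      _ = (γ⁻¹ * (K * l)) * ‖V - V'‖ := by
          rw [Real.exp_neg]; field_simp
      _ ≤ 2⁻¹ * ‖V - V'‖ := by
          gcongr
          rw [inv_mul_le_iff₀ hγ0, hγ]; linarith
  have hcw : ContractingWith 2⁻¹ Φ := by
    refine ⟨by norm_num, LipschitzWith.of_dist_le_mul fun V V' => ?_⟩
    rw [dist_eq_norm, dist_eq_norm]
    simpa using hlip V V'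
  set V := hcw.fixedPoint Φ with hV
  have hfix : Φ V = V := hcw.fixedPoint_isFixedPt
  have hUe : ∀ t ∈ Icc 0 T, ext V t = duhamel E (g V) U₀ t := by
    intro t ht
    have h1 : V ⟨t, ht⟩ = Real.exp (-(γ * t)) • duhamel E (g V) U₀ t := by
      conv_lhs => rw [← hfix]
      rfl
    simp only [ext, projIcc_of_mem hT ht, h1, smul_smul, ← Real.exp_add]
    simp
  refine ⟨ext V, (hext V).continuousOn, fun t ht => ?_⟩
  rw [hUe t ht]
  refine duhamel_congr ht.1 fun τ hτ => ?_
  simp only [g, hpr1 τ ⟨hτ.1, hτ.2.trans ht.2⟩]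

end MildOn

end ThermoPlate

namespace ThermoPlate

/-! ### Truncation by the radial retraction, and Lipschitz continuity on bounded sets. -/

section Retraction

variable {X : Type*} [NormedAddCommGroup X] [NormedSpace ℝ X]

/-- The radial retraction onto the closed ball of radius `R`. -/
def radialRetraction (R : ℝ) (x : X) : X := (R / max R ‖x‖) • x

theorem radialRetraction_of_norm_le {R : ℝ} (hR : 0 < R) {x : X} (hx : ‖x‖ ≤ R) :
    radialRetraction R x = x := by
  rw [radialRetraction, max_eq_left hx, div_self hR.ne', one_smul]

theorem norm_radialRetraction_le {R : ℝ} (hR : 0 < R) (x : X) : ‖radialRetraction R x‖ ≤ R := by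
  have hm : 0 < max R ‖x‖ := hR.trans_le (le_max_left _ _)
  rw [radialRetraction, norm_smul, Real.norm_of_nonneg (by positivity), div_mul_eq_mul_div,
    div_le_iff₀ hm]
  exact mul_le_mul_of_nonneg_left (le_max_right _ _) hR.le

/-- Changing the point and changing the scaling factor contribute at most `‖x - y‖` each. The
constant `2` holds in every normed space. -/
theorem norm_radialRetraction_sub_le {R : ℝ} (hR : 0 < R) (x y : X) :
    ‖radialRetraction R x - radialRetraction R y‖ ≤ 2 * ‖x - y‖ := by
  set a := max R ‖x‖ with ha
  set b := max R ‖y‖ with hb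
  have ha0 : R ≤ a := le_max_left _ _
  have hb0 : R ≤ b := le_max_left _ _
  have hap : 0 < a := hR.trans_le ha0
  have hbp : 0 < b := hR.trans_le hb0
  have e : radialRetraction R x - radialRetraction R y
      = (R / a) • (x - y) + (R / a * ((b - a) / b)) • y := by
    have : R / b = R / a - R / a * ((b - a) / b) := by field_simp; ring
    rw [radialRetraction, radialRetraction, ← ha, ← hb, this]
    module
  have h1 : R / a ≤ 1 := (div_le_one hap).2 ha0
  have h2 : |b - a| ≤ ‖x - y‖ := by
    have h := abs_max_sub_max_le_max R ‖y‖ R ‖x‖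
    rw [sub_self, abs_zero, max_eq_right (abs_nonneg (‖y‖ - ‖x‖))] at h
    exact (h.trans (abs_norm_sub_norm_le y x)).trans_eq (norm_sub_rev _ _)
  have h3 : ‖y‖ / b ≤ 1 := (div_le_one hbp).2 (le_max_right _ _)
  have h4 : ‖(R / a * ((b - a) / b)) • y‖ ≤ ‖x - y‖ := by
    rw [norm_smul, norm_mul, Real.norm_of_nonneg (by positivity : 0 ≤ R / a), norm_div,
      Real.norm_eq_abs, Real.norm_of_nonneg hbp.le]
    calc R / a * (|b - a| / b) * ‖y‖ = R / a * |b - a| * (‖y‖ / b) := by ring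
      _ ≤ 1 * ‖x - y‖ * 1 := by gcongr
      _ = ‖x - y‖ := by ring
  have h5 : ‖(R / a) • (x - y)‖ ≤ ‖x - y‖ := by
    rw [norm_smul, Real.norm_of_nonneg (by positivity)]
    exact mul_le_of_le_one_left (norm_nonneg _) h1
  rw [e]
  linarith [norm_add_le ((R / a) • (x - y)) ((R / a * ((b - a) / b)) • y)]

end Retraction

section IsLipOnBounded

variable {X : Type*} [NormedAddCommGroup X]

/-- Lipschitz continuity on bounded sets. -/
def IsLipOnBounded (f : X → X) : Prop :=
  ∀ R : ℝ, ∃ l, 0 ≤ l ∧ ∀ x y, ‖x‖ ≤ R → ‖y‖ ≤ R → ‖f x - f y‖ ≤ l * ‖x - y‖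

theorem IsLipOnBounded.continuous {f : X → X} (hf : IsLipOnBounded f) : Continuous f := by
  rw [continuous_iff_continuousAt]
  intro x
  obtain ⟨l, hl, h⟩ := hf (‖x‖ + 1)
  rw [ContinuousAt, tendsto_iff_norm_sub_tendsto_zero]
  have h0 : Tendsto (fun y => l * ‖y - x‖) (𝓝 x) (𝓝 0) := by
    have : Continuous fun y => l * ‖y - x‖ := by fun_prop
    simpa using this.tendsto x
  refine squeeze_zero' (Eventually.of_forall fun _ => norm_nonneg _) ?_ h0
  filter_upwards [Metric.ball_mem_nhds x one_pos] with y hy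
  rw [Metric.mem_ball, dist_eq_norm] at hy
  have : ‖y‖ ≤ ‖x‖ + 1 := by
    have := norm_add_le x (y - x)
    rw [add_sub_cancel] at this
    linarith
  exact h y x this (by linarith)

theorem IsLipOnBounded.isLocLip {f : X → X} (hf : IsLipOnBounded f) :
    IsLocLip fun (_ : ℝ) => f where
  cont := (hf.continuous.comp continuous_snd).continuousOn
  lip _ R := by
    obtain ⟨l, hl, h⟩ := hf R
    exact ⟨l, hl, fun _ _ => h⟩

end IsLipOnBounded

/-! ### Global solvability and Fréchet differentiability of semilinear semiflows. -/

section Semiflow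

variable {X : Type*} [NormedAddCommGroup X] [NormedSpace ℝ X]

/-- Mild solutions starting in a ball are bounded on finite intervals of existence. -/
def HasAPrioriBound (E : ℝ → X →L[ℝ] X) (f : X → X) : Prop :=
  ∀ T R : ℝ, ∃ K, ∀ U₀, ‖U₀‖ ≤ R → ∀ T' ≤ T, ∀ U, IsMildOn E (fun _ => f) U₀ T' U →
    ∀ t ∈ Icc 0 T', ‖U t‖ ≤ K

variable {E : ℝ → X →L[ℝ] X} {K : ℝ}

/-- Solve with `f` composed with the retraction onto a ball strictly larger than the a priori bound.
Before the first time at which the norm reaches `R` the truncation is inactive, so the bound `B`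
applies; by continuity it still holds at that time, which is impossible as `B < R`. -/
theorem IsBoundedSemigroup.exists_isMildOn_of_bound [CompleteSpace X]
    (hE : IsBoundedSemigroup E K) {f : X → X} (hf : IsLipOnBounded f) (hb : HasAPrioriBound E f)
    (U₀ : X) {T : ℝ} (hT : 0 ≤ T) : ∃ U, IsMildOn E (fun _ => f) U₀ T U := by
  obtain ⟨B, hB⟩ := hb T ‖U₀‖
  set R := max B ‖U₀‖ + 1 with hR
  have hR0 : 0 < R := by have := (norm_nonneg U₀).trans (le_max_right B ‖U₀‖); positivity
  obtain ⟨l, hl, h⟩ := hf R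
  have hlip : ∀ t ∈ Icc 0 T, ∀ x y, ‖f (radialRetraction R x) - f (radialRetraction R y)‖
      ≤ (l * 2) * ‖x - y‖ := fun t _ x y => by
    refine (h _ _ (norm_radialRetraction_le hR0 x) (norm_radialRetraction_le hR0 y)).trans ?_
    rw [mul_assoc]
    exact mul_le_mul_of_nonneg_left (norm_radialRetraction_sub_le hR0 x y) hl
  have hc : Continuous fun x : X => radialRetraction R x := by
    have : LipschitzWith 2 fun x : X => radialRetraction R x :=
      LipschitzWith.of_dist_le_mul fun x y => by
        rw [dist_eq_norm, dist_eq_norm]; exact norm_radialRetraction_sub_le hR0 x y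
    exact this.continuous
  obtain ⟨U, hU⟩ := hE.exists_isMildOn (G := fun _ x => f (radialRetraction R x))
    ((hf.continuous.comp hc).comp continuous_snd).continuousOn hT (by positivity) hlip U₀
  have hU0 : U 0 = U₀ := by
    rw [hU.2 0 ⟨le_rfl, hT⟩, hE.duhamel_zero]
  -- The a priori bound is used on the shorter interval `[0, s]`, where the truncated solution is a
  -- genuine one.
  have key : ∀ s ∈ Icc 0 T, (∀ t ∈ Icc 0 s, ‖U t‖ ≤ R) → ∀ t ∈ Icc 0 s, ‖U t‖ ≤ B := by
    intro s hs hsR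
    refine hB U₀ le_rfl s hs.2 U ((hU.mono hs.2).congr (fun _ _ => rfl) fun t ht => ?_)
    simp only [radialRetraction_of_norm_le hR0 (hsR t ht)]
  have hlt : ∀ t ∈ Icc 0 T, ‖U t‖ < R := by
    by_contra! hne
    obtain ⟨t₀, ht₀, hUt₀⟩ := hne
    set s : Set ℝ := {t | t ∈ Icc 0 T ∧ R ≤ ‖U t‖} with hs
    have hsc : IsCompact s := by
      have : s = Icc 0 T ∩ (fun t => ‖U t‖) ⁻¹' Ici R := rfl
      rw [this]
      exact isCompact_Icc.of_isClosed_subset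
        (hU.1.norm.preimage_isClosed_of_isClosed isClosed_Icc isClosed_Ici) inter_subset_left
    obtain ⟨t₁, ht₁, hmin⟩ := hsc.exists_isLeast ⟨t₀, ht₀, hUt₀⟩
    have hpos : 0 < t₁ := by
      rcases ht₁.1.1.eq_or_lt with h0 | h0
      · have h1 := ht₁.2
        rw [← h0, hU0, hR] at h1
        linarith [le_max_right B ‖U₀‖]
      · exact h0
    have hbd : ∀ t ∈ Ico 0 t₁, ‖U t‖ ≤ B := by
      intro t ht
      refine key t ⟨ht.1, ht.2.le.trans ht₁.1.2⟩ (fun r hr => ?_) t ⟨ht.1, le_rfl⟩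
      by_contra! hcon
      have := hmin ⟨⟨hr.1, (hr.2.trans ht.2.le).trans ht₁.1.2⟩, hcon.le⟩
      linarith [hr.2, ht.2]
    have hlim : ‖U t₁‖ ≤ B := by
      have hcw : Tendsto (fun t => ‖U t‖) (𝓝[Ico 0 t₁] t₁) (𝓝 ‖U t₁‖) :=
        ((hU.1 t₁ ht₁.1).mono (fun t ht => ⟨ht.1, ht.2.le.trans ht₁.1.2⟩)).norm
      have : (𝓝[Ico 0 t₁] t₁).NeBot := by
        rw [← mem_closure_iff_nhdsWithin_neBot, closure_Ico hpos.ne]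
        exact ⟨hpos.le, le_rfl⟩
      exact le_of_tendsto hcw (by filter_upwards [self_mem_nhdsWithin] with t ht using hbd t ht)
    have := ht₁.2
    linarith [le_max_left B ‖U₀‖]
  refine ⟨U, hU.congr (fun _ _ => rfl) fun t ht => ?_⟩
  simp only [radialRetraction_of_norm_le hR0 (hlt t ht).le]

/-- The formal derivative `f'` of `f`: it is linear and bounded in the second variable,
continuous, and approximates `f` to second order on bounded sets. -/
structure IsQuadraticDeriv (f : X → X) (f' : X → X → X) : Prop where
  map_add : ∀ x w w', f' x (w + w') = f' x w + f' x w'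
  map_smul : ∀ x (c : ℝ) w, f' x (c • w) = c • f' x w
  continuous : Continuous fun p : X × X => f' p.1 p.2
  bound : ∀ R : ℝ, ∃ l, 0 ≤ l ∧ ∀ x w, ‖x‖ ≤ R → ‖f' x w‖ ≤ l * ‖w‖
  remainder : ∀ R : ℝ, ∃ c, 0 ≤ c ∧ ∀ x y, ‖x‖ ≤ R → ‖y‖ ≤ R →
    ‖f y - f x - f' x (y - x)‖ ≤ c * ‖y - x‖ ^ 2

theorem IsQuadraticDeriv.map_sub {f : X → X} {f' : X → X → X} (h : IsQuadraticDeriv f f')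
    (x w w' : X) : f' x (w - w') = f' x w - f' x w' := by
  have := h.map_smul x (-1) w'
  rw [neg_one_smul, neg_one_smul] at this
  rw [sub_eq_add_neg, h.map_add, this, sub_eq_add_neg]

theorem IsQuadraticDeriv.isLocLip {f : X → X} {f' : X → X → X} (h : IsQuadraticDeriv f f')
    {U : ℝ → X} (hU : ContinuousOn U (Ici 0)) : IsLocLip fun t => f' (U t) where
  cont := h.continuous.comp_continuousOn
    ((hU.comp continuousOn_fst fun _ hp => hp.1).prodMk continuousOn_snd)
  lip T R := by
    obtain ⟨B, hB⟩ := isCompact_Icc.exists_bound_of_continuousOn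
      (hU.mono fun t (ht : t ∈ Icc 0 T) => ht.1)
    obtain ⟨l, hl, h'⟩ := h.bound B
    exact ⟨l, hl, fun t ht x y _ _ => by rw [← h.map_sub]; exact h' _ _ (hB t ht)⟩

/-- A continuous `U` is bounded on `[0, T]`, so the linearized forcing is Lipschitz in the second
variable on all of `X` and needs no truncation. -/
theorem IsBoundedSemigroup.exists_linearized [CompleteSpace X]
    (hE : IsBoundedSemigroup E K) {f : X → X} {f' : X → X → X} (h : IsQuadraticDeriv f f')
    {U : ℝ → X} (hU : ContinuousOn U (Ici 0)) (W₀ : X) :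
    ∃ W, IsUniqueMildSolution E (fun t => f' (U t)) W₀ W := by
  refine hE.exists_isUniqueMildSolution (h.isLocLip hU) fun T hT => ?_
  obtain ⟨B, hB⟩ := isCompact_Icc.exists_bound_of_continuousOn
    (hU.mono fun t (ht : t ∈ Icc 0 T) => ht.1)
  obtain ⟨l, hl, h'⟩ := h.bound B
  exact hE.exists_isMildOn (h.isLocLip hU).cont hT hl
    (fun t ht x y => by rw [← h.map_sub]; exact h' _ _ (hB t ht)) W₀

/-- The solution operator of the linearized problem at time `t`. -/
theorem IsBoundedSemigroup.exists_linearized_clm [CompleteSpace X]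
    (hE : IsBoundedSemigroup E K) {f : X → X} {f' : X → X → X} (h : IsQuadraticDeriv f f')
    {U : ℝ → X} (hU : ContinuousOn U (Ici 0)) {W : X → ℝ → X}
    (hW : ∀ W₀, IsUniqueMildSolution E (fun t => f' (U t)) W₀ (W W₀)) {t : ℝ} (ht : 0 ≤ t) :
    ∃ D : X →L[ℝ] X, ∀ W₀, D W₀ = W W₀ t := by
  have hK := hE.K_nonneg
  have hlip := h.isLocLip hU
  have hd := fun W₀ => ((hW W₀).1.isMildOn t).exists_duhamel hlip ht
  have hadd : ∀ a b, W (a + b) t = W a t + W b t := by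
    intro a b
    obtain ⟨g, hg, hg1, hg2⟩ := hd a
    obtain ⟨k, hk, hk1, hk2⟩ := hd b
    have hm : IsMildOn E (fun t => f' (U t)) (a + b) t fun s => W a s + W b s := by
      refine ⟨((hW a).1.isMildOn t).1.add ((hW b).1.isMildOn t).1, fun s hs => ?_⟩
      change W a s + W b s = _
      rw [hg2 s hs, hk2 s hs, ← hE.duhamel_add hg hk]
      refine duhamel_congr hs.1 fun τ hτ => ?_
      have hτ' : τ ∈ Icc 0 t := ⟨hτ.1, hτ.2.trans hs.2⟩
      simp only [h.map_add, hg1 τ hτ', hk1 τ hτ']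
    exact hE.eq_of_isMildOn hlip ((hW (a + b)).1.isMildOn t) hm ⟨ht, le_rfl⟩
  have hsmul : ∀ (c : ℝ) a, W (c • a) t = c • W a t := by
    intro c a
    obtain ⟨g, hg, hg1, hg2⟩ := hd a
    have hm : IsMildOn E (fun t => f' (U t)) (c • a) t fun s => c • W a s := by
      refine ⟨((hW a).1.isMildOn t).1.const_smul c, fun s hs => ?_⟩
      change c • W a s = _
      rw [hg2 s hs, ← duhamel_smul]
      refine duhamel_congr hs.1 fun τ hτ => ?_
      simp only [h.map_smul, hg1 τ ⟨hτ.1, hτ.2.trans hs.2⟩]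
    exact hE.eq_of_isMildOn hlip ((hW (c • a)).1.isMildOn t) hm ⟨ht, le_rfl⟩
  obtain ⟨B, hB⟩ := isCompact_Icc.exists_bound_of_continuousOn
    (hU.mono fun s (hs : s ∈ Icc 0 t) => hs.1)
  obtain ⟨l, hl, h'⟩ := h.bound B
  refine ⟨LinearMap.mkContinuous ⟨⟨fun a => W a t, hadd⟩, hsmul⟩
    (K * Real.exp (K * l * t)) fun a => ?_, fun _ => rfl⟩
  obtain ⟨g, hg, hg1, hg2⟩ := hd a
  have := hE.norm_duhamel_le hg (x := a) (T := t) hl le_rfl (fun s hs => by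
    rw [← hg2 s hs, hg1 s hs, add_zero]
    exact h' _ _ (hB s hs)) ⟨ht, le_rfl⟩
  rw [← hg2 t ⟨ht, le_rfl⟩] at this
  refine this.trans_eq ?_
  ring

/-- Perturbing the initial value by `k` moves the solution by at most `C₁ ‖k‖`. The error of
linearization solves the linearized problem with zero initial value and forcing at most `c (C₁ ‖k‖)
^ 2`, so Gronwall gives an error `O(‖k‖ ^ 2)`. -/
theorem IsBoundedSemigroup.hasFDerivAt_semiflow [CompleteSpace X]
    (hE : IsBoundedSemigroup E K) {f : X → X} {f' : X → X → X} (hf : IsLipOnBounded f)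
    (hb : HasAPrioriBound E f) (h : IsQuadraticDeriv f f') {S : ℝ → X → X}
    (hS : ∀ U₀, IsUniqueMildSolution E (fun _ => f) U₀ fun t => S t U₀) (U₀ : X) {W : X → ℝ → X}
    (hW : ∀ W₀, IsUniqueMildSolution E (fun t => f' (S t U₀)) W₀ (W W₀)) {t : ℝ} (ht : 0 ≤ t)
    {D : X →L[ℝ] X} (hD : ∀ W₀, D W₀ = W W₀ t) : HasFDerivAt (S t) D U₀ := by
  have hK := hE.K_nonneg
  obtain ⟨B, hB⟩ := hb t (‖U₀‖ + 1)
  have hB0 : ∀ s ∈ Icc 0 t, ‖S s U₀‖ ≤ B :=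
    hB U₀ (by linarith) t le_rfl _ ((hS U₀).1.isMildOn t)
  obtain ⟨l, hl, hl'⟩ := hf B
  obtain ⟨m, hm, hm'⟩ := h.bound B
  obtain ⟨c, hc, hc'⟩ := h.remainder B
  set C₁ := K * Real.exp (K * l * t) with hC₁
  set C₂ := K * t * (c * C₁ ^ 2) * Real.exp (K * m * t) with hC₂
  have hlipW := h.isLocLip (hS U₀).1.1
  have key : ∀ k : X, ‖k‖ ≤ 1 → ‖S t (U₀ + k) - S t U₀ - D k‖ ≤ C₂ * ‖k‖ ^ 2 := by
    intro k hk
    have hBk : ∀ s ∈ Icc 0 t, ‖S s (U₀ + k)‖ ≤ B :=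
      hB (U₀ + k) ((norm_add_le _ _).trans (by linarith)) t le_rfl _ ((hS _).1.isMildOn t)
    have h1 : ∀ s ∈ Icc 0 t, ‖S s (U₀ + k) - S s U₀‖ ≤ C₁ * ‖k‖ := by
      intro s hs
      have := hE.norm_sub_le_of_isMildOn hf.isLocLip hl (fun _ _ => hl')
        ((hS (U₀ + k)).1.isMildOn t) ((hS U₀).1.isMildOn t) hBk hB0 hs
      rw [add_sub_cancel_left] at this
      exact this.trans_eq (by ring)
    obtain ⟨g₁, hg₁, hg₁1, hg₁2⟩ := ((hS (U₀ + k)).1.isMildOn t).exists_duhamel hf.isLocLip ht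
    obtain ⟨g₀, hg₀, hg₀1, hg₀2⟩ := ((hS U₀).1.isMildOn t).exists_duhamel hf.isLocLip ht
    obtain ⟨g, hg, hg1, hg2⟩ := ((hW k).1.isMildOn t).exists_duhamel hlipW ht
    have e : ∀ s ∈ Icc 0 t, duhamel E (fun s => g₁ s - g₀ s - g s) 0 s
        = S s (U₀ + k) - S s U₀ - W k s := by
      intro s hs
      have e0 : (0 : X) = U₀ + k - U₀ - k := by abel
      rw [e0, hE.duhamel_sub (hg₁.fun_sub hg₀) hg, hE.duhamel_sub hg₁ hg₀, ← hg2 s hs,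
        ← hg₁2 s hs, ← hg₀2 s hs]
    have h2 := hE.norm_duhamel_le ((hg₁.fun_sub hg₀).fun_sub hg) (x := 0) (T := t) hm
      (ε := c * (C₁ * ‖k‖) ^ 2) (by positivity) (fun s hs => by
        rw [e s hs, hg₁1 s hs, hg₀1 s hs, hg1 s hs]
        -- Linearized operator applied to the error, plus the Taylor remainder of `f` between the
        -- two solutions.
        have e1 : f (S s (U₀ + k)) - f (S s U₀) - f' (S s U₀) (W k s)
            = f' (S s U₀) (S s (U₀ + k) - S s U₀ - W k s) + (f (S s (U₀ + k)) - f (S s U₀)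
              - f' (S s U₀) (S s (U₀ + k) - S s U₀)) := by
          rw [h.map_sub _ (S s (U₀ + k) - S s U₀)]; abel
        rw [e1]
        refine (norm_add_le _ _).trans (add_le_add (hm' _ _ (hB0 s hs)) ?_)
        refine (hc' _ _ (hB0 s hs) (hBk s hs)).trans ?_
        gcongr
        exact h1 s hs) ⟨ht, le_rfl⟩
    rw [e t ⟨ht, le_rfl⟩, norm_zero, mul_zero, zero_add, ← hD] at h2
    exact h2.trans_eq (by rw [hC₂]; ring)
  rw [hasFDerivAt_iff_isLittleO_nhds_zero]
  have hO : (fun k => S t (U₀ + k) - S t U₀ - D k) =O[𝓝 0] fun k => ‖k‖ ^ 2 := by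
    refine Asymptotics.IsBigO.of_bound C₂ ?_
    filter_upwards [Metric.closedBall_mem_nhds (0 : X) one_pos] with k hk
    rw [norm_pow, norm_norm]
    exact key k (by simpa using hk)
  refine hO.trans_isLittleO ?_
  exact Asymptotics.isLittleO_norm_pow_id one_lt_two

/-- Global semiflows generated by semilinear equations, and their derivatives. -/
theorem IsBoundedSemigroup.exists_semiflow [CompleteSpace X]
    (hE : IsBoundedSemigroup E K) {f : X → X} {f' : X → X → X} (hf : IsLipOnBounded f)
    (hb : HasAPrioriBound E f) (h : IsQuadraticDeriv f f') : ∃ S : ℝ → X → X,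
      (∀ U₀, IsUniqueMildSolution E (fun _ => f) U₀ fun t => S t U₀) ∧
      (∀ t, 0 ≤ t → Differentiable ℝ (S t)) ∧
      ∀ U₀ W₀, ∃ W, IsUniqueMildSolution E (fun t => f' (S t U₀)) W₀ W ∧
        ∀ t, 0 ≤ t → fderiv ℝ (S t) U₀ W₀ = W t := by
  choose S hS using fun U₀ => hE.exists_isUniqueMildSolution hf.isLocLip
    fun T hT => hE.exists_isMildOn_of_bound hf hb U₀ hT
  choose W hW using fun U₀ => hE.exists_linearized h (hS U₀).1.1
  choose! D hD using fun U₀ t ht => hE.exists_linearized_clm h (hS U₀).1.1 (hW U₀) (t := t) ht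
  have hder : ∀ U₀ t, 0 ≤ t → HasFDerivAt (fun U => S U t) (D U₀ t) U₀ := fun U₀ t ht =>
    hE.hasFDerivAt_semiflow hf hb h (S := fun t U => S U t) hS U₀ (hW U₀) ht (hD U₀ t ht)
  refine ⟨fun t U => S U t, hS, fun t ht U₀ => (hder U₀ t ht).differentiableAt,
    fun U₀ W₀ => ⟨W U₀ W₀, hW U₀ W₀, fun t ht => ?_⟩⟩
  rw [(hder U₀ t ht).fderiv, hD U₀ t ht]

end Semiflow

end ThermoPlate

namespace ThermoPlate

/-! ### The first-order memory equation solved by exponential convolution. -/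

section ExpConv

variable {X : Type*} [NormedAddCommGroup X] [InnerProductSpace ℝ X]

/-- The integrand is almost everywhere the derivative of `exp (l y) ∫₀ʸ g`. As `g` is merely
integrable, this product is only absolutely continuous, which is still enough for the fundamental
theorem. -/
theorem integral_exp_mul_add_real {g : ℝ → ℝ} {s : ℝ}
    (hg : IntervalIntegrable g volume 0 s) (l : ℝ) :
    ∫ y in (0 : ℝ)..s, Real.exp (l * y) * (g y + l * ∫ z in (0 : ℝ)..y, g z)
      = Real.exp (l * s) * ∫ z in (0 : ℝ)..s, g z := by
  have hac := hg.absolutelyContinuousOnInterval_intervalIntegral (c := 0) left_mem_uIcc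
  have hexp : AbsolutelyContinuousOnInterval (fun y => Real.exp (l * y)) 0 s := by
    refine ContDiffOn.absolutelyContinuousOnInterval ?_
    exact (Real.contDiff_exp.comp (contDiff_const.mul contDiff_id)).contDiffOn
  have h1 := (hexp.mul hac).integral_deriv_eq_sub
  simp only [Pi.mul_apply, intervalIntegral.integral_same, mul_zero, sub_zero] at h1
  rw [← h1]
  refine intervalIntegral.integral_congr_ae ?_
  filter_upwards [hg.ae_hasDerivAt_integral] with y hy hy'
  have h2 := hy (uIoc_subset_uIcc hy') 0 left_mem_uIcc
  have h3 : HasDerivAt (fun y => Real.exp (l * y)) (Real.exp (l * y) * l) y := by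
    simpa using ((hasDerivAt_id y).const_mul l).exp
  rw [(h3.mul h2).deriv]
  ring

/-- The solution `∫₀ˢ exp (-l (s - y)) φ(y) dy` of `η' + l η = φ`, `η(0) = 0`. -/
def expConv (l : ℝ) (φ : ℝ → X) (s : ℝ) : X :=
  ∫ y in (0 : ℝ)..s, Real.exp (-(l * (s - y))) • φ y

theorem expConv_eq (l : ℝ) (φ : ℝ → X) (s : ℝ) :
    expConv l φ s = Real.exp (-(l * s)) • ∫ y in (0 : ℝ)..s, Real.exp (l * y) • φ y := by
  rw [expConv, ← intervalIntegral.integral_smul]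
  congr 1
  funext y
  rw [smul_smul, ← Real.exp_add]
  congr 2; ring

variable [CompleteSpace X]

theorem integral_exp_smul_add {g : ℝ → X} {s : ℝ} (hg : IntervalIntegrable g volume 0 s)
    (l : ℝ) :
    ∫ y in (0 : ℝ)..s, Real.exp (l * y) • (g y + l • ∫ z in (0 : ℝ)..y, g z)
      = Real.exp (l * s) • ∫ z in (0 : ℝ)..s, g z := by
  have hc : ContinuousOn (fun y => ∫ z in (0 : ℝ)..y, g z) (uIcc 0 s) :=
    intervalIntegral.continuousOn_primitive_interval' hg left_mem_uIcc
  have hi : IntervalIntegrable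
      (fun y => Real.exp (l * y) • (g y + l • ∫ z in (0 : ℝ)..y, g z)) volume 0 s :=
    (hg.add (hc.const_smul l).intervalIntegrable).continuousOn_smul (by fun_prop)
  -- Testing against a fixed vector reduces the claim to the scalar case.
  refine ext_inner_left ℝ fun x => ?_
  have h1 := (innerSL ℝ x).intervalIntegral_comp_comm hi
  have h2 := (innerSL ℝ x).intervalIntegral_comp_comm hg
  have h3 := integral_exp_mul_add_real (g := fun y => ⟪x, g y⟫_ℝ)
    ⟨(innerSL ℝ x).integrable_comp hg.1, (innerSL ℝ x).integrable_comp hg.2⟩ l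
  simp only [innerSL_apply_apply] at h1 h2
  rw [← h1, real_inner_smul_right, ← h2, ← h3]
  refine intervalIntegral.integral_congr fun y hy => ?_
  have h4 := (innerSL ℝ x).intervalIntegral_comp_comm
    (hg.mono_set (uIcc_subset_uIcc left_mem_uIcc hy))
  simp only [innerSL_apply_apply] at h4
  simp only [real_inner_smul_right, inner_add_right, h4]

/-- With `expConv_eq_integral`, this says that `η ↦ η_s + l η` on functions vanishing at zero and
`expConv l` are mutually inverse. -/
theorem integral_eq_expConv {g : ℝ → X} {s : ℝ} (hg : IntervalIntegrable g volume 0 s)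
    (l : ℝ) :
    ∫ y in (0 : ℝ)..s, g y = expConv l (fun y => g y + l • ∫ z in (0 : ℝ)..y, g z) s := by
  rw [expConv_eq, integral_exp_smul_add hg, smul_smul, ← Real.exp_add]
  simp

theorem expConv_eq_integral {φ : ℝ → X} {s : ℝ} (hφ : IntervalIntegrable φ volume 0 s) (l : ℝ) :
    IntervalIntegrable (fun y => φ y - l • expConv l φ y) volume 0 s ∧
      expConv l φ s = ∫ y in (0 : ℝ)..s, (φ y - l • expConv l φ y) := by
  have hg : IntervalIntegrable (fun y => Real.exp (l * y) • φ y) volume 0 s :=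
    hφ.continuousOn_smul (by fun_prop)
  have hc := intervalIntegral.continuousOn_primitive_interval' hg left_mem_uIcc
  constructor
  · refine hφ.sub (ContinuousOn.intervalIntegrable ?_)
    simp only [expConv_eq]
    exact (ContinuousOn.smul (by fun_prop) hc).const_smul l
  · rw [expConv_eq, ← neg_mul, ← integral_exp_smul_add hg (-l)]
    refine intervalIntegral.integral_congr fun y _ => ?_
    simp only [expConv_eq, smul_add, smul_smul, ← Real.exp_add, neg_mul, neg_add_cancel,
      Real.exp_zero, one_smul]
    module

end ExpConv

/-! ### Memory kernels and comparison of the weighted measure with Lebesgue measure. -/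

section Kernel

variable {μ : ℝ → ℝ} {δ : ℝ}

namespace IsMemoryKernel

theorem antitoneOn (hμ : IsMemoryKernel μ δ) (hδ : 0 < δ) : AntitoneOn μ (Ici 0) := by
  refine antitoneOn_of_deriv_nonpos (convex_Ici 0) hμ.continuousOn ?_ ?_
  · rw [interior_Ici]
    exact hμ.contDiffOn.differentiableOn one_ne_zero
  · rw [interior_Ici]
    intro s (hs : 0 < s)
    have h1 := hμ.deriv_le s hs
    have h2 := mul_nonneg hδ.le (hμ.nonneg s hs.le)
    linarith

theorem aemeasurable (hμ : IsMemoryKernel μ δ) :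
    AEMeasurable (fun s => ENNReal.ofReal (μ s)) (volume.restrict (Ioi 0)) :=
  ((hμ.continuousOn.mono Ioi_subset_Ici_self).aemeasurable measurableSet_Ioi).ennreal_ofReal

theorem isFiniteMeasure (hμ : IsMemoryKernel μ δ) : IsFiniteMeasure (memMeasure μ) :=
  isFiniteMeasure_withDensity_ofReal hμ.integrableOn.2

theorem ae_pos (hμ : IsMemoryKernel μ δ) : ∀ᵐ s ∂(memMeasure μ), 0 < s ∧ 0 < μ s := by
  rw [memMeasure, ae_withDensity_iff' hμ.aemeasurable]
  filter_upwards [ae_restrict_mem measurableSet_Ioi] with s (hs : 0 < s) h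
  refine ⟨hs, ?_⟩
  by_contra! hn
  exact h (ENNReal.ofReal_eq_zero.2 hn)

/-- A nonincreasing kernel is at least `μ s` on `(0, s]`. Hence almost-everywhere statements and
integrability for the weighted measure pass to Lebesgue measure on `(0, s]` whenever `μ s > 0`. -/
theorem restrict_le (hμ : IsMemoryKernel μ δ) (hδ : 0 < δ) {s : ℝ} (hs : 0 < s) (h : 0 < μ s) :
    volume.restrict (Ioc 0 s) ≤ (ENNReal.ofReal (μ s))⁻¹ • memMeasure μ := by
  have h0 : ENNReal.ofReal (μ s) ≠ 0 := (ENNReal.ofReal_pos.2 h).ne'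
  rw [Measure.le_iff]
  intro B hB
  rw [Measure.smul_apply, smul_eq_mul, ← ENNReal.div_eq_inv_mul,
    ENNReal.le_div_iff_mul_le (Or.inl h0) (Or.inl ENNReal.ofReal_ne_top), memMeasure,
    withDensity_apply _ hB, Measure.restrict_restrict hB, Measure.restrict_apply hB]
  calc volume (B ∩ Ioc 0 s) * ENNReal.ofReal (μ s)
      = ∫⁻ _ in B ∩ Ioc 0 s, ENNReal.ofReal (μ s) := by
        rw [setLIntegral_const, mul_comm]
    _ ≤ ∫⁻ y in B ∩ Ioc 0 s, ENNReal.ofReal (μ y) := by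
        refine setLIntegral_mono' (hB.inter measurableSet_Ioc) fun y hy => ?_
        exact ENNReal.ofReal_le_ofReal
          (hμ.antitoneOn hδ (mem_Ici.2 hy.2.1.le) (mem_Ici.2 hs.le) hy.2.2)
    _ ≤ ∫⁻ y in B ∩ Ioi 0, ENNReal.ofReal (μ y) :=
        lintegral_mono_set (inter_subset_inter_right _ Ioc_subset_Ioi_self)

theorem ae_restrict (hμ : IsMemoryKernel μ δ) (hδ : 0 < δ) {s : ℝ} (hs : 0 < s) (h : 0 < μ s)
    {p : ℝ → Prop} (hp : ∀ᵐ y ∂(memMeasure μ), p y) : ∀ᵐ y ∂(volume.restrict (Ioc 0 s)), p y :=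
  (Measure.absolutelyContinuous_of_le_smul (hμ.restrict_le hδ hs h)).ae_le hp

theorem intervalIntegrable (hμ : IsMemoryKernel μ δ) (hδ : 0 < δ) {X : Type*}
    [NormedAddCommGroup X] {s : ℝ} (hs : 0 < s) (h : 0 < μ s) {g : ℝ → X}
    (hg : MemLp g 2 (memMeasure μ)) : IntervalIntegrable g volume 0 s := by
  have := hμ.isFiniteMeasure
  rw [intervalIntegrable_iff_integrableOn_Ioc_of_le hs.le]
  refine Integrable.mono_measure (Integrable.smul_measure (hg.integrable one_le_two) ?_)
    (hμ.restrict_le hδ hs h)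
  exact ENNReal.inv_ne_top.2 (ENNReal.ofReal_pos.2 h).ne'

end IsMemoryKernel
end Kernel

end ThermoPlate

namespace ThermoPlate

/-! ### Young's inequality for the exponential kernel in the weighted space. -/

section Young

/-- The kernel `exp (-l r)` on `r ≥ 0`. -/
def expKernel (l r : ℝ) : ℝ≥0∞ :=
  (Ici (0 : ℝ)).indicator (fun r => ENNReal.ofReal (Real.exp (-(l * r)))) r

theorem measurable_expKernel (l : ℝ) : Measurable (expKernel l) :=
  Measurable.indicator (by fun_prop) measurableSet_Ici

theorem lintegral_expKernel {l : ℝ} (hl : 0 < l) : ∫⁻ r, expKernel l r = ENNReal.ofReal l⁻¹ := by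
  have hi : IntegrableOn (fun r : ℝ => Real.exp (-l * r)) (Ioi 0) :=
    integrableOn_exp_mul_Ioi (neg_lt_zero.2 hl) 0
  have h := integral_exp_mul_Ioi (neg_lt_zero.2 hl) 0
  unfold expKernel
  rw [lintegral_indicator measurableSet_Ici, setLIntegral_congr Ioi_ae_eq_Ici.symm]
  simp only [← neg_mul]
  rw [← ofReal_integral_eq_lintegral_ofReal hi (ae_of_all _ fun _ => Real.exp_nonneg _), h]
  simp

theorem expKernel_mul (l r : ℝ) : expKernel (l / 2) r * expKernel (l / 2) r = expKernel l r := by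
  unfold expKernel
  by_cases hr : r ∈ Ici (0 : ℝ)
  · rw [indicator_of_mem hr, indicator_of_mem hr, ← ENNReal.ofReal_mul (Real.exp_nonneg _),
      ← Real.exp_add]
    congr 2; ring
  · rw [indicator_of_notMem hr, indicator_of_notMem hr, zero_mul]

/-- Cauchy–Schwarz after splitting the kernel into two square roots, each an exponential kernel of
rate `l / 2`. -/
theorem sq_lintegral_expKernel_mul_le {l : ℝ} (hl : 0 < l) {n : ℝ → ℝ≥0∞} (hn : Measurable n)
    (s : ℝ) : (∫⁻ y in Ioi 0, expKernel l (s - y) * n y) ^ 2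
      ≤ ENNReal.ofReal l⁻¹ * ∫⁻ y in Ioi 0, expKernel l (s - y) * n y ^ 2 := by
  have hm : Measurable fun y => expKernel (l / 2) (s - y) :=
    (measurable_expKernel _).comp (by fun_prop)
  have h := ENNReal.lintegral_mul_le_Lp_mul_Lq (volume.restrict (Ioi 0))
    Real.HolderConjugate.two_two
    hm.aemeasurable (hm.mul hn).aemeasurable
  have h1 : ∀ y, (expKernel (l / 2) (s - y)) ^ (2 : ℝ) = expKernel l (s - y) := fun y => by
    rw [ENNReal.rpow_two, sq, expKernel_mul]
  have h2 : ∀ y, (((fun y => expKernel (l / 2) (s - y)) * n) y) ^ (2 : ℝ)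
      = expKernel l (s - y) * n y ^ 2 := fun y => by
    rw [Pi.mul_apply, ENNReal.mul_rpow_of_nonneg _ _ zero_le_two, h1, ENNReal.rpow_two]
  have h3 : ∀ y, ((fun y => expKernel (l / 2) (s - y)) * ((fun y => expKernel (l / 2) (s - y)) * n)) y
      = expKernel l (s - y) * n y := fun y => by
    simp only [Pi.mul_apply]; rw [← mul_assoc, expKernel_mul]
  simp only [h1, h2, h3] at h
  have h4 : ∫⁻ y in Ioi 0, expKernel l (s - y) ≤ ENNReal.ofReal l⁻¹ := by
    refine (setLIntegral_le_lintegral _ _).trans ?_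
    rw [lintegral_sub_left_eq_self (expKernel l) s, lintegral_expKernel hl]
  calc _ ≤ ((∫⁻ y in Ioi 0, expKernel l (s - y)) ^ (1 / 2 : ℝ)
        * (∫⁻ y in Ioi 0, expKernel l (s - y) * n y ^ 2) ^ (1 / 2 : ℝ)) ^ 2 := by gcongr
    _ = (∫⁻ y in Ioi 0, expKernel l (s - y)) * ∫⁻ y in Ioi 0, expKernel l (s - y) * n y ^ 2 := by
        rw [mul_pow, ← ENNReal.rpow_two, ← ENNReal.rpow_two, ← ENNReal.rpow_mul,
          ← ENNReal.rpow_mul]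
        norm_num
    _ ≤ _ := by gcongr

variable {μ : ℝ → ℝ} {δ : ℝ}

/-- The kernel lives on `s ≥ y`, where `μ s ≤ μ y`. Monotonicity of the weight thus keeps the
unweighted constant `1 / l`. -/
theorem IsMemoryKernel.lintegral_expKernel_sub_le (hμ : IsMemoryKernel μ δ) (hδ : 0 < δ) {l : ℝ}
    (hl : 0 < l) {y : ℝ} (hy : 0 < y) :
    ∫⁻ s, expKernel l (s - y) ∂(memMeasure μ) ≤ ENNReal.ofReal (μ y) * ENNReal.ofReal l⁻¹ := by
  have hm : Measurable fun s => expKernel l (s - y) := (measurable_expKernel _).comp (by fun_prop)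
  rw [memMeasure, lintegral_withDensity_eq_lintegral_mul₀ hμ.aemeasurable hm.aemeasurable]
  calc _ ≤ ∫⁻ s in Ioi 0, ENNReal.ofReal (μ y) * expKernel l (s - y) := by
        refine setLIntegral_mono' measurableSet_Ioi fun s (hs : 0 < s) => ?_
        rw [Pi.mul_apply]
        by_cases h : s - y ∈ Ici (0 : ℝ)
        · gcongr
          exact hμ.antitoneOn hδ (mem_Ici.2 hy.le) (mem_Ici.2 hs.le) (sub_nonneg.1 h)
        · rw [expKernel, indicator_of_notMem h, mul_zero, mul_zero]
    _ ≤ ∫⁻ s, ENNReal.ofReal (μ y) * expKernel l (s - y) := setLIntegral_le_lintegral _ _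
    _ = _ := by
        rw [lintegral_const_mul _ hm, lintegral_sub_right_eq_self (expKernel l) y,
          lintegral_expKernel hl]

variable {X : Type*} [NormedAddCommGroup X] [InnerProductSpace ℝ X]

theorem enorm_expConv_le (l : ℝ) (φ : ℝ → X) {s : ℝ} (hs : 0 ≤ s) :
    ‖expConv l φ s‖ₑ ≤ ∫⁻ y in Ioi 0, expKernel l (s - y) * ‖φ y‖ₑ := by
  rw [expConv, intervalIntegral.integral_of_le hs]
  refine (enorm_integral_le_lintegral_enorm _).trans ?_
  calc _ = ∫⁻ y in Ioc 0 s, expKernel l (s - y) * ‖φ y‖ₑ := by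
        refine setLIntegral_congr_fun measurableSet_Ioc fun y hy => ?_
        have : s - y ∈ Ici (0 : ℝ) := sub_nonneg.2 hy.2
        simp only [expKernel]
        rw [indicator_of_mem this, enorm_smul, Real.enorm_of_nonneg (Real.exp_nonneg _)]
    _ ≤ _ := lintegral_mono_set Ioc_subset_Ioi_self

/-- Young's inequality for the exponential convolution in the weighted space. -/
theorem IsMemoryKernel.lintegral_expConv_le (hμ : IsMemoryKernel μ δ) (hδ : 0 < δ) {l : ℝ}
    (hl : 0 < l) {φ : ℝ → X} (hφ : StronglyMeasurable φ) :
    ∫⁻ s, ‖expConv l φ s‖ₑ ^ 2 ∂(memMeasure μ)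
      ≤ ENNReal.ofReal l⁻¹ ^ 2 * ∫⁻ s, ‖φ s‖ₑ ^ 2 ∂(memMeasure μ) := by
  have hf := hμ.isFiniteMeasure
  have hn : Measurable fun y => ‖φ y‖ₑ := hφ.enorm
  have hjm : Measurable fun p : ℝ × ℝ => expKernel l (p.1 - p.2) * ‖φ p.2‖ₑ ^ 2 :=
    ((measurable_expKernel l).comp (measurable_fst.sub measurable_snd)).mul
      ((hn.comp measurable_snd).pow_const 2)
  have hm : ∀ y, Measurable fun s => expKernel l (s - y) := fun y =>
    (measurable_expKernel _).comp (by fun_prop)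
  calc _ ≤ ∫⁻ s, (ENNReal.ofReal l⁻¹ * ∫⁻ y in Ioi 0, expKernel l (s - y) * ‖φ y‖ₑ ^ 2)
        ∂(memMeasure μ) := by
        refine lintegral_mono_ae ?_
        filter_upwards [hμ.ae_pos] with s hs
        refine le_trans ?_ (sq_lintegral_expKernel_mul_le hl hn s)
        gcongr
        exact enorm_expConv_le l φ hs.1.le
    _ = ENNReal.ofReal l⁻¹ * ∫⁻ y in Ioi 0, (∫⁻ s, expKernel l (s - y) * ‖φ y‖ₑ ^ 2
        ∂(memMeasure μ)) := by
        rw [lintegral_const_mul _ hjm.lintegral_prod_right', lintegral_lintegral_swap]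
        exact hjm.aemeasurable
    _ ≤ ENNReal.ofReal l⁻¹ * ∫⁻ y in Ioi 0, ENNReal.ofReal l⁻¹
        * (ENNReal.ofReal (μ y) * ‖φ y‖ₑ ^ 2) := by
        refine mul_le_mul_right (setLIntegral_mono' measurableSet_Ioi fun y hy => ?_) _
        rw [lintegral_mul_const _ (hm y), ← mul_assoc, mul_comm (ENNReal.ofReal l⁻¹)]
        exact mul_le_mul_left (hμ.lintegral_expKernel_sub_le hδ hl hy) _
    _ = _ := by
        rw [lintegral_const_mul' _ _ ENNReal.ofReal_ne_top, memMeasure,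
          lintegral_withDensity_eq_lintegral_mul₀ hμ.aemeasurable (hn.pow_const 2).aemeasurable,
          ← mul_assoc, sq]
        rfl

/-- The convolution is a parameter integral of a jointly measurable function over `0 < y ≤ s`. The
indicator discards `s ≤ 0`, where the interval integral would run backwards. -/
theorem stronglyMeasurable_indicator_expConv (l : ℝ) {φ : ℝ → X} (hφ : StronglyMeasurable φ) :
    StronglyMeasurable ((Ioi 0).indicator (expConv l φ)) := by
  have h : StronglyMeasurable fun s : ℝ => ∫ y, {p : ℝ × ℝ | 0 < p.2 ∧ p.2 ≤ p.1}.indicator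
      (fun p => Real.exp (-(l * (p.1 - p.2))) • φ p.2) (s, y) := by
    refine StronglyMeasurable.integral_prod_right' (StronglyMeasurable.indicator ?_ ?_)
    · exact (Continuous.stronglyMeasurable (by fun_prop)).smul
        (hφ.comp_measurable measurable_snd)
    · exact (measurableSet_lt measurable_const measurable_snd).inter
        (measurableSet_le measurable_snd measurable_fst)
  convert h.indicator measurableSet_Ioi using 1
  refine indicator_congr fun s (hs : 0 < s) => ?_
  rw [expConv, intervalIntegral.integral_of_le hs.le, ← integral_indicator measurableSet_Ioc]
  rfl

end Young

end ThermoPlate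

namespace ThermoPlate

/-! ### The generator of the shift semigroup on the memory space. -/

section MemDeriv

variable {μ : ℝ → ℝ} {δ : ℝ} {X : Type*} [NormedAddCommGroup X] [InnerProductSpace ℝ X]

theorem expConv_congr {l s : ℝ} {φ ψ : ℝ → X} (hs : 0 ≤ s)
    (h : ∀ᵐ y ∂(volume.restrict (Ioc 0 s)), φ y = ψ y) : expConv l φ s = expConv l ψ s := by
  rw [expConv, expConv, intervalIntegral.integral_of_le hs, intervalIntegral.integral_of_le hs]
  refine integral_congr_ae ?_
  filter_upwards [h] with y hy
  rw [hy]

theorem intervalIntegral_congr_ae_restrict {s : ℝ} {φ ψ : ℝ → X} (hs : 0 ≤ s)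
    (h : ∀ᵐ y ∂(volume.restrict (Ioc 0 s)), φ y = ψ y) :
    ∫ y in (0 : ℝ)..s, φ y = ∫ y in (0 : ℝ)..s, ψ y := by
  rw [intervalIntegral.integral_of_le hs, intervalIntegral.integral_of_le hs]
  exact integral_congr_ae h

namespace IsMemoryKernel

theorem eLpNorm_expConv_le (hμ : IsMemoryKernel μ δ) (hδ : 0 < δ) {l : ℝ}
    (hl : 0 < l) {φ : ℝ → X} (hφ : StronglyMeasurable φ) :
    eLpNorm (expConv l φ) 2 (memMeasure μ) ≤ ENNReal.ofReal l⁻¹ * eLpNorm φ 2 (memMeasure μ) := by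
  have e : ∀ f : ℝ → X, eLpNorm f 2 (memMeasure μ)
      = (∫⁻ s, ‖f s‖ₑ ^ 2 ∂(memMeasure μ)) ^ (1 / 2 : ℝ) := fun f => by
    have := eLpNorm_nnreal_eq_lintegral (μ := memMeasure μ) (f := f) (p := 2) two_ne_zero
    simpa using this
  rw [e, e]
  calc _ ≤ (ENNReal.ofReal l⁻¹ ^ 2 * ∫⁻ s, ‖φ s‖ₑ ^ 2 ∂(memMeasure μ)) ^ (1 / 2 : ℝ) := by
        gcongr
        exact hμ.lintegral_expConv_le hδ hl hφ
    _ = _ := by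
        rw [ENNReal.mul_rpow_of_nonneg _ _ (by norm_num), ← ENNReal.rpow_natCast,
          ← ENNReal.rpow_mul]
        norm_num

variable [CompleteSpace X]

/-- The resolvent of the generator of the shift semigroup on the memory space. -/
theorem exists_hasMemDeriv (hμ : IsMemoryKernel μ δ) (hδ : 0 < δ) {l : ℝ} (hl : 0 < l)
    (φ : MemSpace μ X) : ∃ η : MemSpace μ X, HasMemDeriv η (φ - l • η) ∧
      ∀ᵐ s ∂(memMeasure μ), η s = expConv l φ s := by
  have hφ : StronglyMeasurable φ := Lp.stronglyMeasurable φ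
  have hae : (Ioi 0).indicator (expConv l φ) =ᵐ[memMeasure μ] expConv l φ := by
    filter_upwards [hμ.ae_pos] with s hs
    rw [indicator_of_mem (mem_Ioi.2 hs.1)]
  have hm : MemLp ((Ioi 0).indicator (expConv l φ)) 2 (memMeasure μ) := by
    refine ⟨(stronglyMeasurable_indicator_expConv l hφ).aestronglyMeasurable, ?_⟩
    rw [eLpNorm_congr_ae hae]
    exact (hμ.eLpNorm_expConv_le hδ hl hφ).trans_lt
      (ENNReal.mul_lt_top ENNReal.ofReal_lt_top (Lp.memLp φ).2)
  have hη : ∀ᵐ s ∂(memMeasure μ), hm.toLp _ s = expConv l φ s := hm.coeFn_toLp.trans hae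
  refine ⟨hm.toLp _, ?_, hη⟩
  have hd : ∀ᵐ s ∂(memMeasure μ), (φ - l • hm.toLp _ : MemSpace μ X) s
      = φ s - l • expConv l φ s := by
    filter_upwards [Lp.coeFn_sub φ (l • hm.toLp _), Lp.coeFn_smul l (hm.toLp _), hη]
      with s h1 h2 h3
    rw [h1, Pi.sub_apply, h2, Pi.smul_apply, h3]
  filter_upwards [hμ.ae_pos, hη] with s hs hηs
  refine ⟨hμ.intervalIntegrable hδ hs.1 hs.2 (Lp.memLp _), ?_⟩
  rw [hηs, (expConv_eq_integral (hμ.intervalIntegrable hδ hs.1 hs.2 (Lp.memLp φ)) l).2]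
  refine intervalIntegral_congr_ae_restrict hs.1.le ?_
  filter_upwards [hμ.ae_restrict hδ hs.1 hs.2 hd] with y hy using hy.symm

/-- Such an `η` is the exponential convolution of `g + l • η`, so Young's inequality applies. -/
theorem norm_le_of_hasMemDeriv (hμ : IsMemoryKernel μ δ) (hδ : 0 < δ) {l : ℝ} (hl : 0 < l)
    {η g : MemSpace μ X} (h : HasMemDeriv η g) : ‖η‖ ≤ l⁻¹ * ‖g + l • η‖ := by
  have hd : ∀ᵐ s ∂(memMeasure μ), (g + l • η : MemSpace μ X) s
      = g s + l • ∫ y in (0 : ℝ)..s, g y := by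
    filter_upwards [Lp.coeFn_add g (l • η), Lp.coeFn_smul l η, h] with s h1 h2 h3
    rw [h1, Pi.add_apply, h2, Pi.smul_apply, h3.2]
  have hη : ∀ᵐ s ∂(memMeasure μ), η s = expConv l (g + l • η : MemSpace μ X) s := by
    filter_upwards [h, hμ.ae_pos] with s h1 hs
    rw [h1.2, integral_eq_expConv h1.1 l]
    refine expConv_congr hs.1.le ?_
    filter_upwards [hμ.ae_restrict hδ hs.1 hs.2 hd] with y hy using hy.symm
  have h1 := hμ.eLpNorm_expConv_le hδ hl (Lp.stronglyMeasurable (g + l • η))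
  rw [← eLpNorm_congr_ae hη] at h1
  rw [Lp.norm_def, Lp.norm_def, ← ENNReal.toReal_ofReal (inv_nonneg.2 hl.le), ← ENNReal.toReal_mul]
  exact ENNReal.toReal_mono (ENNReal.mul_ne_top ENNReal.ofReal_ne_top (Lp.eLpNorm_ne_top _)) h1

/-- `-∂ₛ` is dissipative in the memory space. -/
theorem inner_nonneg_of_hasMemDeriv (hμ : IsMemoryKernel μ δ) (hδ : 0 < δ)
    {η g : MemSpace μ X} (h : HasMemDeriv η g) : 0 ≤ ⟪η, g⟫_ℝ := by
  by_contra! hn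
  set c := ⟪η, g⟫_ℝ with hc
  -- Squaring the resolvent estimate cancels `l ^ 2 ‖η‖ ^ 2`; the remaining term is linear in `l`,
  -- so a negative `c` is refuted by large `l`.
  have key : ∀ l : ℝ, 0 < l → 0 ≤ ‖g‖ ^ 2 + 2 * l * c := by
    intro l hl
    have h1 := hμ.norm_le_of_hasMemDeriv hδ hl h
    rw [le_inv_mul_iff₀ hl] at h1
    have h2 : (l * ‖η‖) ^ 2 ≤ ‖g + l • η‖ ^ 2 := by gcongr
    rw [norm_add_sq_real, real_inner_smul_right, norm_smul, Real.norm_of_nonneg hl.le,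
      real_inner_comm, ← hc] at h2
    linarith
  have h3 := key ((‖g‖ ^ 2 + 1) / (-c)) (div_pos (by positivity) (by linarith))
  have h4 : 2 * ((‖g‖ ^ 2 + 1) / (-c)) * c = -2 * (‖g‖ ^ 2 + 1) := by
    have := hn.ne
    field_simp
  rw [h4] at h3
  nlinarith [sq_nonneg ‖g‖]

/-- The primitive of `g` vanishes wherever the kernel is positive, hence so does its
almost-everywhere derivative `g`. Rational right endpoints keep the union of exceptional sets null.
-/
theorem eq_zero_of_hasMemDeriv_zero (hμ : IsMemoryKernel μ δ) (hδ : 0 < δ)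
    {g : MemSpace μ X} (h : HasMemDeriv 0 g) : g = 0 := by
  have h0 : ∀ᵐ s ∂(memMeasure μ), ∫ y in (0 : ℝ)..s, g y = 0 := by
    filter_upwards [h, Lp.coeFn_zero X 2 (memMeasure μ)] with s h1 h2
    rw [← h1.2, h2]; rfl
  have key : ∀ q : ℚ, 0 < (q : ℝ) → 0 < μ q → ∀ᵐ y : ℝ, y ∈ Ioo (0 : ℝ) q → g y = 0 := by
    intro q hq hμq
    have hi := hμ.intervalIntegrable hδ hq hμq (Lp.memLp g)
    have hc : ContinuousOn (fun y => ∫ z in (0 : ℝ)..y, g z) (Icc 0 (q : ℝ)) := by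
      rw [← uIcc_of_le hq.le]
      exact intervalIntegral.continuousOn_primitive_interval' hi left_mem_uIcc
    have hz : EqOn (fun y => ∫ z in (0 : ℝ)..y, g z) (fun _ => 0) (Ioc 0 (q : ℝ)) :=
      Measure.eqOn_Ioc_of_ae_eq volume (hμ.ae_restrict hδ hq hμq h0)
        (hc.mono Ioc_subset_Icc_self) continuousOn_const
    filter_upwards [hi.ae_hasDerivAt_integral] with y hy hyq
    have h1 := hy (by rw [uIcc_of_le hq.le]; exact Ioo_subset_Icc_self hyq) 0 left_mem_uIcc
    have h2 : (fun y => ∫ z in (0 : ℝ)..y, g z) =ᶠ[𝓝 y] fun _ => 0 := by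
      filter_upwards [isOpen_Ioo.mem_nhds hyq] with z hz' using hz (Ioo_subset_Ioc_self hz')
    exact h1.unique ((hasDerivAt_const y (0 : X)).congr_of_eventuallyEq h2)
  rw [Lp.eq_zero_iff_ae_eq_zero]
  have h1 : ∀ᵐ y : ℝ, ∀ q : ℚ, 0 < (q : ℝ) → 0 < μ q → y ∈ Ioo (0 : ℝ) q → g y = 0 := by
    rw [ae_all_iff]
    intro q
    by_cases hq : 0 < (q : ℝ) ∧ 0 < μ q
    · filter_upwards [key q hq.1 hq.2] with y hy _ _ using hy
    · exact ae_of_all _ fun y h2 h3 => absurd ⟨h2, h3⟩ hq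
  have h2 : ∀ᵐ y ∂(memMeasure μ), ∀ q : ℚ, 0 < (q : ℝ) → 0 < μ q → y ∈ Ioo (0 : ℝ) q → g y = 0 :=
    (withDensity_absolutelyContinuous _ _).ae_le (ae_restrict_of_ae h1)
  filter_upwards [h2, hμ.ae_pos] with y hy hy0
  have h3 : ∀ᶠ z in 𝓝 y, 0 < μ z :=
    (hμ.continuousOn.continuousAt (Ici_mem_nhds hy0.1)).eventually_const_lt hy0.2
  obtain ⟨ε, hε, hball⟩ := Metric.eventually_nhds_iff.1 h3
  obtain ⟨q, hq1, hq2⟩ := exists_rat_btwn (show y < y + ε by linarith)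
  refine hy q (hy0.1.trans hq1) (hball ?_) ⟨hy0.1, hq1⟩
  rw [Real.dist_eq, abs_of_pos (sub_pos.2 hq1)]
  linarith

end IsMemoryKernel

theorem HasMemDeriv.add {η g η' g' : MemSpace μ X} (h : HasMemDeriv η g)
    (h' : HasMemDeriv η' g') (hμ : IsMemoryKernel μ δ) (hδ : 0 < δ) :
    HasMemDeriv (η + η') (g + g') := by
  filter_upwards [h, h', hμ.ae_pos, Lp.coeFn_add η η'] with s h1 h2 hs h3
  refine ⟨hμ.intervalIntegrable hδ hs.1 hs.2 (Lp.memLp _), ?_⟩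
  rw [h3, Pi.add_apply, h1.2, h2.2, ← intervalIntegral.integral_add h1.1 h2.1]
  refine intervalIntegral_congr_ae_restrict hs.1.le ?_
  filter_upwards [hμ.ae_restrict hδ hs.1 hs.2 (Lp.coeFn_add g g')] with y hy using hy.symm

theorem HasMemDeriv.smul {η g : MemSpace μ X} (h : HasMemDeriv η g) (c : ℝ)
    (hμ : IsMemoryKernel μ δ) (hδ : 0 < δ) : HasMemDeriv (c • η) (c • g) := by
  filter_upwards [h, hμ.ae_pos, Lp.coeFn_smul c η] with s h1 hs h3
  refine ⟨hμ.intervalIntegrable hδ hs.1 hs.2 (Lp.memLp _), ?_⟩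
  rw [h3, Pi.smul_apply, h1.2, ← intervalIntegral.integral_smul]
  refine intervalIntegral_congr_ae_restrict hs.1.le ?_
  filter_upwards [hμ.ae_restrict hδ hs.1 hs.2 (Lp.coeFn_smul c g)] with y hy using hy.symm

end MemDeriv

end ThermoPlate

namespace ThermoPlate

variable {H : Type*} [NormedAddCommGroup H] [InnerProductSpace ℝ H]

/-! ### Fourier coefficients in the spaces `F_s`. -/

namespace DiagOp

variable (A : DiagOp H)

/-- The coefficients of an element of `F_s`. -/
def coef {s : ℝ≥0} (x : A.F s) (k : ℕ) : ℝ := ⟪A.e k, A.incl s x⟫_ℝ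

theorem coef_add {s : ℝ≥0} (x y : A.F s) (k : ℕ) : A.coef (x + y) k = A.coef x k + A.coef y k := by
  simp only [coef, map_add, inner_add_right]

theorem coef_smul {s : ℝ≥0} (c : ℝ) (x : A.F s) (k : ℕ) : A.coef (c • x) k = c * A.coef x k := by
  simp only [coef, map_smul, real_inner_smul_right]

theorem coef_zero {s : ℝ≥0} (k : ℕ) : A.coef (0 : A.F s) k = 0 := by
  simp only [coef, map_zero, inner_zero_right]

theorem summable_sq (v : H) : Summable fun k => ⟪A.e k, v⟫_ℝ ^ 2 := by
  have h := (A.e.hasSum_inner_mul_inner v v).summable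
  refine h.congr fun k => ?_
  rw [real_inner_comm, sq]

theorem summable_coef {s : ℝ≥0} (x : A.F s) :
    Summable fun k => A.eig k ^ (2 * (s : ℝ)) * A.coef x k ^ 2 := A.incl_mem x

theorem hasSum_inner_F {s : ℝ≥0} (x y : A.F s) :
    HasSum (fun k => A.eig k ^ (2 * (s : ℝ)) * (A.coef x k * A.coef y k)) ⟪x, y⟫_ℝ := by
  have h := A.e.hasSum_inner_mul_inner (A.pow s (A.incl s x)) (A.pow s (A.incl s y))
  rw [inner_F]
  have e : ∀ k, ⟪A.pow s (A.incl s x), A.e k⟫_ℝ * ⟪A.e k, A.pow s (A.incl s y)⟫_ℝ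
      = A.eig k ^ (2 * (s : ℝ)) * (A.coef x k * A.coef y k) := fun k => by
    rw [real_inner_comm, A.inner_pow (A.incl_mem x), A.inner_pow (A.incl_mem y), two_mul,
      Real.rpow_add (A.eig_pos k), coef, coef]
    ring
  simpa only [e] using h

theorem hasSum_inner (v w : H) :
    HasSum (fun k => ⟪A.e k, v⟫_ℝ * ⟪A.e k, w⟫_ℝ) ⟪v, w⟫_ℝ := by
  have h := A.e.hasSum_inner_mul_inner v w
  simpa only [real_inner_comm v] using h

theorem norm_incl_le {s : ℝ≥0} (x : A.F s) :
    ‖A.incl s x‖ ≤ (A.eig 0 ^ (s : ℝ))⁻¹ * ‖x‖ := by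
  have h0 : 0 < A.eig 0 ^ (s : ℝ) := Real.rpow_pos_of_pos (A.eig_pos 0) _
  rw [le_inv_mul_iff₀ h0, ← sq_le_sq₀ (by positivity) (norm_nonneg _), mul_pow,
    ← real_inner_self_eq_norm_sq, ← real_inner_self_eq_norm_sq]
  refine hasSum_le (fun k => ?_) ((A.hasSum_inner _ _).mul_left _) (A.hasSum_inner_F x x)
  have h1 : (A.eig 0 ^ (s : ℝ)) ^ 2 ≤ A.eig k ^ (2 * (s : ℝ)) := by
    rw [mul_comm, Real.rpow_mul (A.eig_pos k).le, Real.rpow_two]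
    gcongr
    · exact (A.eig_pos 0).le
    · exact A.eig_mono (Nat.zero_le k)
  exact mul_le_mul_of_nonneg_right h1 (mul_self_nonneg _)

/-- The inclusion `F_s ⊆ H` as a bounded operator. -/
def inclL (s : ℝ≥0) : A.F s →L[ℝ] H :=
  (A.incl s).mkContinuous (A.eig 0 ^ (s : ℝ))⁻¹ A.norm_incl_le

theorem inclL_apply {s : ℝ≥0} (x : A.F s) : A.inclL s x = A.incl s x := rfl

theorem exists_coef_eq [CompleteSpace H] {s : ℝ≥0} {x : ℕ → ℝ}
    (hx : Summable fun k => A.eig k ^ (2 * (s : ℝ)) * x k ^ 2) :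
    ∃ y : A.F s, ∀ k, A.coef y k = x k := by
  have hp : ∀ k, 0 < A.eig k ^ (s : ℝ) := fun k => Real.rpow_pos_of_pos (A.eig_pos k) _
  have hm : Memℓp (fun k => A.eig k ^ (s : ℝ) * x k) 2 := by
    rw [memℓp_gen_iff (by norm_num)]
    refine hx.congr fun k => ?_
    rw [ENNReal.toReal_ofNat, Real.rpow_two, Real.norm_eq_abs, sq_abs, mul_pow, mul_comm 2,
      Real.rpow_mul (A.eig_pos k).le, Real.rpow_two]
  refine ⟨(A.powEquiv s).symm (A.e.repr.symm ⟨_, hm⟩), fun k => ?_⟩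
  have h1 := A.powEquiv_apply s ((A.powEquiv s).symm (A.e.repr.symm ⟨_, hm⟩))
  rw [LinearEquiv.apply_symm_apply] at h1
  have h2 := A.inner_pow (A.incl_mem ((A.powEquiv s).symm (A.e.repr.symm ⟨_, hm⟩))) k
  rw [← h1, ← A.e.repr_apply_apply, LinearIsometryEquiv.apply_symm_apply] at h2
  exact (mul_left_cancel₀ (hp k).ne' h2).symm

theorem eig_rpow_one (k : ℕ) : A.eig k ^ (2 * ((1 : ℝ≥0) : ℝ)) = A.eig k ^ 2 := by
  rw [NNReal.coe_one, mul_one, Real.rpow_two]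

theorem eig_rpow_half (k : ℕ) : A.eig k ^ (2 * ((1 / 2 : ℝ≥0) : ℝ)) = A.eig k := by
  have : 2 * ((1 / 2 : ℝ≥0) : ℝ) = 1 := by push_cast; norm_num
  rw [this, Real.rpow_one]

theorem inner_powIsometry_one (x : A.F 1) (k : ℕ) :
    ⟪A.e k, A.powIsometry 1 x⟫_ℝ = A.eig k * A.coef x k := by
  have := A.inner_pow (A.incl_mem x) k
  rw [NNReal.coe_one, Real.rpow_one] at this
  exact this

end DiagOp

/-! ### Constant histories, total memory, and the response to a constant source. -/

section MemConst

variable {μ : ℝ → ℝ} [IsFiniteMeasure (memMeasure μ)] {X : Type*} [NormedAddCommGroup X]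

variable (μ) in
/-- The constant functions in the memory space. -/
def memConst (x : X) : MemSpace μ X := Lp.const 2 (memMeasure μ) x

theorem coeFn_memConst (x : X) : ∀ᵐ s ∂(memMeasure μ), memConst μ x s = x :=
  Lp.coeFn_const _ _ _

theorem memConst_add (x y : X) : memConst μ (x + y) = memConst μ x + memConst μ y :=
  map_add (Lp.const 2 (memMeasure μ)) x y

theorem memConst_smul [NormedSpace ℝ X] (c : ℝ) (x : X) :
    memConst μ (c • x) = c • memConst μ x :=
  map_smul (Lp.constₗ 2 (memMeasure μ) ℝ) c x

theorem memConst_zero : memConst μ (0 : X) = 0 :=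
  map_zero (Lp.const 2 (memMeasure μ))

theorem memIntegrable (η : MemSpace μ X) : Integrable η (memMeasure μ) :=
  (Lp.memLp η).integrable one_le_two

end MemConst

section Memory

variable {μ : ℝ → ℝ} {δ : ℝ} {X : Type*} [NormedAddCommGroup X] [InnerProductSpace ℝ X]

/-- The total memory `∫ μ(s) η(s) ds`. -/
def memTotal (η : MemSpace μ X) : X := ∫ s, η s ∂(memMeasure μ)

theorem memTotal_zero : memTotal (0 : MemSpace μ X) = 0 := by
  rw [memTotal, integral_congr_ae (Lp.coeFn_zero X 2 (memMeasure μ))]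
  simp

theorem memTotal_smul (c : ℝ) (η : MemSpace μ X) : memTotal (c • η) = c • memTotal η := by
  rw [memTotal, integral_congr_ae (Lp.coeFn_smul c η)]
  exact integral_smul _ _

variable [IsFiniteMeasure (memMeasure μ)]

theorem memTotal_add (η ζ : MemSpace μ X) : memTotal (η + ζ) = memTotal η + memTotal ζ := by
  rw [memTotal, integral_congr_ae (Lp.coeFn_add η ζ)]
  exact integral_add (memIntegrable η) (memIntegrable ζ)

variable [CompleteSpace X]

/-- A constant history sees `η` only through its total memory. This is why the source terms of the
memory equations cancel the memory forces in the energy balance. -/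
theorem inner_memConst (η : MemSpace μ X) (x : X) : ⟪η, memConst μ x⟫_ℝ = ⟪memTotal η, x⟫_ℝ := by
  rw [real_inner_comm, L2.inner_def, real_inner_comm, memTotal, ← integral_inner (memIntegrable η)]
  refine integral_congr_ae ?_
  filter_upwards [coeFn_memConst (μ := μ) x] with s hs
  rw [hs]

theorem integral_coef [CompleteSpace H] {A : DiagOp H} {s : ℝ≥0} (η : MemSpace μ (A.F s))
    (c : ℝ) (k : ℕ) : ∫ r, c * ⟪A.e k, A.incl s (η r)⟫_ℝ ∂(memMeasure μ)
      = c * A.coef (memTotal η) k := by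
  rw [integral_const_mul, DiagOp.coef, ← A.inclL_apply, memTotal]
  have h := ((innerSL ℝ (A.e k)).comp (A.inclL s)).integral_comp_comm (memIntegrable η)
  simp only [ContinuousLinearMap.comp_apply, innerSL_apply_apply] at h
  rw [← h]
  rfl

/-- The solution of `η_s + l η = x`, `η(0) = 0` for constant `x`. -/
theorem IsMemoryKernel.exists_hasMemDeriv_const {l : ℝ} (hμ : IsMemoryKernel μ δ) (hδ : 0 < δ)
    (hl : 0 < l) : ∃ c : ℝ, 0 ≤ c ∧ ((∃ s, 0 < s ∧ μ s ≠ 0) → 0 < c) ∧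
      ∀ x : X, ∃ ζ : MemSpace μ X, HasMemDeriv ζ (memConst μ x - l • ζ) ∧ memTotal ζ = c • x := by
  have hk : ∀ s : ℝ, 0 < s → 0 < expConv l (fun _ => (1 : ℝ)) s := by
    intro s hs
    rw [expConv]
    refine intervalIntegral.intervalIntegral_pos_of_pos
      (Continuous.intervalIntegrable (by fun_prop) _ _) (fun y => ?_) hs
    simp only [smul_eq_mul, mul_one]
    positivity
  -- The scalar solution for source `1` determines the constant: the solution for source `x` is this
  -- function times `x`.
  obtain ⟨ζ₁, -, h1⟩ := hμ.exists_hasMemDeriv hδ hl (memConst μ (1 : ℝ))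
  have h2 : ∀ᵐ s ∂(memMeasure μ), ζ₁ s = expConv l (fun _ => (1 : ℝ)) s := by
    filter_upwards [h1, hμ.ae_pos] with s hs hs'
    rw [hs]
    refine expConv_congr hs'.1.le ?_
    exact hμ.ae_restrict hδ hs'.1 hs'.2 (coeFn_memConst (μ := μ) (1 : ℝ))
  refine ⟨memTotal ζ₁, ?_, ?_, fun x => ?_⟩
  · refine integral_nonneg_of_ae ?_
    filter_upwards [h2, hμ.ae_pos] with s hs hs'
    rw [hs]; exact (hk s hs'.1).le
  · rintro ⟨s, hs, hμs⟩
    have hμs' : 0 < μ s := (hμ.nonneg s hs.le).lt_of_ne' hμs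
    rw [memTotal, integral_pos_iff_support_of_nonneg_ae ?_ (memIntegrable ζ₁)]
    · have h3 : Function.support ζ₁ =ᵐ[memMeasure μ] univ := by
        rw [eventuallyEq_univ]
        filter_upwards [h2, hμ.ae_pos] with s hs hs'
        rw [Function.mem_support, hs]; exact (hk s hs'.1).ne'
      rw [measure_congr h3]
      -- A weighted measure of total mass zero would force the interval `(0, s]` to have Lebesgue
      -- measure zero.
      have h4 := hμ.restrict_le hδ hs hμs' univ
      rw [Measure.restrict_apply_univ, Real.volume_Ioc, sub_zero, Measure.smul_apply,
        smul_eq_mul] at h4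
      by_contra hn
      rw [not_lt, nonpos_iff_eq_zero] at hn
      rw [hn, mul_zero, nonpos_iff_eq_zero, ENNReal.ofReal_eq_zero] at h4
      linarith
    · filter_upwards [h2, hμ.ae_pos] with s hs hs'
      rw [hs]; exact (hk s hs'.1).le
  · obtain ⟨ζ, hζ, h3⟩ := hμ.exists_hasMemDeriv hδ hl (memConst μ x)
    refine ⟨ζ, hζ, ?_⟩
    rw [memTotal, memTotal, ← integral_smul_const]
    refine integral_congr_ae ?_
    filter_upwards [h2, h3, hμ.ae_pos] with s h4 h5 hs'
    rw [h4, h5, expConv_congr hs'.1.le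
      (hμ.ae_restrict hδ hs'.1 hs'.2 (coeFn_memConst (μ := μ) x)), expConv, expConv,
      ← intervalIntegral.integral_smul_const]
    simp only [smul_eq_mul, mul_one]

end Memory

end ThermoPlate

namespace ThermoPlate

variable {H : Type*} [NormedAddCommGroup H] [InnerProductSpace ℝ H]

/-! ### Components of the phase space, the energy scaling, and the operator in terms of
coefficients. -/

namespace Plate

variable {P : Plate H}

theorem inner_phase (U V : P.Phase) : ⟪U, V⟫_ℝ = ⟪compU U, compU V⟫_ℝ + (⟪compW U, compW V⟫_ℝ
    + (⟪compV U, compV V⟫_ℝ + (⟪compEtaBar U, compEtaBar V⟫_ℝ + ⟪compEta U, compEta V⟫_ℝ))) := by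
  simp only [WithLp.prod_inner_apply]
  rfl

theorem phase_ext {U V : P.Phase} (h₁ : compU U = compU V) (h₂ : compW U = compW V)
    (h₃ : compV U = compV V) (h₄ : compEtaBar U = compEtaBar V) (h₅ : compEta U = compEta V) :
    U = V := by
  rw [← sub_eq_zero, ← inner_self_eq_zero (𝕜 := ℝ), inner_phase]
  have e₁ : compU (U - V) = compU U - compU V := rfl
  have e₂ : compW (U - V) = compW U - compW V := rfl
  have e₃ : compV (U - V) = compV U - compV V := rfl
  have e₄ : compEtaBar (U - V) = compEtaBar U - compEtaBar V := rfl
  have e₅ : compEta (U - V) = compEta U - compEta V := rfl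
  rw [e₁, e₂, e₃, e₄, e₅, h₁, h₂, h₃, h₄, h₅]
  simp

/-- The element of the phase space with the given components. -/
def mkPhase (u : P.A.F 1) (w v : H) (ζ : MemSpace P.μ₁ (P.A.F 1))
    (η : MemSpace P.μ₂ (P.A.F (1 / 2))) : P.Phase :=
  WithLp.toLp 2 (u, WithLp.toLp 2 (w, WithLp.toLp 2 (v, WithLp.toLp 2 (ζ, η))))

theorem norm_sq_phase (U : P.Phase) : ‖U‖ ^ 2 = ‖compU U‖ ^ 2 + (‖compW U‖ ^ 2
    + (‖compV U‖ ^ 2 + (‖compEtaBar U‖ ^ 2 + ‖compEta U‖ ^ 2))) := by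
  simp only [← real_inner_self_eq_norm_sq, inner_phase]

theorem norm_compU_le (U : P.Phase) : ‖compU U‖ ≤ ‖U‖ := by
  rw [← sq_le_sq₀ (norm_nonneg _) (norm_nonneg _), norm_sq_phase U]
  nlinarith [sq_nonneg ‖compW U‖, sq_nonneg ‖compV U‖, sq_nonneg ‖compEtaBar U‖,
    sq_nonneg ‖compEta U‖]

theorem norm_compW_le (U : P.Phase) : ‖compW U‖ ≤ ‖U‖ := by
  rw [← sq_le_sq₀ (norm_nonneg _) (norm_nonneg _), norm_sq_phase U]
  nlinarith [sq_nonneg ‖compU U‖, sq_nonneg ‖compV U‖, sq_nonneg ‖compEtaBar U‖,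
    sq_nonneg ‖compEta U‖]

variable (P) in
/-- The displacement component as a bounded operator. -/
def compUL : P.Phase →L[ℝ] P.A.F 1 :=
  LinearMap.mkContinuous ⟨⟨compU, fun _ _ => rfl⟩, fun _ _ => rfl⟩ 1
    fun U => by rw [one_mul]; exact norm_compU_le U

variable (P) in
/-- The velocity component as a bounded operator. -/
def compWL : P.Phase →L[ℝ] H :=
  LinearMap.mkContinuous ⟨⟨compW, fun _ _ => rfl⟩, fun _ _ => rfl⟩ 1
    fun U => by rw [one_mul]; exact norm_compW_le U

variable (P) in
/-- Multiplication of the displacement component by a scalar. -/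
def scale (c : ℝ) : P.Phase →L[ℝ] P.Phase :=
  LinearMap.mkContinuous
    ⟨⟨fun U => WithLp.toLp 2 (c • U.fst, U.snd), fun U V => by
      refine phase_ext ?_ rfl rfl rfl rfl
      exact smul_add c (compU U) (compU V)⟩, fun r U => by
      refine phase_ext ?_ rfl rfl rfl rfl
      exact smul_comm c r (compU U)⟩ (|c| + 1) fun U => by
    rw [← sq_le_sq₀ (norm_nonneg _) (by positivity), mul_pow, norm_sq_phase, norm_sq_phase U]
    change ‖c • compU U‖ ^ 2 + (‖compW U‖ ^ 2
      + (‖compV U‖ ^ 2 + (‖compEtaBar U‖ ^ 2 + ‖compEta U‖ ^ 2))) ≤ _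
    rw [norm_smul, mul_pow, Real.norm_eq_abs]
    have h1 : |c| ^ 2 ≤ (|c| + 1) ^ 2 := by gcongr; linarith
    have h2 : 1 ≤ (|c| + 1) ^ 2 := by nlinarith [abs_nonneg c]
    have h3 := mul_le_mul_of_nonneg_right h1 (sq_nonneg ‖compU U‖)
    have h4 : 0 ≤ ‖compW U‖ ^ 2 + (‖compV U‖ ^ 2 + (‖compEtaBar U‖ ^ 2 + ‖compEta U‖ ^ 2)) := by
      positivity
    have h5 := mul_le_mul_of_nonneg_right h2 h4
    linarith

theorem compU_scale (c : ℝ) (U : P.Phase) : compU (P.scale c U) = c • compU U := rfl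

theorem scale_scale {c d : ℝ} (h : c * d = 1) (U : P.Phase) : P.scale c (P.scale d U) = U := by
  refine phase_ext ?_ rfl rfl rfl rfl
  rw [compU_scale, compU_scale, smul_smul, h, one_smul]

theorem inner_scale (c : ℝ) (U V : P.Phase) : ⟪P.scale c U, P.scale c V⟫_ℝ
    = c ^ 2 * ⟪compU U, compU V⟫_ℝ + (⟪compW U, compW V⟫_ℝ
    + (⟪compV U, compV V⟫_ℝ + (⟪compEtaBar U, compEtaBar V⟫_ℝ + ⟪compEta U, compEta V⟫_ℝ))) := by
  rw [inner_phase, compU_scale, compU_scale, real_inner_smul_left, real_inner_smul_right, sq,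
    mul_assoc]
  rfl

section Operator

variable [CompleteSpace H] [IsFiniteMeasure (memMeasure P.μ₁)] [IsFiniteMeasure (memMeasure P.μ₂)]

/-- Moves the memory integrals inside the coefficients, as coefficients of `memTotal`, and turns the
pointwise memory identities into identities in the memory spaces. -/
theorem linOp_iff {U V : P.Phase} : P.LinOp U V ↔
    ∃ (w : P.A.F 1) (v : P.A.F (1 / 2))
      (g₁ : MemSpace P.μ₁ (P.A.F 1)) (g₂ : MemSpace P.μ₂ (P.A.F (1 / 2))),
      P.A.incl 1 w = compW U ∧ P.A.incl (1 / 2) v = compV U ∧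
      HasMemDeriv (compEtaBar U) g₁ ∧ HasMemDeriv (compEta U) g₂ ∧
      compU V = w ∧
      (∀ k, ⟪P.A.e k, compW V⟫_ℝ =
        -(P.β * P.A.eig k ^ 2 * P.A.coef (compU U) k
          + P.A.eig k ^ 2 * P.A.coef (memTotal (compEtaBar U)) k
          - P.ν * P.A.eig k * P.A.coef v k)) ∧
      (∀ k, ⟪P.A.e k, compV V⟫_ℝ =
        -(P.ω * P.A.eig k * P.A.coef v k
          + P.A.eig k * P.A.coef (memTotal (compEta U)) k)
          - P.ν * P.A.eig k * P.A.coef w k) ∧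
      compEtaBar V = memConst P.μ₁ w - g₁ ∧ compEta V = memConst P.μ₂ v - g₂ := by
  unfold LinOp
  simp only [integral_coef]
  refine exists_congr fun w => exists_congr fun v => exists_congr fun g₁ =>
    exists_congr fun g₂ => ?_
  refine and_congr_right fun hw => and_congr_right fun hv => and_congr_right fun _ =>
    and_congr_right fun _ => and_congr_right fun _ => ?_
  rw [← hw, ← hv]
  refine and_congr Iff.rfl (and_congr Iff.rfl (and_congr ?_ ?_))
  · rw [Lp.ext_iff]
    constructor
    · intro h
      filter_upwards [h, Lp.coeFn_sub (memConst P.μ₁ w) g₁, coeFn_memConst (μ := P.μ₁) w]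
        with s h1 h2 h3
      rw [h1, h2, Pi.sub_apply, h3]; abel
    · intro h
      filter_upwards [h, Lp.coeFn_sub (memConst P.μ₁ w) g₁, coeFn_memConst (μ := P.μ₁) w]
        with s h1 h2 h3
      rw [h1, h2, Pi.sub_apply, h3]; abel
  · rw [Lp.ext_iff]
    constructor
    · intro h
      filter_upwards [h, Lp.coeFn_sub (memConst P.μ₂ v) g₂, coeFn_memConst (μ := P.μ₂) v]
        with s h1 h2 h3
      rw [h1, h2, Pi.sub_apply, h3]; abel
    · intro h
      filter_upwards [h, Lp.coeFn_sub (memConst P.μ₂ v) g₂, coeFn_memConst (μ := P.μ₂) v]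
        with s h1 h2 h3
      rw [h1, h2, Pi.sub_apply, h3]; abel

end Operator

end Plate

end ThermoPlate

namespace ThermoPlate

/-! ### Linearity, single-valuedness and dissipativity of the operator. -/

namespace Plate

variable {H : Type*} [NormedAddCommGroup H] [InnerProductSpace ℝ H] [CompleteSpace H]
  {P : Plate H} {δ₁ δ₂ : ℝ}

theorem LinOp.add (hδ₁ : 0 < δ₁) (hδ₂ : 0 < δ₂) (hμ₁ : IsMemoryKernel P.μ₁ δ₁)
    (hμ₂ : IsMemoryKernel P.μ₂ δ₂) {U V U' V' : P.Phase} (h : P.LinOp U V) (h' : P.LinOp U' V') :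
    P.LinOp (U + U') (V + V') := by
  have := hμ₁.isFiniteMeasure
  have := hμ₂.isFiniteMeasure
  rw [linOp_iff] at h h' ⊢
  obtain ⟨w, v, g₁, g₂, h1, h2, h3, h4, h5, h6, h7, h8, h9⟩ := h
  obtain ⟨w', v', g₁', g₂', h1', h2', h3', h4', h5', h6', h7', h8', h9'⟩ := h'
  have e₁ : compU (U + U') = compU U + compU U' := rfl
  have e₂ : compU (V + V') = compU V + compU V' := rfl
  have e₃ : compW (U + U') = compW U + compW U' := rfl
  have e₄ : compW (V + V') = compW V + compW V' := rfl
  have e₅ : compV (U + U') = compV U + compV U' := rfl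
  have e₆ : compV (V + V') = compV V + compV V' := rfl
  have e₇ : compEtaBar (U + U') = compEtaBar U + compEtaBar U' := rfl
  have e₈ : compEtaBar (V + V') = compEtaBar V + compEtaBar V' := rfl
  have e₉ : compEta (U + U') = compEta U + compEta U' := rfl
  have e₀ : compEta (V + V') = compEta V + compEta V' := rfl
  refine ⟨w + w', v + v', g₁ + g₁', g₂ + g₂', ?_, ?_, h3.add h3' hμ₁ hδ₁, h4.add h4' hμ₂ hδ₂,
    ?_, fun k => ?_, fun k => ?_, ?_, ?_⟩
  · rw [e₃, map_add, h1, h1']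
  · rw [e₅, map_add, h2, h2']
  · rw [e₂, h5, h5']
  · rw [e₄, e₁, e₇, inner_add_right, h6, h6', memTotal_add, P.A.coef_add, P.A.coef_add,
      P.A.coef_add]
    ring
  · rw [e₆, e₉, inner_add_right, h7, h7', memTotal_add, P.A.coef_add, P.A.coef_add,
      P.A.coef_add]
    ring
  · rw [e₈, h8, h8', memConst_add]; abel
  · rw [e₀, h9, h9', memConst_add]; abel

theorem LinOp.smul (hδ₁ : 0 < δ₁) (hδ₂ : 0 < δ₂) (hμ₁ : IsMemoryKernel P.μ₁ δ₁)
    (hμ₂ : IsMemoryKernel P.μ₂ δ₂) {U V : P.Phase} (h : P.LinOp U V) (c : ℝ) :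
    P.LinOp (c • U) (c • V) := by
  have := hμ₁.isFiniteMeasure
  have := hμ₂.isFiniteMeasure
  rw [linOp_iff] at h ⊢
  obtain ⟨w, v, g₁, g₂, h1, h2, h3, h4, h5, h6, h7, h8, h9⟩ := h
  have e₁ : compU (c • U) = c • compU U := rfl
  have e₂ : compU (c • V) = c • compU V := rfl
  have e₃ : compW (c • U) = c • compW U := rfl
  have e₄ : compW (c • V) = c • compW V := rfl
  have e₅ : compV (c • U) = c • compV U := rfl
  have e₆ : compV (c • V) = c • compV V := rfl
  have e₇ : compEtaBar (c • U) = c • compEtaBar U := rfl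
  have e₈ : compEtaBar (c • V) = c • compEtaBar V := rfl
  have e₉ : compEta (c • U) = c • compEta U := rfl
  have e₀ : compEta (c • V) = c • compEta V := rfl
  refine ⟨c • w, c • v, c • g₁, c • g₂, ?_, ?_, h3.smul c hμ₁ hδ₁, h4.smul c hμ₂ hδ₂,
    ?_, fun k => ?_, fun k => ?_, ?_, ?_⟩
  · rw [e₃, map_smul, h1]
  · rw [e₅, map_smul, h2]
  · rw [e₂, h5]
  · rw [e₄, e₁, e₇, real_inner_smul_right, h6, memTotal_smul, P.A.coef_smul, P.A.coef_smul,
      P.A.coef_smul]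
    ring
  · rw [e₆, e₉, real_inner_smul_right, h7, memTotal_smul, P.A.coef_smul, P.A.coef_smul,
      P.A.coef_smul]
    ring
  · rw [e₈, h8, memConst_smul, smul_sub]
  · rw [e₀, h9, memConst_smul, smul_sub]

theorem LinOp.eq_zero (hδ₁ : 0 < δ₁) (hδ₂ : 0 < δ₂) (hμ₁ : IsMemoryKernel P.μ₁ δ₁)
    (hμ₂ : IsMemoryKernel P.μ₂ δ₂) {V : P.Phase} (h : P.LinOp 0 V) : V = 0 := by
  have := hμ₁.isFiniteMeasure
  have := hμ₂.isFiniteMeasure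
  rw [linOp_iff] at h
  obtain ⟨w, v, g₁, g₂, h1, h2, h3, h4, h5, h6, h7, h8, h9⟩ := h
  have e₁ : compU (0 : P.Phase) = 0 := rfl
  have e₂ : compW (0 : P.Phase) = 0 := rfl
  have e₃ : compV (0 : P.Phase) = 0 := rfl
  have e₄ : compEtaBar (0 : P.Phase) = 0 := rfl
  have e₅ : compEta (0 : P.Phase) = 0 := rfl
  have hw : w = 0 := P.A.incl_injective 1 (by rw [h1, e₂, map_zero])
  have hv : v = 0 := P.A.incl_injective (1 / 2) (by rw [h2, e₃, map_zero])
  have hg₁ : g₁ = 0 := hμ₁.eq_zero_of_hasMemDeriv_zero hδ₁ h3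
  have hg₂ : g₂ = 0 := hμ₂.eq_zero_of_hasMemDeriv_zero hδ₂ h4
  rw [e₁, e₄, memTotal_zero] at h6
  rw [e₅, memTotal_zero] at h7
  subst hw hv hg₁ hg₂
  simp only [P.A.coef_zero, mul_zero, add_zero, sub_zero, neg_zero] at h6 h7
  rw [memConst_zero, sub_zero] at h8 h9
  refine phase_ext h5 ?_ ?_ h8 h9
  · exact P.A.ext_coef fun k => by rw [h6, e₂, inner_zero_right]
  · exact P.A.ext_coef fun k => by rw [h7, e₃, inner_zero_right]

theorem eq_of_hasSum_congr {f g : ℕ → ℝ} {x y : ℝ} (hf : HasSum f x) (hg : HasSum g y)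
    (h : ∀ k, f k = g k) : x = y := by
  obtain rfl := funext h
  exact hf.unique hg

/-- The energy dissipation. -/
theorem LinOp.dissipative (hω : 0 ≤ P.ω) (hδ₁ : 0 < δ₁) (hδ₂ : 0 < δ₂)
    (hμ₁ : IsMemoryKernel P.μ₁ δ₁) (hμ₂ : IsMemoryKernel P.μ₂ δ₂) {U V : P.Phase}
    (h : P.LinOp U V) : P.β * ⟪compU U, compU V⟫_ℝ + (⟪compW U, compW V⟫_ℝ
      + (⟪compV U, compV V⟫_ℝ + (⟪compEtaBar U, compEtaBar V⟫_ℝ + ⟪compEta U, compEta V⟫_ℝ)))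
      ≤ 0 := by
  have := hμ₁.isFiniteMeasure
  have := hμ₂.isFiniteMeasure
  rw [linOp_iff] at h
  obtain ⟨w, v, g₁, g₂, h1, h2, h3, h4, h5, h6, h7, h8, h9⟩ := h
  have s1 := P.A.hasSum_inner_F (compU U) w
  have s2 := P.A.hasSum_inner_F (memTotal (compEtaBar U)) w
  have s3 := P.A.hasSum_inner_F v v
  have s4 := P.A.hasSum_inner_F (memTotal (compEta U)) v
  have s5 := P.A.hasSum_inner (P.A.powIsometry 1 w) (P.A.incl (1 / 2) v)
  simp only [P.A.eig_rpow_one] at s1 s2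
  simp only [P.A.eig_rpow_half] at s3 s4
  simp only [P.A.inner_powIsometry_one] at s5
  have t1 := P.A.hasSum_inner (compW U) (compW V)
  have t2 := P.A.hasSum_inner (compV U) (compV V)
  -- The coupling series `s5` enters `r1` with a plus sign and `r2` with a minus sign, so it drops
  -- out of the sum. Summing coefficients avoids giving meaning to `A² u` in a negative space.
  have r1 := (((s1.mul_left P.β).add s2).sub (s5.mul_left P.ν)).neg
  have r2 := ((s3.mul_left P.ω).add s4).neg.sub (s5.mul_left P.ν)
  have q1 : ⟪compW U, compW V⟫_ℝ = -(P.β * ⟪compU U, w⟫_ℝ + ⟪memTotal (compEtaBar U), w⟫_ℝ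
      - P.ν * ⟪P.A.powIsometry 1 w, P.A.incl (1 / 2) v⟫_ℝ) := by
    refine eq_of_hasSum_congr t1 r1 fun k => ?_
    rw [h6, ← h1]
    simp only [DiagOp.coef]
    ring
  have q2 : ⟪compV U, compV V⟫_ℝ = -(P.ω * ⟪v, v⟫_ℝ + ⟪memTotal (compEta U), v⟫_ℝ)
      - P.ν * ⟪P.A.powIsometry 1 w, P.A.incl (1 / 2) v⟫_ℝ := by
    refine eq_of_hasSum_congr t2 r2 fun k => ?_
    rw [h7, ← h2]
    simp only [DiagOp.coef]
    ring
  have d1 := hμ₁.inner_nonneg_of_hasMemDeriv hδ₁ h3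
  have d2 := hμ₂.inner_nonneg_of_hasMemDeriv hδ₂ h4
  have d3 := mul_nonneg hω (real_inner_self_nonneg (x := v))
  rw [q1, q2, h5, h8, h9, inner_sub_right, inner_sub_right, inner_memConst, inner_memConst]
  linarith

end Plate

end ThermoPlate

/-! ### Surjectivity of `l - 𝓛` by solving a 2×2 system in every mode. -/

namespace ThermoPlate

/-- The resolvent equation for one Fourier mode. -/
theorem exists_mode {l b d t : ℝ} (hl : 0 < l) (hb : 0 < b) (hd : 0 < d) (ht : 0 < t)
    (n x y g k : ℝ) : ∃ w v : ℝ, (l + b * t ^ 2) * w - n * v = x + t ^ 2 * g ∧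
      (l + d * t) * v + n * w = y + t * k ∧
      b * (t ^ 2 * w ^ 2) + d * (t * v ^ 2) ≤
        l⁻¹ * x ^ 2 + l⁻¹ * y ^ 2 + b⁻¹ * (t ^ 2 * g ^ 2) + d⁻¹ * (t * k ^ 2) := by
  have hD : 0 < (l + b * t ^ 2) * (l + d * t) + n ^ 2 := by positivity
  -- Cramer's rule; the antisymmetric coupling makes the determinant positive.
  obtain ⟨w, hw⟩ : ∃ w, w = ((l + d * t) * (x + t ^ 2 * g) + n * (y + t * k))
    / ((l + b * t ^ 2) * (l + d * t) + n ^ 2) := ⟨_, rfl⟩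
  obtain ⟨v, hv⟩ : ∃ v, v = ((l + b * t ^ 2) * (y + t * k) - n * (x + t ^ 2 * g))
    / ((l + b * t ^ 2) * (l + d * t) + n ^ 2) := ⟨_, rfl⟩
  have h1 : (l + b * t ^ 2) * w - n * v = x + t ^ 2 * g := by
    rw [hw, hv]; field_simp; ring
  have h2 : (l + d * t) * v + n * w = y + t * k := by
    rw [hw, hv]; field_simp; ring
  refine ⟨w, v, h1, h2, ?_⟩
  have young : ∀ c p q : ℝ, 0 < c → 2 * (p * q) ≤ c * q ^ 2 + c⁻¹ * p ^ 2 := by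
    intro c p q hc
    have h : c * q ^ 2 + c⁻¹ * p ^ 2 - 2 * (p * q) = c * (q - c⁻¹ * p) ^ 2 := by
      field_simp; ring
    nlinarith [mul_nonneg hc.le (sq_nonneg (q - c⁻¹ * p))]
  -- Multiply the equations by `w` and `v` and add: the coupling cancels, and Young's inequality
  -- absorbs the right-hand side.
  have e : (l + b * t ^ 2) * w ^ 2 + (l + d * t) * v ^ 2
      = x * w + t ^ 2 * (g * w) + (y * v + t * (k * v)) := by
    linear_combination w * h1 + v * h2
  have y1 := young l x w hl
  have y2 := mul_le_mul_of_nonneg_left (young b g w hb) (sq_nonneg t)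
  have y3 := young l y v hl
  have y4 := mul_le_mul_of_nonneg_left (young d k v hd) ht.le
  have y5 : 0 ≤ l * w ^ 2 := by positivity
  have y6 : 0 ≤ l * v ^ 2 := by positivity
  linarith

namespace Plate

variable {H : Type*} [NormedAddCommGroup H] [InnerProductSpace ℝ H] [CompleteSpace H]
  {P : Plate H} {δ₁ δ₂ : ℝ}

/-- Put `u = (w + z) / l` with `z` the first component of `Z`, and split each memory component into
the response to the data and the response to the constant source `w` or `v`. The total memory of the
latter is `c₁ w` or `c₂ v`, leaving a diagonal system for `w` and `v` alone. -/
theorem exists_linOp (hβ : 0 < P.β) (hω : 0 ≤ P.ω) (hδ₁ : 0 < δ₁) (hδ₂ : 0 < δ₂)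
    (hμ₁ : IsMemoryKernel P.μ₁ δ₁) (hμ₂ : IsMemoryKernel P.μ₂ δ₂)
    (hωμ₂ : 0 < P.ω ∨ ∃ s, 0 < s ∧ P.μ₂ s ≠ 0) {l : ℝ} (hl : 0 < l) (Z : P.Phase) :
    ∃ U V : P.Phase, P.LinOp U V ∧ l • U - V = Z := by
  have := hμ₁.isFiniteMeasure
  have := hμ₂.isFiniteMeasure
  obtain ⟨ζ₁, hζ₁, -⟩ := hμ₁.exists_hasMemDeriv hδ₁ hl (compEtaBar Z)
  obtain ⟨ζ₂, hζ₂, -⟩ := hμ₂.exists_hasMemDeriv hδ₂ hl (compEta Z)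
  obtain ⟨c₁, hc₁, -, hx₁⟩ := hμ₁.exists_hasMemDeriv_const (X := P.A.F 1) hδ₁ hl
  obtain ⟨c₂, hc₂, hc₂', hx₂⟩ := hμ₂.exists_hasMemDeriv_const (X := P.A.F (1 / 2)) hδ₂ hl
  have hb : 0 < P.β / l + c₁ := by positivity
  -- Positivity of this coefficient is what places `v` in `F_{1/2}`: it comes from instantaneous
  -- heat conduction or from a nontrivial memory kernel.
  have hd : 0 < P.ω + c₂ := by
    rcases hωμ₂ with h | h
    · positivity
    · have := hc₂' h; positivity
  -- The data parts of `u` and of the memories, moved to the right-hand side; in the modes they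
  -- carry the factors `λ²` and `λ`.
  let g : P.A.F 1 := -((P.β / l) • compU Z + memTotal ζ₁)
  let q : P.A.F (1 / 2) := -memTotal ζ₂
  choose w v h1 h2 h3 using fun k => exists_mode hl hb hd (P.A.eig_pos k) (P.ν * P.A.eig k)
    ⟪P.A.e k, compW Z⟫_ℝ ⟪P.A.e k, compV Z⟫_ℝ (P.A.coef g k) (P.A.coef q k)
  have sg := P.A.summable_coef g
  have sq := P.A.summable_coef q
  simp only [P.A.eig_rpow_one] at sg
  simp only [P.A.eig_rpow_half] at sq
  have hsum := (((((P.A.summable_sq (compW Z)).mul_left l⁻¹).add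
    ((P.A.summable_sq (compV Z)).mul_left l⁻¹)).add (sg.mul_left (P.β / l + c₁)⁻¹)).add
    (sq.mul_left (P.ω + c₂)⁻¹))
  have n1 : ∀ k, 0 ≤ (P.β / l + c₁) * (P.A.eig k ^ 2 * w k ^ 2) := fun k => by positivity
  have n2 : ∀ k, 0 ≤ (P.ω + c₂) * (P.A.eig k * v k ^ 2) := fun k =>
    mul_nonneg hd.le (mul_nonneg (P.A.eig_pos k).le (sq_nonneg _))
  have sw : Summable fun k => P.A.eig k ^ 2 * w k ^ 2 := by
    refine (summable_mul_left_iff hb.ne').1 (Summable.of_nonneg_of_le n1 (fun k => ?_) hsum)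
    have := h3 k
    have := n2 k
    linarith
  have sv : Summable fun k => P.A.eig k * v k ^ 2 := by
    refine (summable_mul_left_iff hd.ne').1 (Summable.of_nonneg_of_le n2 (fun k => ?_) hsum)
    have := h3 k
    have := n1 k
    linarith
  obtain ⟨w', hw'⟩ := P.A.exists_coef_eq (s := 1) (x := w) (by simpa only [P.A.eig_rpow_one])
  obtain ⟨v', hv'⟩ := P.A.exists_coef_eq (s := 1 / 2) (x := v) (by simpa only [P.A.eig_rpow_half])
  obtain ⟨ξ₁, hξ₁, m₁⟩ := hx₁ w'
  obtain ⟨ξ₂, hξ₂, m₂⟩ := hx₂ v'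
  let U : P.Phase := mkPhase (l⁻¹ • (w' + compU Z)) (P.A.incl 1 w') (P.A.incl (1 / 2) v')
    (ζ₁ + ξ₁) (ζ₂ + ξ₂)
  have hUu : compU U = l⁻¹ • (w' + compU Z) := rfl
  have hUw : compW U = P.A.incl 1 w' := rfl
  have hUv : compV U = P.A.incl (1 / 2) v' := rfl
  have hU₁ : compEtaBar U = ζ₁ + ξ₁ := rfl
  have hU₂ : compEta U = ζ₂ + ξ₂ := rfl
  have e₁ : compU (l • U - Z) = l • compU U - compU Z := rfl
  have e₂ : compW (l • U - Z) = l • compW U - compW Z := rfl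
  have e₃ : compV (l • U - Z) = l • compV U - compV Z := rfl
  have e₄ : compEtaBar (l • U - Z) = l • compEtaBar U - compEtaBar Z := rfl
  have e₅ : compEta (l • U - Z) = l • compEta U - compEta Z := rfl
  have hg : ∀ k, P.A.coef g k = -(P.β / l * P.A.coef (compU Z) k + P.A.coef (memTotal ζ₁) k) := by
    intro k
    rw [← neg_one_mul, ← P.A.coef_smul, ← P.A.coef_add, ← P.A.coef_smul, neg_one_smul]
  have hq : ∀ k, P.A.coef q k = -P.A.coef (memTotal ζ₂) k := by
    intro k
    rw [← neg_one_mul, ← P.A.coef_smul, neg_one_smul]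
  refine ⟨U, l • U - Z, ?_, sub_sub_cancel _ _⟩
  rw [linOp_iff]
  refine ⟨w', v', _, _, rfl, rfl, hζ₁.add hξ₁ hμ₁ hδ₁, hζ₂.add hξ₂ hμ₂ hδ₂, ?_, fun k => ?_,
    fun k => ?_, ?_, ?_⟩
  · rw [e₁, hUu, smul_inv_smul₀ hl.ne', add_sub_cancel_right]
  · have h := h1 k
    rw [hg] at h
    rw [e₂, hUw, hUu, hU₁, inner_sub_right, real_inner_smul_right, memTotal_add, m₁,
      P.A.coef_smul, P.A.coef_add, P.A.coef_add, P.A.coef_smul, hw', hv']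
    change l * P.A.coef w' k - _ = _
    rw [hw']
    field_simp at h ⊢
    linear_combination h
  · have h := h2 k
    rw [hq] at h
    rw [e₃, hUv, hU₂, inner_sub_right, real_inner_smul_right, memTotal_add, m₂,
      P.A.coef_add, P.A.coef_smul, hw', hv']
    change l * P.A.coef v' k - _ = _
    rw [hv']
    linear_combination h
  · rw [e₄, hU₁, smul_add]; abel
  · rw [e₅, hU₂, smul_add]; abel

end Plate

end ThermoPlate

namespace ThermoPlate

/-! ### The semigroup of the linear plate, and velocity as derivative of displacement. -/

namespace Plate

variable {H : Type*} [NormedAddCommGroup H] [InnerProductSpace ℝ H]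
  {P : Plate H} {δ₁ δ₂ : ℝ}

/-- In the energy norm, `𝓛` is maximal dissipative. -/
theorem isMaxDissipative [CompleteSpace H] (hβ : 0 < P.β) (hω : 0 ≤ P.ω) (hδ₁ : 0 < δ₁)
    (hδ₂ : 0 < δ₂)
    (hμ₁ : IsMemoryKernel P.μ₁ δ₁) (hμ₂ : IsMemoryKernel P.μ₂ δ₂)
    (hωμ₂ : 0 < P.ω ∨ ∃ s, 0 < s ∧ P.μ₂ s ≠ 0) :
    IsMaxDissipative fun U V : P.Phase =>
      P.LinOp (P.scale (√P.β)⁻¹ U) (P.scale (√P.β)⁻¹ V) := by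
  -- `P.scale (√β)` carries the energy norm to the standard norm of the phase space, so the
  -- conjugated operator is dissipative for the latter.
  have hσ : √P.β ≠ 0 := (Real.sqrt_pos.2 hβ).ne'
  have h1 : √P.β * (√P.β)⁻¹ = 1 := mul_inv_cancel₀ hσ
  have h2 : (√P.β)⁻¹ * √P.β = 1 := inv_mul_cancel₀ hσ
  constructor
  · intro U V U' V' h h'
    rw [map_add, map_add]
    exact h.add hδ₁ hδ₂ hμ₁ hμ₂ h'
  · intro c U V h
    rw [map_smul, map_smul]
    exact h.smul hδ₁ hδ₂ hμ₁ hμ₂ c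
  · intro V h
    rw [map_zero] at h
    rw [← scale_scale h1 V, h.eq_zero hδ₁ hδ₂ hμ₁ hμ₂, map_zero]
  · intro U V h
    rw [← scale_scale h1 U, ← scale_scale h1 V, inner_scale, Real.sq_sqrt hβ.le]
    exact h.dissipative hω hδ₁ hδ₂ hμ₁ hμ₂
  · intro l hl Z
    obtain ⟨U, V, h, e⟩ := exists_linOp hβ hω hδ₁ hδ₂ hμ₁ hμ₂ hωμ₂ hl (P.scale (√P.β)⁻¹ Z)
    refine ⟨P.scale (√P.β) U, P.scale (√P.β) V, ?_, ?_⟩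
    · rwa [scale_scale h2, scale_scale h2]
    · rw [← map_smul, ← map_sub, e, scale_scale h1]

/-- Conjugating the contraction semigroup back by the scaling yields a semigroup that contracts the
energy norm and is bounded in the original one. -/
theorem exists_semigroup [CompleteSpace H] (hβ : 0 < P.β) (hω : 0 ≤ P.ω) (hδ₁ : 0 < δ₁)
    (hδ₂ : 0 < δ₂)
    (hμ₁ : IsMemoryKernel P.μ₁ δ₁) (hμ₂ : IsMemoryKernel P.μ₂ δ₂)
    (hωμ₂ : 0 < P.ω ∨ ∃ s, 0 < s ∧ P.μ₂ s ≠ 0) :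
    ∃ (E : ℝ → P.Phase →L[ℝ] P.Phase) (K : ℝ), IsBoundedSemigroup E K ∧ IsGenerator E P.LinOp ∧
      (∀ t U, ‖P.scale (√P.β) (E t U)‖ ≤ ‖P.scale (√P.β) U‖) ∧ Dense {U | ∃ V, P.LinOp U V} := by
  have hσ : √P.β ≠ 0 := (Real.sqrt_pos.2 hβ).ne'
  have h1 : √P.β * (√P.β)⁻¹ = 1 := mul_inv_cancel₀ hσ
  have h2 : (√P.β)⁻¹ * √P.β = 1 := inv_mul_cancel₀ hσ
  have hL := isMaxDissipative hβ hω hδ₁ hδ₂ hμ₁ hμ₂ hωμ₂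
  have hcont : ∀ t U, ‖P.scale (√P.β) (P.scale (√P.β)⁻¹ (hL.semigroup t (P.scale (√P.β) U)))‖
      ≤ ‖P.scale (√P.β) U‖ := fun t U => by
    rw [scale_scale h1]; exact hL.norm_semigroup_apply_le t _
  refine ⟨fun t => (P.scale (√P.β)⁻¹).comp ((hL.semigroup t).comp (P.scale (√P.β))),
    ‖P.scale (√P.β)⁻¹‖ * ‖P.scale (√P.β)‖, ⟨⟨?_, ?_, ?_⟩, ?_, ?_, by positivity⟩, ?_, hcont, ?_⟩
  · ext1 U
    rw [hL.semigroup_zero]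
    exact scale_scale h2 U
  · intro s t hs ht
    rw [hL.semigroup_add hs ht]
    ext1 U
    simp only [ContinuousLinearMap.comp_apply]
    rw [scale_scale h1]
  · intro U
    have := ((P.scale (√P.β)⁻¹).continuous.tendsto _).comp
      (hL.isC0Semigroup.tendsto (P.scale (√P.β) U))
    rw [scale_scale h2] at this
    exact this
  · intro t U
    refine ((P.scale (√P.β)⁻¹).le_opNorm _).trans ?_
    rw [mul_assoc]
    gcongr
    exact (hL.norm_semigroup_apply_le t _).trans ((P.scale (√P.β)).le_opNorm U)
  · intro t
    simp only [hL.semigroup_max]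
  · intro U V
    have h3 := hL.isGenerator (P.scale (√P.β) U) (P.scale (√P.β) V)
    rw [scale_scale h2, scale_scale h2] at h3
    rw [h3]
    constructor
    · intro h
      have := ((P.scale (√P.β)⁻¹).continuous.tendsto _).comp h
      rw [scale_scale h2] at this
      refine this.congr fun t => ?_
      simp only [Function.comp_apply, map_smul, map_sub, scale_scale h2,
        ContinuousLinearMap.comp_apply]
    · intro h
      have := ((P.scale (√P.β)).continuous.tendsto _).comp h
      refine this.congr fun t => ?_
      simp only [Function.comp_apply, map_smul, map_sub, scale_scale h1,
        ContinuousLinearMap.comp_apply]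
  · have h3 : Function.Surjective (P.scale (√P.β)⁻¹) := fun U => ⟨_, scale_scale h2 U⟩
    have h4 := h3.denseRange.dense_image (P.scale (√P.β)⁻¹).continuous hL.dense_domain
    refine h4.mono ?_
    rintro _ ⟨U, ⟨V, h⟩, rfl⟩
    exact ⟨_, h⟩

/-- The displacement is differentiable in `H` along the semigroup, and its derivative is the
velocity. -/
theorem tendsto_displacement {E : ℝ → P.Phase →L[ℝ] P.Phase} {K : ℝ}
    (hE : IsBoundedSemigroup E K) (hL : IsGenerator E P.LinOp)
    (hD : Dense {U | ∃ V, P.LinOp U V}) (U : P.Phase) :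
    Tendsto (fun h : ℝ => h⁻¹ • (((P.A.inclL 1).comp P.compUL) (E h U)
      - ((P.A.inclL 1).comp P.compUL) U)) (𝓝[>] 0) (𝓝 (P.compWL U)) := by
  set B := (P.A.inclL 1).comp P.compUL with hB
  have hK := hE.K_nonneg
  have hgen : ∀ U V, P.LinOp U V → B V = P.compWL U := by
    rintro U V ⟨w, v, g₁, g₂, h1, -, -, -, h5, -⟩
    have : B V = P.A.incl 1 (compU V) := rfl
    rw [this, h5, h1]; rfl
  -- The domain is invariant because the semigroup operators commute.
  have hdom : ∀ U V, P.LinOp U V → ∀ t, 0 ≤ t → P.LinOp (E t U) (E t V) := by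
    intro U V h t ht
    rw [hL] at h ⊢
    refine (((E t).continuous.tendsto _).comp h).congr' ?_
    filter_upwards [self_mem_nhdsWithin] with s (hs : 0 < s)
    simp only [Function.comp_apply, map_smul, map_sub]
    rw [← hE.add_apply ht hs.le, ← hE.add_apply hs.le ht, add_comm]
  -- For data in the domain the displacement has right derivative equal to the velocity, bounded by
  -- `K ‖U‖`. The resulting Lipschitz bound involves only `‖U‖`, hence extends to all data in
  -- `hlip'` and bounds the difference quotients uniformly.
  have hlip : ∀ U V, P.LinOp U V → ∀ h, 0 ≤ h → ‖B (E h U) - B U‖ ≤ K * ‖U‖ * h := by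
    intro U V hUV h hh
    have hd : ∀ t ∈ Ico 0 h,
        HasDerivWithinAt (fun t => B (E t U)) (P.compWL (E t U)) (Ici t) t := by
      intro t ht
      have h1 := (hL _ _).1 (hdom U V hUV t ht.1)
      have h2 := ((B.continuous.tendsto _).comp h1).comp (tendsto_sub_nhdsGT t)
      rw [hgen _ _ (hdom U V hUV t ht.1)] at h2
      rw [← hasDerivWithinAt_Ioi_iff_Ici, hasDerivWithinAt_iff_tendsto_slope' (by simp)]
      refine h2.congr' ?_
      filter_upwards [self_mem_nhdsWithin] with s (hs : t < s)
      simp only [Function.comp_apply, map_smul, map_sub, slope, vsub_eq_sub]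
      rw [← hE.add_apply (sub_pos.2 hs).le ht.1, sub_add_cancel]
    have h3 := norm_image_sub_le_of_norm_deriv_right_le_segment (C := K * ‖U‖)
      (B.continuous.comp (hE.continuous_orbit U)).continuousOn hd
      (fun t _ => (norm_compW_le _).trans (hE.bound t U)) h ⟨hh, le_rfl⟩
    simpa [hE.isC0.zero] using h3
  have hlip' : ∀ U, ∀ h, 0 ≤ h → ‖B (E h U) - B U‖ ≤ K * ‖U‖ * h := by
    intro U h hh
    have hc : IsClosed {U | ‖B (E h U) - B U‖ ≤ K * ‖U‖ * h} :=
      isClosed_le (((B.continuous.comp (E h).continuous).sub B.continuous).norm)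
        ((continuous_const.mul continuous_norm).mul continuous_const)
    have : closure {U | ∃ V, P.LinOp U V} ⊆ {U | ‖B (E h U) - B U‖ ≤ K * ‖U‖ * h} :=
      hc.closure_subset_iff.2 fun U ⟨V, hUV⟩ => hlip U V hUV h hh
    exact this (hD U)
  refine tendsto_apply_of_dense (T := fun (h : ℝ) U => h⁻¹ • (B (E h U) - B U))
    (S := fun U => P.compWL U) (K := max K 1) ?_ ?_ hD ?_ U
  · filter_upwards [self_mem_nhdsWithin] with h (hh : 0 < h) x y
    have e : h⁻¹ • (B (E h x) - B x) - h⁻¹ • (B (E h y) - B y)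
        = h⁻¹ • (B (E h (x - y)) - B (x - y)) := by
      simp only [map_sub, smul_sub]; abel
    rw [e, norm_smul, norm_inv, Real.norm_of_nonneg hh.le, inv_mul_le_iff₀ hh]
    refine (hlip' _ h hh.le).trans ?_
    rw [mul_comm]
    gcongr
    exact le_max_left _ _
  · intro x y
    rw [← map_sub]
    refine (norm_compW_le _).trans ?_
    exact le_mul_of_one_le_left (norm_nonneg _) (le_max_right _ _)
  · rintro U ⟨V, hUV⟩
    have h2 := (B.continuous.tendsto _).comp ((hL _ _).1 hUV)
    rw [hgen _ _ hUV] at h2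
    refine h2.congr fun h => ?_
    simp only [Function.comp_apply, map_smul, map_sub]

end Plate

end ThermoPlate

namespace ThermoPlate

/-! ### Lipschitz and Taylor bounds for `M` on compact subintervals of `[0, ∞)`. -/

section ScalarCalculus

variable {M : ℝ → ℝ}

theorem exists_bound_derivWithin {n : ℕ} (hM : ContDiffOn ℝ (n + 1) M (Ici 0)) (Q : ℝ) :
    ∃ m, 0 ≤ m ∧ ∀ s ∈ Icc 0 Q, |derivWithin M (Ici 0) s| ≤ m := by
  have hc : ContinuousOn (derivWithin M (Ici 0)) (Ici 0) :=
    hM.continuousOn_derivWithin (uniqueDiffOn_Ici 0) (by simp)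
  obtain ⟨m, hm⟩ := isCompact_Icc.exists_bound_of_continuousOn
    (hc.mono fun t (ht : t ∈ Icc 0 Q) => ht.1)
  exact ⟨|m|, abs_nonneg _, fun s hs => (hm s hs).trans (le_abs_self m)⟩

theorem abs_sub_le_of_derivWithin (hM : DifferentiableOn ℝ M (Ici 0)) {Q m : ℝ}
    (hm : ∀ s ∈ Icc 0 Q, |derivWithin M (Ici 0) s| ≤ m) {s t : ℝ} (hs : s ∈ Icc 0 Q)
    (ht : t ∈ Icc 0 Q) : |M t - M s| ≤ m * |t - s| :=
  (convex_Icc 0 Q).norm_image_sub_le_of_norm_hasDerivWithin_le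
    (fun r hr => ((hM r hr.1).hasDerivWithinAt.mono fun _ h => h.1)) hm hs ht

/-- Mean value inequality for `r ↦ M r - M'(s) r` between `s` and `t`, whose derivative is at most
`m |t - s|` by the same inequality for `M'`. -/
theorem exists_taylor_bound (hM : ContDiffOn ℝ 2 M (Ici 0)) (Q : ℝ) :
    ∃ m, 0 ≤ m ∧ ∀ s ∈ Icc 0 Q, ∀ t ∈ Icc 0 Q,
      |M t - M s - derivWithin M (Ici 0) s * (t - s)| ≤ m * |t - s| ^ 2 := by
  have hd : DifferentiableOn ℝ M (Ici 0) := hM.differentiableOn (by simp)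
  have hM' : ContDiffOn ℝ 1 (derivWithin M (Ici 0)) (Ici 0) :=
    hM.derivWithin (uniqueDiffOn_Ici 0) (by norm_num)
  obtain ⟨m, hm0, hm⟩ := exists_bound_derivWithin (n := 0) (by simpa using hM') Q
  refine ⟨m, hm0, fun s hs t ht => ?_⟩
  have hsub : uIcc s t ⊆ Icc 0 Q := uIcc_subset_Icc hs ht
  have h := (convex_uIcc s t).norm_image_sub_le_of_norm_hasDerivWithin_le
    (f := fun r => M r - derivWithin M (Ici 0) s * r)
    (f' := fun r => derivWithin M (Ici 0) r - derivWithin M (Ici 0) s) (C := m * |t - s|)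
    (fun r hr => by
      have := ((hd r (hsub hr).1).hasDerivWithinAt.mono fun _ h => (hsub h).1 :
        HasDerivWithinAt M _ (uIcc s t) r)
      simpa using this.fun_sub ((hasDerivWithinAt_id r _).const_mul (derivWithin M (Ici 0) s)))
    (fun r hr => by
      refine (abs_sub_le_of_derivWithin (hM'.differentiableOn (by simp)) hm hs (hsub hr)).trans ?_
      exact mul_le_mul_of_nonneg_left (abs_sub_left_of_mem_uIcc hr) hm0)
    left_mem_uIcc right_mem_uIcc
  have e : M t - M s - derivWithin M (Ici 0) s * (t - s)
      = (M t - derivWithin M (Ici 0) s * t) - (M s - derivWithin M (Ici 0) s * s) := by ring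
  rw [e, sq, ← mul_assoc]
  exact h

end ScalarCalculus

/-! ### Smoothness of Kirchhoff nonlinearities, for a nonnegative symmetric form `⟪B x, D x⟫`. -/

section Nonlinearity

variable {X Y : Type*} [NormedAddCommGroup X] [NormedSpace ℝ X]
  [NormedAddCommGroup Y] [InnerProductSpace ℝ Y] {B D : X →L[ℝ] Y}

theorem abs_inner_clm_le (B D : X →L[ℝ] Y) (x y : X) :
    |⟪B x, D y⟫_ℝ| ≤ ‖B‖ * ‖D‖ * (‖x‖ * ‖y‖) := by
  refine (abs_real_inner_le_norm _ _).trans ?_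
  calc ‖B x‖ * ‖D y‖ ≤ (‖B‖ * ‖x‖) * (‖D‖ * ‖y‖) := by
        gcongr
        · exact B.le_opNorm x
        · exact D.le_opNorm y
    _ = _ := by ring

/-- Factorization of a difference of squares; symmetry cancels the mixed terms. -/
theorem inner_clm_sub (hBD : ∀ x y, ⟪B x, D y⟫_ℝ = ⟪B y, D x⟫_ℝ) (x y : X) :
    ⟪B y, D y⟫_ℝ - ⟪B x, D x⟫_ℝ = ⟪B (x + y), D (y - x)⟫_ℝ := by
  have := hBD x y
  simp only [map_add, map_sub, inner_add_left, inner_sub_right]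
  linarith

theorem inner_clm_mem_Icc (h0 : ∀ x, 0 ≤ ⟪B x, D x⟫_ℝ) {R : ℝ} {x : X} (hx : ‖x‖ ≤ R) :
    ⟪B x, D x⟫_ℝ ∈ Icc 0 (‖B‖ * ‖D‖ * (R * R)) := by
  refine ⟨h0 x, (le_abs_self _).trans ((abs_inner_clm_le B D x x).trans ?_)⟩
  have := (norm_nonneg x).trans hx
  gcongr

theorem abs_inner_clm_sub_le (hBD : ∀ x y, ⟪B x, D y⟫_ℝ = ⟪B y, D x⟫_ℝ) {R : ℝ} {x y : X}
    (hx : ‖x‖ ≤ R) (hy : ‖y‖ ≤ R) :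
    |⟪B y, D y⟫_ℝ - ⟪B x, D x⟫_ℝ| ≤ ‖B‖ * ‖D‖ * (R + R) * ‖y - x‖ := by
  rw [inner_clm_sub hBD, mul_assoc]
  refine (abs_inner_clm_le B D _ _).trans ?_
  gcongr
  exact (norm_add_le x y).trans (add_le_add hx hy)

variable {M : ℝ → ℝ}

theorem exists_lip_comp (hBD : ∀ x y, ⟪B x, D y⟫_ℝ = ⟪B y, D x⟫_ℝ) (h0 : ∀ x, 0 ≤ ⟪B x, D x⟫_ℝ)
    (hM : ContDiffOn ℝ 2 M (Ici 0)) {R : ℝ} (hR : 0 ≤ R) :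
    ∃ l, 0 ≤ l ∧ ∀ x y, ‖x‖ ≤ R → ‖y‖ ≤ R →
      |M ⟪B y, D y⟫_ℝ - M ⟪B x, D x⟫_ℝ| ≤ l * ‖y - x‖ := by
  obtain ⟨m, hm0, hm⟩ := exists_bound_derivWithin (n := 1) (by exact_mod_cast hM)
    (‖B‖ * ‖D‖ * (R * R))
  refine ⟨m * (‖B‖ * ‖D‖ * (R + R)), by positivity, fun x y hx hy => ?_⟩
  refine (abs_sub_le_of_derivWithin (hM.differentiableOn (by simp)) hm
    (inner_clm_mem_Icc h0 hx) (inner_clm_mem_Icc h0 hy)).trans ?_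
  rw [mul_assoc]
  gcongr
  exact abs_inner_clm_sub_le hBD hx hy

theorem exists_bound_comp (h0 : ∀ x, 0 ≤ ⟪B x, D x⟫_ℝ)
    (hM : ContinuousOn M (Ici 0)) (R : ℝ) :
    ∃ m, 0 ≤ m ∧ ∀ x, ‖x‖ ≤ R → |M ⟪B x, D x⟫_ℝ| ≤ m := by
  obtain ⟨m, hm⟩ := isCompact_Icc.exists_bound_of_continuousOn
    (hM.mono fun t (ht : t ∈ Icc 0 (‖B‖ * ‖D‖ * (R * R))) => ht.1)
  exact ⟨|m|, abs_nonneg _, fun x hx =>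
    (hm _ (inner_clm_mem_Icc h0 hx)).trans (le_abs_self m)⟩

theorem exists_remainder_comp (hBD : ∀ x y, ⟪B x, D y⟫_ℝ = ⟪B y, D x⟫_ℝ)
    (h0 : ∀ x, 0 ≤ ⟪B x, D x⟫_ℝ) (hM : ContDiffOn ℝ 2 M (Ici 0)) (R : ℝ) :
    ∃ c, 0 ≤ c ∧ ∀ x y, ‖x‖ ≤ R → ‖y‖ ≤ R →
      |M ⟪B y, D y⟫_ℝ - M ⟪B x, D x⟫_ℝ
        - 2 * derivWithin M (Ici 0) ⟪B x, D x⟫_ℝ * ⟪B x, D (y - x)⟫_ℝ| ≤ c * ‖y - x‖ ^ 2 := by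
  obtain ⟨m, hm0, hm⟩ := exists_bound_derivWithin (n := 1) (by exact_mod_cast hM)
    (‖B‖ * ‖D‖ * (R * R))
  obtain ⟨c, hc0, hc⟩ := exists_taylor_bound hM (‖B‖ * ‖D‖ * (R * R))
  refine ⟨c * (‖B‖ * ‖D‖ * (R + R)) ^ 2 + m * (‖B‖ * ‖D‖), by positivity, fun x y hx hy => ?_⟩
  have hx' := inner_clm_mem_Icc (B := B) (D := D) h0 hx
  have hy' := inner_clm_mem_Icc (B := B) (D := D) h0 hy
  -- Taylor remainder of `M` at the value of the form, plus `M'` times the second-order part of the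
  -- form itself.
  have e : M ⟪B y, D y⟫_ℝ - M ⟪B x, D x⟫_ℝ
        - 2 * derivWithin M (Ici 0) ⟪B x, D x⟫_ℝ * ⟪B x, D (y - x)⟫_ℝ
      = (M ⟪B y, D y⟫_ℝ - M ⟪B x, D x⟫_ℝ
        - derivWithin M (Ici 0) ⟪B x, D x⟫_ℝ * (⟪B y, D y⟫_ℝ - ⟪B x, D x⟫_ℝ))
        + derivWithin M (Ici 0) ⟪B x, D x⟫_ℝ * ⟪B (y - x), D (y - x)⟫_ℝ := by
    rw [inner_clm_sub hBD]
    simp only [map_add, map_sub, inner_add_left, inner_sub_left, inner_sub_right]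
    ring
  rw [e]
  refine (abs_add_le _ _).trans ?_
  rw [abs_mul, add_mul]
  refine add_le_add ((hc _ hx' _ hy').trans ?_) ?_
  · rw [mul_assoc, ← mul_pow]
    gcongr
    exact abs_inner_clm_sub_le hBD hx hy
  · rw [mul_assoc, sq]
    gcongr
    · exact hm _ hx'
    · exact abs_inner_clm_le B D _ _

variable {V : Y →L[ℝ] X} {p : Y}

/-- For the plate, `B` is `U ↦ A u`, `D` is `U ↦ u` and `V` inserts a velocity. The form is bounded
on `F₁` and nonnegative, so `M` is evaluated only on a compact part of its domain. -/
theorem isLipOnBounded_of_kirchhoff (hBD : ∀ x y, ⟪B x, D y⟫_ℝ = ⟪B y, D x⟫_ℝ)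
    (h0 : ∀ x, 0 ≤ ⟪B x, D x⟫_ℝ) (hM : ContDiffOn ℝ 2 M (Ici 0)) :
    IsLipOnBounded fun x => V (-(M ⟪B x, D x⟫_ℝ • B x) + p) := by
  intro R
  rcases lt_or_ge R 0 with hR | hR
  · exact ⟨0, le_rfl, fun x y hx => absurd (hx.trans_lt hR) (not_lt.2 (norm_nonneg x))⟩
  obtain ⟨l, hl, hl'⟩ := exists_lip_comp hBD h0 hM hR
  obtain ⟨m, hm, hm'⟩ := exists_bound_comp h0 hM.continuousOn R
  refine ⟨‖V‖ * (m * ‖B‖ + l * (‖B‖ * R)), by positivity, fun x y hx hy => ?_⟩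
  rw [← map_sub, mul_assoc]
  refine (V.le_opNorm _).trans ?_
  gcongr
  have e : -(M ⟪B x, D x⟫_ℝ • B x) + p - (-(M ⟪B y, D y⟫_ℝ • B y) + p)
      = -(M ⟪B x, D x⟫_ℝ • B (x - y)) - (M ⟪B x, D x⟫_ℝ - M ⟪B y, D y⟫_ℝ) • B y := by
    rw [map_sub]; module
  rw [e]
  refine (norm_sub_le _ _).trans ?_
  rw [norm_neg, norm_smul, norm_smul, add_mul]
  refine add_le_add ?_ ?_
  · rw [mul_assoc]
    exact mul_le_mul (hm' x hx) (B.le_opNorm _) (norm_nonneg _) hm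
  · rw [mul_right_comm]
    refine mul_le_mul (hl' y x hy hx) ((B.le_opNorm y).trans ?_) (norm_nonneg _) (by positivity)
    gcongr

theorem isQuadraticDeriv_of_kirchhoff (hBD : ∀ x y, ⟪B x, D y⟫_ℝ = ⟪B y, D x⟫_ℝ)
    (h0 : ∀ x, 0 ≤ ⟪B x, D x⟫_ℝ) (hM : ContDiffOn ℝ 2 M (Ici 0)) :
    IsQuadraticDeriv (fun x => V (-(M ⟪B x, D x⟫_ℝ • B x) + p)) (fun x w =>
      V (-((2 * derivWithin M (Ici 0) ⟪B x, D x⟫_ℝ * ⟪B x, D w⟫_ℝ) • B x)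
        - M ⟪B x, D x⟫_ℝ • B w)) := by
  have hM' : ContinuousOn (derivWithin M (Ici 0)) (Ici 0) :=
    hM.continuousOn_derivWithin (uniqueDiffOn_Ici 0) (by norm_num)
  have hq : Continuous fun x : X × X => ⟪B x.1, D x.1⟫_ℝ := by fun_prop
  constructor
  · intro x w w'
    rw [← map_add]
    congr 1
    simp only [map_add, inner_add_right]
    module
  · intro x c w
    rw [← V.map_smul]
    congr 1
    simp only [map_smul, real_inner_smul_right]
    module
  · have c1 : Continuous fun x : X × X => M ⟪B x.1, D x.1⟫_ℝ :=
      hM.continuousOn.comp_continuous hq fun x => h0 x.1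
    have c2 : Continuous fun x : X × X => derivWithin M (Ici 0) ⟪B x.1, D x.1⟫_ℝ :=
      hM'.comp_continuous hq fun x => h0 x.1
    have c3 : Continuous fun x : X × X => ⟪B x.1, D x.2⟫_ℝ := by fun_prop
    have c4 : Continuous fun x : X × X => B x.1 := by fun_prop
    have c5 : Continuous fun x : X × X => B x.2 := by fun_prop
    exact V.continuous.comp (((((continuous_const.mul c2).mul c3).smul c4).neg).sub (c1.smul c5))
  · intro R
    rcases lt_or_ge R 0 with hR | hR
    · exact ⟨0, le_rfl, fun x w hx => absurd (hx.trans_lt hR) (not_lt.2 (norm_nonneg x))⟩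
    obtain ⟨m, hm, hm'⟩ := exists_bound_comp (B := B) (D := D) h0 hM.continuousOn R
    obtain ⟨d, hd, hd'⟩ := exists_bound_comp (B := B) (D := D) h0 hM' R
    refine ⟨‖V‖ * (2 * d * (‖B‖ * ‖D‖ * R) * (‖B‖ * R) + m * ‖B‖), by positivity,
      fun x w hx => ?_⟩
    refine (V.le_opNorm _).trans ?_
    rw [mul_assoc ‖V‖]
    gcongr
    refine (norm_sub_le _ _).trans ?_
    rw [norm_neg, norm_smul, norm_smul, add_mul, norm_mul, norm_mul, Real.norm_ofNat]
    refine add_le_add ?_ ?_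
    · have h1 : |⟪B x, D w⟫_ℝ| ≤ ‖B‖ * ‖D‖ * (R * ‖w‖) :=
        (abs_inner_clm_le B D x w).trans (by gcongr)
      calc 2 * ‖derivWithin M (Ici 0) ⟪B x, D x⟫_ℝ‖ * ‖⟪B x, D w⟫_ℝ‖ * ‖B x‖
          ≤ 2 * d * (‖B‖ * ‖D‖ * (R * ‖w‖)) * (‖B‖ * R) := by
            gcongr
            · exact hd' x hx
            · exact h1
            · exact (B.le_opNorm x).trans (by gcongr)
        _ = _ := by ring
    · rw [mul_assoc]
      exact mul_le_mul (hm' x hx) (B.le_opNorm _) (norm_nonneg _) hm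
  · intro R
    rcases lt_or_ge R 0 with hR | hR
    · exact ⟨0, le_rfl, fun x y hx => absurd (hx.trans_lt hR) (not_lt.2 (norm_nonneg x))⟩
    obtain ⟨l, hl, hl'⟩ := exists_lip_comp hBD h0 hM hR
    obtain ⟨c, hc, hc'⟩ := exists_remainder_comp hBD h0 hM R
    refine ⟨‖V‖ * (c * (‖B‖ * R) + l * ‖B‖), by positivity, fun x y hx hy => ?_⟩
    rw [← map_sub, ← map_sub, mul_assoc ‖V‖]
    refine (V.le_opNorm _).trans ?_
    gcongr
    have e : -(M ⟪B y, D y⟫_ℝ • B y) + p - (-(M ⟪B x, D x⟫_ℝ • B x) + p)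
          - (-((2 * derivWithin M (Ici 0) ⟪B x, D x⟫_ℝ * ⟪B x, D (y - x)⟫_ℝ) • B x)
            - M ⟪B x, D x⟫_ℝ • B (y - x))
        = -((M ⟪B y, D y⟫_ℝ - M ⟪B x, D x⟫_ℝ
            - 2 * derivWithin M (Ici 0) ⟪B x, D x⟫_ℝ * ⟪B x, D (y - x)⟫_ℝ) • B x)
          - (M ⟪B y, D y⟫_ℝ - M ⟪B x, D x⟫_ℝ) • B (y - x) := by
      simp only [map_sub B]; module
    rw [e]
    refine (norm_sub_le _ _).trans ?_
    rw [norm_neg, norm_smul, norm_smul, add_mul]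
    refine add_le_add ?_ ?_
    · calc _ ≤ (c * ‖y - x‖ ^ 2) * (‖B‖ * R) :=
            mul_le_mul (hc' x y hx hy) ((B.le_opNorm x).trans (by gcongr)) (norm_nonneg _)
              (by positivity)
        _ = _ := by ring
    · calc _ ≤ (l * ‖y - x‖) * (‖B‖ * ‖y - x‖) :=
            mul_le_mul (hl' x y hx hy) (B.le_opNorm _) (norm_nonneg _) (by positivity)
        _ = _ := by ring

end Nonlinearity

/-! ### The plate nonlinearity as an instance of the abstract form. -/

namespace Plate

variable {H : Type*} [NormedAddCommGroup H] [InnerProductSpace ℝ H] (P : Plate H)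

/-- `U ↦ A u`. -/
def stiffness : P.Phase →L[ℝ] H :=
  (P.A.powIsometry 1 : P.A.F 1 →L[ℝ] H).comp P.compUL

/-- `U ↦ u` as an element of `H`. -/
def displacement : P.Phase →L[ℝ] H := (P.A.inclL 1).comp P.compUL

/-- The inclusion of the velocities into the phase space. -/
def velocityL : H →L[ℝ] P.Phase :=
  LinearMap.mkContinuous ⟨⟨P.velocity, fun h h' => by
      refine phase_ext ?_ rfl ?_ ?_ ?_
      · exact (add_zero 0).symm
      · exact (add_zero 0).symm
      · exact (add_zero 0).symm
      · exact (add_zero 0).symm⟩, fun c h => by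
      refine phase_ext ?_ rfl ?_ ?_ ?_
      · exact (smul_zero c).symm
      · exact (smul_zero c).symm
      · exact (smul_zero c).symm
      · exact (smul_zero c).symm⟩ 1 fun h => by
    rw [one_mul, ← sq_le_sq₀ (norm_nonneg _) (norm_nonneg _), norm_sq_phase]
    change ‖(0 : P.A.F 1)‖ ^ 2 + (‖h‖ ^ 2 + (‖(0 : H)‖ ^ 2 + (‖(0 : MemSpace P.μ₁ (P.A.F 1))‖ ^ 2
      + ‖(0 : MemSpace P.μ₂ (P.A.F (1 / 2)))‖ ^ 2))) ≤ _
    simp only [norm_zero]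
    linarith

variable {P}

theorem inner_stiffness_displacement_comm (U V : P.Phase) :
    ⟪P.stiffness U, P.displacement V⟫_ℝ = ⟪P.stiffness V, P.displacement U⟫_ℝ := by
  refine eq_of_hasSum_congr (P.A.hasSum_inner _ _) (P.A.hasSum_inner _ _) fun k => ?_
  have h : ∀ U : P.Phase, ⟪P.A.e k, P.stiffness U⟫_ℝ = P.A.eig k * ⟪P.A.e k, P.displacement U⟫_ℝ :=
    fun U => P.A.inner_powIsometry_one (compU U) k
  rw [h, h]; ring

theorem _root_.ThermoPlate.DiagOp.norm_pow_half_sq (A : DiagOp H) (x : A.F 1) :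
    ‖A.pow (1 / 2) (A.incl 1 x)‖ ^ 2 = ⟪A.powIsometry 1 x, A.incl 1 x⟫_ℝ := by
  have h := A.hasSum_inner (A.powIsometry 1 x) (A.incl 1 x)
  have e : ∀ k, ⟪A.e k, A.powIsometry 1 x⟫_ℝ * ⟪A.e k, A.incl 1 x⟫_ℝ
      = A.eig k * ⟪A.e k, A.incl 1 x⟫_ℝ ^ 2 := fun k => by
    rw [A.inner_powIsometry_one, DiagOp.coef]; ring
  have hm : A.MemF (1 / 2) (A.incl 1 x) := by
    simp only [DiagOp.MemF, A.eig_rpow_half]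
    exact h.summable.congr e
  have hc : ((1 / 2 : ℝ≥0) : ℝ) = 1 / 2 := by push_cast; rfl
  have hp := A.inner_pow hm
  simp only [hc] at hp
  rw [← real_inner_self_eq_norm_sq]
  refine eq_of_hasSum_congr (A.hasSum_inner _ _) h fun k => ?_
  rw [e, hp, ← sq, mul_pow, ← Real.rpow_natCast, ← Real.rpow_mul (A.eig_pos k).le]
  norm_num

theorem norm_pow_half_sq (U : P.Phase) : ‖P.A.pow (1 / 2) (P.A.incl 1 (compU U))‖ ^ 2
    = ⟪P.stiffness U, P.displacement U⟫_ℝ :=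
  P.A.norm_pow_half_sq (compU U)

theorem f_eq : P.f = fun U => P.velocityL
    (-(P.M ⟪P.stiffness U, P.displacement U⟫_ℝ • P.stiffness U) + P.p) := by
  funext U
  rw [← norm_pow_half_sq]
  rfl

theorem f'_eq : P.f' = fun U W => P.velocityL
    (-((2 * derivWithin P.M (Ici 0) ⟪P.stiffness U, P.displacement U⟫_ℝ
      * ⟪P.stiffness U, P.displacement W⟫_ℝ) • P.stiffness U)
      - P.M ⟪P.stiffness U, P.displacement U⟫_ℝ • P.stiffness W) := by
  funext U W
  rw [← norm_pow_half_sq]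
  rfl

theorem inner_stiffness_displacement_nonneg (U : P.Phase) :
    0 ≤ ⟪P.stiffness U, P.displacement U⟫_ℝ := by
  rw [← norm_pow_half_sq]; positivity

theorem isLipOnBounded_f (hM : ContDiffOn ℝ 2 P.M (Ici 0)) : IsLipOnBounded P.f := by
  rw [f_eq]
  exact isLipOnBounded_of_kirchhoff inner_stiffness_displacement_comm
    inner_stiffness_displacement_nonneg hM

theorem isQuadraticDeriv_f (hM : ContDiffOn ℝ 2 P.M (Ici 0)) : IsQuadraticDeriv P.f P.f' := by
  rw [f_eq, f'_eq]
  exact isQuadraticDeriv_of_kirchhoff inner_stiffness_displacement_comm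
    inner_stiffness_displacement_nonneg hM

end Plate

end ThermoPlate

namespace ThermoPlate

/-! ### Right derivatives of the displacement and of the form `(Au, u)` along mild solutions. -/

namespace Plate

variable {H : Type*} [NormedAddCommGroup H] [InnerProductSpace ℝ H]
  {P : Plate H} {E : ℝ → P.Phase →L[ℝ] P.Phase} {K : ℝ}

theorem displacement_velocityL (h : H) : P.displacement (P.velocityL h) = 0 :=
  map_zero (P.A.inclL 1)

theorem inner_scale_velocityL (c : ℝ) (U : P.Phase) (h : H) :
    ⟪P.scale c U, P.scale c (P.velocityL h)⟫_ℝ = ⟪P.compWL U, h⟫_ℝ := by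
  rw [inner_scale]
  change c ^ 2 * ⟪compU U, (0 : P.A.F 1)⟫_ℝ + (⟪compW U, h⟫_ℝ + (⟪compV U, (0 : H)⟫_ℝ
    + (⟪compEtaBar U, (0 : MemSpace P.μ₁ (P.A.F 1))⟫_ℝ
    + ⟪compEta U, (0 : MemSpace P.μ₂ (P.A.F (1 / 2)))⟫_ℝ))) = _
  simp only [inner_zero_right, mul_zero, add_zero, zero_add]
  rfl

section Displacement

variable [CompleteSpace H]

theorem hasDerivWithinAt_displacement (hE : IsBoundedSemigroup E K)
    (hu : ∀ U, Tendsto (fun h : ℝ => h⁻¹ • (P.displacement (E h U) - P.displacement U)) (𝓝[>] 0)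
      (𝓝 (P.compWL U))) {g : ℝ → P.Phase} (hg : Continuous g) (U₀ : P.Phase) {s : ℝ} (hs : 0 ≤ s)
    (hgs : P.displacement (g s) = 0) :
    HasDerivWithinAt (fun t => P.displacement (duhamel E g U₀ t))
      (P.compWL (duhamel E g U₀ s)) (Ici s) s := by
  have := hE.hasDerivWithinAt_duhamel hu hg U₀ hs
  rwa [hgs, add_zero] at this

/-- In a mild solution with forcing in the velocity equation, the velocity is the time derivative
of the displacement. -/
theorem hasDerivWithinAt_of_isMildOn (hE : IsBoundedSemigroup E K)
    (hu : ∀ U, Tendsto (fun h : ℝ => h⁻¹ • (P.displacement (E h U) - P.displacement U)) (𝓝[>] 0)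
      (𝓝 (P.compWL U))) {G : ℝ → P.Phase → P.Phase} (hG : IsLocLip G)
    (hG0 : ∀ t U, P.displacement (G t U) = 0) {U₀ : P.Phase} {U : ℝ → P.Phase} {T : ℝ}
    (hU : IsMildOn E G U₀ T U) {t : ℝ} (ht : t ∈ Ico 0 T) :
    HasDerivWithinAt (fun τ => P.displacement (U τ)) (P.compWL (U t)) (Ici 0) t := by
  obtain ⟨g, hg, hgG, hUg⟩ := hU.exists_duhamel hG (ht.1.trans ht.2.le)
  have hc := hE.continuous_duhamel hg U₀
  have hw : Continuous fun s => P.compWL (duhamel E g U₀ s) := P.compWL.continuous.comp hc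
  -- The right derivative is continuous, so the displacement is the integral of the velocity;
  -- differentiating that integral gives the derivative within `[0, ∞)`.
  have key : ∀ s ∈ Icc 0 T, P.displacement (U s)
      = (∫ r in (0 : ℝ)..s, P.compWL (duhamel E g U₀ r)) + P.displacement U₀ := by
    intro s hs
    have h := intervalIntegral.integral_eq_sub_of_hasDeriv_right (a := 0) (b := s)
      (P.displacement.continuous.comp hc).continuousOn (fun r hr => by
        rw [min_eq_left hs.1, max_eq_right hs.1] at hr
        refine (hasDerivWithinAt_displacement hE hu hg U₀ hr.1.le ?_).mono Ioi_subset_Ici_self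
        rw [hgG r ⟨hr.1.le, hr.2.le.trans hs.2⟩, hG0]) (hw.intervalIntegrable 0 s)
    rw [h, hUg s hs, Function.comp_apply, Function.comp_apply, hE.duhamel_zero, sub_add_cancel]
  have ht' : t ∈ Icc 0 T := ⟨ht.1, ht.2.le⟩
  have hd := ((intervalIntegral.integral_hasDerivAt_right (hw.intervalIntegrable 0 t)
    hw.aestronglyMeasurable.stronglyMeasurableAtFilter hw.continuousAt).add_const
    (P.displacement U₀)).hasDerivWithinAt (s := Ici 0)
  rw [hUg t ht']
  refine hd.congr_of_eventuallyEq ?_ (key t ht')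
  filter_upwards [self_mem_nhdsWithin, mem_nhdsWithin_of_mem_nhds (Iio_mem_nhds ht.2)] with s h1 h2
  exact key s ⟨h1, h2.le⟩

/-- The right derivative of `‖A^{1/2} u‖²`. -/
theorem hasDerivWithinAt_inner_stiffness (hE : IsBoundedSemigroup E K)
    (hu : ∀ U, Tendsto (fun h : ℝ => h⁻¹ • (P.displacement (E h U) - P.displacement U)) (𝓝[>] 0)
      (𝓝 (P.compWL U))) {g : ℝ → P.Phase} (hg : Continuous g) (U₀ : P.Phase) {s : ℝ} (hs : 0 ≤ s)
    (hgs : P.displacement (g s) = 0) :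
    HasDerivWithinAt
      (fun t => ⟪P.stiffness (duhamel E g U₀ t), P.displacement (duhamel E g U₀ t)⟫_ℝ)
      (2 * ⟪P.stiffness (duhamel E g U₀ s), P.compWL (duhamel E g U₀ s)⟫_ℝ) (Ici s) s := by
  have hd := hasDerivWithinAt_displacement hE hu hg U₀ hs hgs
  rw [← hasDerivWithinAt_Ioi_iff_Ici, hasDerivWithinAt_iff_tendsto_slope' (by simp)] at hd ⊢
  have hc := hE.continuous_duhamel hg U₀
  -- Along a mild solution `A u` is only continuous while `u` is differentiable in `H`. The
  -- factorization of the increment as `(A(u(s) + u(t)), u(t) - u(s))` needs no more than that.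
  have h1 : Tendsto (fun t => P.stiffness (duhamel E g U₀ s + duhamel E g U₀ t)) (𝓝[>] s)
      (𝓝 (P.stiffness (duhamel E g U₀ s + duhamel E g U₀ s))) :=
    ((P.stiffness.continuous.comp (continuous_const.add hc)).tendsto s).mono_left
      nhdsWithin_le_nhds
  have h2 := h1.inner (𝕜 := ℝ) hd
  have e : ⟪P.stiffness (duhamel E g U₀ s + duhamel E g U₀ s), P.compWL (duhamel E g U₀ s)⟫_ℝ
      = 2 * ⟪P.stiffness (duhamel E g U₀ s), P.compWL (duhamel E g U₀ s)⟫_ℝ := by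
    rw [map_add, inner_add_left]; ring
  rw [e] at h2
  refine h2.congr fun t => ?_
  simp only [slope, vsub_eq_sub, smul_eq_mul]
  rw [inner_clm_sub inner_stiffness_displacement_comm, map_sub, real_inner_smul_right]

end Displacement

/-! ### The energy inequality and the a priori bound. -/

section Energy

variable (P) in
/-- Twice the energy. -/
def energy (U : P.Phase) : ℝ :=
  -- Extending `M` by the constant `M 0` to negative arguments makes the potential differentiable on
  -- both sides of zero.
  ‖P.scale (√P.β) U‖ ^ 2 + (∫ ξ in (0 : ℝ)..⟪P.stiffness U, P.displacement U⟫_ℝ, P.M (max ξ 0))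
    - 2 * ⟪P.p, P.displacement U⟫_ℝ

theorem hasDerivAt_primitive (hM : ContinuousOn P.M (Ici 0)) (z : ℝ) :
    HasDerivAt (fun z => ∫ ξ in (0 : ℝ)..z, P.M (max ξ 0)) (P.M (max z 0)) z := by
  have hc : Continuous fun ξ => P.M (max ξ 0) :=
    hM.comp_continuous (by fun_prop) fun ξ => mem_Ici.2 (le_max_right _ _)
  exact intervalIntegral.integral_hasDerivAt_right (hc.intervalIntegrable _ _)
    hc.aestronglyMeasurable.stronglyMeasurableAtFilter hc.continuousAt

theorem continuous_primitive (hM : ContinuousOn P.M (Ici 0)) :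
    Continuous fun z => ∫ ξ in (0 : ℝ)..z, P.M (max ξ 0) :=
  continuous_iff_continuousAt.2 fun z => (hasDerivAt_primitive hM z).continuousAt

theorem continuous_energy (hM : ContinuousOn P.M (Ici 0)) : Continuous P.energy := by
  have h1 : Continuous fun U : P.Phase => ⟪P.stiffness U, P.displacement U⟫_ℝ := by fun_prop
  exact ((P.scale (√P.β)).continuous.norm.pow 2 |>.add ((continuous_primitive hM).comp h1)).sub
    (continuous_const.mul (continuous_const.inner P.displacement.continuous))

/-- The linear flow does not increase the energy norm, and the work of the forcing, `2 (w,
-M(‖A^{1/2}u‖²) A u + p)`, is exactly minus the derivative of the potential terms. A function whose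
upper right slopes are at most zero is nonincreasing. -/
theorem energy_le [CompleteSpace H] (hE : IsBoundedSemigroup E K)
    (hR : ∀ t U, ‖P.scale (√P.β) (E t U)‖ ≤ ‖P.scale (√P.β) U‖)
    (hu : ∀ U, Tendsto (fun h : ℝ => h⁻¹ • (P.displacement (E h U) - P.displacement U)) (𝓝[>] 0)
      (𝓝 (P.compWL U))) (hM : ContinuousOn P.M (Ici 0)) {g : ℝ → P.Phase} (hg : Continuous g)
    {U₀ : P.Phase} {T : ℝ} (hgf : ∀ t ∈ Icc 0 T, g t = P.f (duhamel E g U₀ t)) {t : ℝ}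
    (ht : t ∈ Icc 0 T) : P.energy (duhamel E g U₀ t) ≤ P.energy U₀ := by
  have hc := hE.continuous_duhamel hg U₀
  refine image_le_of_liminf_slope_right_le_deriv_boundary (a := 0) (b := T)
    (f := fun t => P.energy (duhamel E g U₀ t)) (B := fun _ => P.energy U₀) (B' := fun _ => 0)
    ((continuous_energy hM).comp hc).continuousOn (by simp only [hE.duhamel_zero, le_refl])
    continuousOn_const (fun s _ => hasDerivWithinAt_const _ _ _) (fun s hs r hr => ?_) ht
  refine Eventually.frequently ?_
  have hgs := hgf s ⟨hs.1, hs.2.le⟩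
  rw [f_eq] at hgs
  set U := duhamel E g U₀ s with hU
  have hgs0 : P.displacement (g s) = 0 := by rw [hgs]; exact displacement_velocityL _
  have d1 := hasDerivWithinAt_inner_stiffness hE hu hg U₀ hs.1 hgs0
  have d2 := (hasDerivAt_primitive hM ⟪P.stiffness U, P.displacement U⟫_ℝ).comp_hasDerivWithinAt s d1
  have d3 := ((innerSL ℝ P.p).hasFDerivAt.comp_hasDerivWithinAt s
    (hasDerivWithinAt_displacement hE hu hg U₀ hs.1 hgs0)).const_mul 2
  have d4 := d2.fun_sub d3
  rw [← hasDerivWithinAt_Ioi_iff_Ici, hasDerivWithinAt_iff_tendsto_slope' (by simp)] at d4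
  rw [max_eq_left (inner_stiffness_displacement_nonneg U)] at d4
  set d := P.M ⟪P.stiffness U, P.displacement U⟫_ℝ * (2 * ⟪P.stiffness U, P.compWL U⟫_ℝ)
    - 2 * (innerSL ℝ P.p) (P.compWL U) with hd
  have e : 2 * ⟪P.scale (√P.β) U, P.scale (√P.β) (g s)⟫_ℝ = -d := by
    rw [hgs, inner_scale_velocityL, hd, innerSL_apply_apply, inner_add_right, inner_neg_right,
      real_inner_smul_right, real_inner_comm P.p, real_inner_comm (P.stiffness U)]
    ring
  -- The slack `r` is shared equally between the norm part and the potential part.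
  have h1 := hE.eventually_slope_lt hR hg U₀ hs.1 (r := -d + r / 2)
    (by rw [← hU, e]; linarith)
  have h2 := d4.eventually_lt_const (show d < d + r / 2 by linarith)
  filter_upwards [h1, h2] with t h1 h2
  have e2 : slope (fun t => P.energy (duhamel E g U₀ t)) s t
      = slope (fun t => ‖P.scale (√P.β) (duhamel E g U₀ t)‖ ^ 2) s t
        + slope (fun t => (∫ ξ in (0 : ℝ)..⟪P.stiffness (duhamel E g U₀ t),
            P.displacement (duhamel E g U₀ t)⟫_ℝ, P.M (max ξ 0))
          - 2 * (innerSL ℝ P.p) (P.displacement (duhamel E g U₀ t))) s t := by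
    simp only [slope, vsub_eq_sub, smul_eq_mul, energy, innerSL_apply_apply]
    ring
  rw [e2]
  have h2' : slope (fun t => (∫ ξ in (0 : ℝ)..⟪P.stiffness (duhamel E g U₀ t),
            P.displacement (duhamel E g U₀ t)⟫_ℝ, P.M (max ξ 0))
          - 2 * (innerSL ℝ P.p) (P.displacement (duhamel E g U₀ t))) s t < d + r / 2 := h2
  linarith

/-- The energy controls the norm up to the norm of the displacement in `H`. -/
theorem exists_norm_le_of_energy_le {a b : ℝ} (hβ : 0 < P.β) (ha : 0 < a)
    (hMab : ∀ z, 0 ≤ z → -a * z - b ≤ ∫ ξ in (0 : ℝ)..z, P.M ξ) (Z : ℝ) :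
    ∃ C c, 0 ≤ C ∧ 0 ≤ c ∧ ∀ U, P.energy U ≤ Z → ‖U‖ ≤ c * ‖P.displacement U‖ + C := by
  have hσ : √P.β ≠ 0 := (Real.sqrt_pos.2 hβ).ne'
  set κ := ‖P.scale (√P.β)⁻¹‖ with hκ
  -- This constant is what remains after completing the squares in `‖U‖` and in `‖P.displacement
  -- U‖`; see `h8`.
  have hA : 0 ≤ 2 * κ ^ 2 * (|Z| + |b|) + 2 * (κ ^ 2 * ‖P.p‖) ^ 2 := by positivity
  set A := 2 * κ ^ 2 * (|Z| + |b|) + 2 * (κ ^ 2 * ‖P.p‖) ^ 2 with hA'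
  refine ⟨A + 1, κ ^ 2 * a + 2, by positivity, by positivity, fun U hU => ?_⟩
  have h1 : ‖U‖ ≤ κ * ‖P.scale (√P.β) U‖ := by
    have := (P.scale (√P.β)⁻¹).le_opNorm (P.scale (√P.β) U)
    rwa [scale_scale (inv_mul_cancel₀ hσ)] at this
  set d := ‖P.displacement U‖ with hd
  -- Interpolating `‖A^{1/2}u‖²` between `F₁` and `H` leaves the negative part of the potential only
  -- linear in `‖U‖`, so it is absorbed for any size of `a`.
  have h2 : ⟪P.stiffness U, P.displacement U⟫_ℝ ≤ ‖U‖ * d := by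
    refine (real_inner_le_norm _ _).trans ?_
    gcongr
    refine le_trans (le_of_eq ?_) (norm_compU_le U)
    exact (P.A.powIsometry 1).norm_map _
  have h0 := inner_stiffness_displacement_nonneg U
  have h3 := hMab _ h0
  have h4 : ∫ ξ in (0 : ℝ)..⟪P.stiffness U, P.displacement U⟫_ℝ, P.M (max ξ 0)
      = ∫ ξ in (0 : ℝ)..⟪P.stiffness U, P.displacement U⟫_ℝ, P.M ξ := by
    refine intervalIntegral.integral_congr fun ξ hξ => ?_
    rw [uIcc_of_le h0] at hξ
    simp only [max_eq_left hξ.1]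
  have h5 : ⟪P.p, P.displacement U⟫_ℝ ≤ ‖P.p‖ * d := real_inner_le_norm _ _
  rw [energy, h4] at hU
  have h6 : ‖P.scale (√P.β) U‖ ^ 2 ≤ |Z| + |b| + a * (‖U‖ * d) + 2 * (‖P.p‖ * d) := by
    have := mul_le_mul_of_nonneg_left h2 ha.le
    linarith [le_abs_self Z, le_abs_self b]
  have h7 : ‖U‖ ^ 2 ≤ κ ^ 2 * (|Z| + |b| + a * (‖U‖ * d) + 2 * (‖P.p‖ * d)) := by
    calc ‖U‖ ^ 2 ≤ (κ * ‖P.scale (√P.β) U‖) ^ 2 := by gcongr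
      _ = κ ^ 2 * ‖P.scale (√P.β) U‖ ^ 2 := by ring
      _ ≤ _ := by gcongr
  have hd0 : 0 ≤ d := norm_nonneg _
  have h8 : ‖U‖ ^ 2 ≤ A + (κ ^ 2 * a * d) ^ 2 + 2 * d ^ 2 := by
    have e1 := sq_nonneg (‖U‖ - κ ^ 2 * a * d)
    have e2 := sq_nonneg (d - κ ^ 2 * ‖P.p‖)
    rw [hA']
    linarith
  refine abs_le_of_sq_le_sq' ?_ (by positivity) |>.2
  have hκa : 0 ≤ κ ^ 2 * a := by positivity
  have e3 : 0 ≤ A * (κ ^ 2 * a * d) := by positivity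
  have e4 : 0 ≤ A * d := by positivity
  have e5 : 0 ≤ κ ^ 2 * a * d := by positivity
  have e6 : 0 ≤ κ ^ 2 * a * d * d := by positivity
  have e7 : 0 ≤ A * A := by positivity
  nlinarith [sq_nonneg d]

/-- The energy bound gives `‖U‖ ≤ c ‖u‖ + C` with `u` measured in `H`, while the derivative of `u`
is at most `‖U‖`. Gronwall's inequality closes the loop on every finite interval, with constants
depending only on the size of the initial value. -/
theorem hasAPrioriBound_f [CompleteSpace H] {a b : ℝ} (hβ : 0 < P.β) (hE : IsBoundedSemigroup E K)
    (hR : ∀ t U, ‖P.scale (√P.β) (E t U)‖ ≤ ‖P.scale (√P.β) U‖)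
    (hu : ∀ U, Tendsto (fun h : ℝ => h⁻¹ • (P.displacement (E h U) - P.displacement U)) (𝓝[>] 0)
      (𝓝 (P.compWL U))) (hM : ContDiffOn ℝ 2 P.M (Ici 0)) (ha : 0 < a)
    (hMab : ∀ z, 0 ≤ z → -a * z - b ≤ ∫ ξ in (0 : ℝ)..z, P.M ξ) : HasAPrioriBound E P.f := by
  intro T R
  obtain ⟨m, hm, hm'⟩ := exists_bound_comp (B := P.stiffness) (D := P.displacement)
    inner_stiffness_displacement_nonneg (continuous_primitive hM.continuousOn).continuousOn R
  obtain ⟨C, c, hC, hc, hCc⟩ := exists_norm_le_of_energy_le (P := P) hβ ha hMab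
    ((‖P.scale (√P.β)‖ * |R|) ^ 2 + m + 2 * (‖P.p‖ * (‖P.displacement‖ * |R|)))
  refine ⟨c * gronwallBound (‖P.displacement‖ * |R|) c C T + C, ?_⟩
  intro U₀ hU₀ T' hT' U hU t ht
  have hU₀' : ‖U₀‖ ≤ |R| := hU₀.trans (le_abs_self R)
  have hD₀ : ‖P.displacement U₀‖ ≤ ‖P.displacement‖ * |R| :=
    (P.displacement.le_opNorm _).trans (by gcongr)
  obtain ⟨g, hg, hgf, hUg⟩ := hU.exists_duhamel (isLipOnBounded_f hM).isLocLip (ht.1.trans ht.2)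
  have hgf' : ∀ t ∈ Icc 0 T', g t = P.f (duhamel E g U₀ t) := fun t ht => by
    rw [hgf t ht, hUg t ht]
  have hbd : ∀ t ∈ Icc 0 T', ‖duhamel E g U₀ t‖ ≤ c * ‖P.displacement (duhamel E g U₀ t)‖ + C := by
    intro t ht
    refine hCc _ ((energy_le hE hR hu hM.continuousOn hg hgf' ht).trans ?_)
    have h1 : ‖P.scale (√P.β) U₀‖ ^ 2 ≤ (‖P.scale (√P.β)‖ * |R|) ^ 2 := by
      gcongr
      exact ((P.scale (√P.β)).le_opNorm _).trans (by gcongr)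
    have h2 := (le_abs_self _).trans (hm' U₀ hU₀)
    have h3 : -⟪P.p, P.displacement U₀⟫_ℝ ≤ ‖P.p‖ * (‖P.displacement‖ * |R|) := by
      refine (neg_le_abs _).trans ((abs_real_inner_le_norm _ _).trans ?_)
      gcongr
    rw [energy]
    linarith
  have hgr := norm_le_gronwallBound_of_norm_deriv_right_le
    (f := fun t => P.displacement (duhamel E g U₀ t))
    (f' := fun t => P.compWL (duhamel E g U₀ t)) (δ := ‖P.displacement‖ * |R|) (K := c) (ε := C)
    (a := 0) (b := T') (P.displacement.continuous.comp (hE.continuous_duhamel hg U₀)).continuousOn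
    (fun s hs => hasDerivWithinAt_displacement hE hu hg U₀ hs.1 (by
      rw [hgf' s ⟨hs.1, hs.2.le⟩, f_eq]; exact displacement_velocityL _))
    (by rw [hE.duhamel_zero]; exact hD₀)
    (fun s hs => (norm_compW_le _).trans (hbd s ⟨hs.1, hs.2.le⟩)) t ht
  rw [hUg t ht]
  refine (hbd t ht).trans ?_
  gcongr
  refine hgr.trans ?_
  exact gronwallBound_mono (by positivity) hC hc (by linarith [ht.2])

end Energy

end Plate

end ThermoPlate

end

/-! ### Assembly of the theorem. -/

theorem theorem2p10 {H : Type*} [NormedAddCommGroup H] [InnerProductSpace ℝ H] [CompleteSpace H]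
    (P : ThermoPlate.Plate H) (δ₁ δ₂ a b : ℝ)
    (hβ : 0 < P.β) (hν : 0 < P.ν) (hω : 0 ≤ P.ω) (hω1 : P.ω < 1)
    (hδ₁ : 0 < δ₁) (hδ₂ : 0 < δ₂)
    (hμ₁ : ThermoPlate.IsMemoryKernel P.μ₁ δ₁) (hμ₂ : ThermoPlate.IsMemoryKernel P.μ₂ δ₂)
    (hωμ₂ : 0 < P.ω ∨ ∃ s, 0 < s ∧ P.μ₂ s ≠ 0)
    (hM : ContDiffOn ℝ 2 P.M (Set.Ici 0))
    (ha : 0 < a) (ha1 : a < P.A.eig 0)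
    (hMab : ∀ z, 0 ≤ z → -a * z - b ≤ ∫ ξ in (0 : ℝ)..z, P.M ξ) :
    ∃ (E : ℝ → P.Phase →L[ℝ] P.Phase) (S : ℝ → P.Phase → P.Phase),
      -- `E t = e^{t𝓛}` is the linear semigroup generated by `𝓛`
      ThermoPlate.IsC0Semigroup E ∧ ThermoPlate.IsGenerator E P.LinOp ∧
      -- `S t U₀` is the mild solution of the nonlinear problem
      (∀ U₀, ThermoPlate.IsUniqueMildSolution E (fun _ U => P.f U) U₀ (fun t => S t U₀)) ∧
      -- Fréchet differentiability of `S t`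
      (∀ t, 0 ≤ t → Differentiable ℝ (S t)) ∧
      -- the derivative is given by the linearized problem
      ∀ U₀ W₀ : P.Phase, ∃ W : ℝ → P.Phase,
        ThermoPlate.IsUniqueMildSolution E (fun t V => P.f' (S t U₀) V) W₀ W ∧
        (∀ t, 0 ≤ t → HasDerivWithinAt (fun τ => P.A.incl 1 (ThermoPlate.Plate.compU (W τ)))
          (ThermoPlate.Plate.compW (W t)) (Set.Ici 0) t) ∧
        ∀ t, 0 ≤ t → fderiv ℝ (S t) U₀ W₀ = W t := by
  obtain ⟨E, K, hE, hL, hR, hD⟩ :=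
    ThermoPlate.Plate.exists_semigroup hβ hω hδ₁ hδ₂ hμ₁ hμ₂ hωμ₂
  have hu := ThermoPlate.Plate.tendsto_displacement hE hL hD
  have hf' := ThermoPlate.Plate.isQuadraticDeriv_f (P := P) hM
  obtain ⟨S, hS, hSd, hW⟩ := hE.exists_semiflow (ThermoPlate.Plate.isLipOnBounded_f hM)
    (ThermoPlate.Plate.hasAPrioriBound_f hβ hE hR hu hM ha hMab) hf'
  refine ⟨E, S, hE.isC0, hL, hS, hSd, fun U₀ W₀ => ?_⟩
  obtain ⟨W, h1, h2⟩ := hW U₀ W₀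
  refine ⟨W, h1, fun t ht => ?_, h2⟩
  -- The linearized forcing also acts only in the velocity equation. The interval is taken up to `t
  -- + 1` so that `t` lies strictly before its right end.
  refine ThermoPlate.Plate.hasDerivWithinAt_of_isMildOn hE hu (hf'.isLocLip (hS U₀).1.1)
    (fun s V => ?_) (h1.1.isMildOn (t + 1)) ⟨ht, lt_add_one t⟩
  rw [ThermoPlate.Plate.f'_eq]
  exact ThermoPlate.Plate.displacement_velocityL _
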